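/- Let $d\ge 1$ and $\alpha\in(1/2,\infty)^d$. Write $L^p=L^p((0,\infty)^d,dx)$ (real-valued functions, Lebesgue measure), and for $\mathbf g=(g_1,\dots,g_d)$ put $\|\mathbf g\|_p=\big(\int_{(0,\infty)^d}(\sum_{i=1}^d|g_i(x)|^2)^{p/2}\,dx\big)^{1/p}$. For $k\in\mathbb N^d$ (with $0\in\mathbb N$) let $\varphi_k^\alpha(x)=\prod_{i=1}^d\varphi_{k_i}^{\alpha_i}(x_i)$ be the $L^2$-normalized Laguerre functions of Hermite type, where $$\varphi_n^{a}(t)=\Big(\frac{2\,n!}{\Gamma(n+a+1)}\Big)^{1/2}L_n^{a}(t^2)\,t^{a+1/2}e^{-t^2/2},\qquad t>0,$$ and $L_n^a$ is the Laguerre polynomial of degree $n$ and type $a$. These are eigenfunctions of $L=-\Delta+|x|^2+\sum_{i=1}^d\frac{\alpha_i^2-1/4}{x_i^2}$ with eigenvalues $\lambda_k=4\sum_i k_i+2\sum_i\alpha_i+2d$. Let $\delta_i=\partial_{x_i}+x_i-\frac{\alpha_i+1/2}{x_i}$, and let $\mathbf R=(R_1,\dots,R_d)$ be the vector of Riesz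 transforms $R_i=\delta_iL^{-1/2}$, that is, $$R_if=\sum_{k\in\mathbb N^d}\lambda_k^{-1/2}\,\langle f,\varphi_k^\alpha\rangle_{L^2}\,\delta_i\varphi_k^\alpha,\qquad f\in L^2,$$ where the series converges unconditionally in $L^2$. Then for every $1<p<\infty$ the operator $\mathbf R$, restricted to $L^2\cap L^p$, extends uniquely to a bounded linear operator from $L^p$ to $L^p((0,\infty)^d,dx;\mathbb R^d)$, still denoted by $\mathbf R$, and $$\|\mathbf Rf\|_p\le 24\big(1+\sqrt{C(\alpha)}\big)(p^*-1)\|f\|_p,\qquad f\in L^p,$$ where $C(\alpha)=\max_{1\le i\le d}\frac{\alpha_i+1/2}{\alpha_i-1/2}$ and $p^*=\max\big(p,\frac p{p-1}\big)$. -/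

import Mathlib

open MeasureTheory Filter Topology
open scoped ENNReal

namespace LaguerreHermite

noncomputable section

/-- The Laguerre polynomial `L_k^a` of type `a > -1`:
`L_k^a(x) = ∑_{j ≤ k} (-1)^j Γ(k+a+1) / (Γ(j+a+1) (k-j)! j!) x^j`. -/
def laguerre (a : ℝ) (k : ℕ) (x : ℝ) : ℝ :=
  ∑ j ∈ Finset.range (k + 1),
    (-1) ^ j * Real.Gamma (k + a + 1) /
      (Real.Gamma (j + a + 1) * (Nat.factorial (k - j) : ℝ) * (Nat.factorial j : ℝ)) * x ^ j

/-- The one-dimensional Laguerre function of Hermite type, normalized in `L²((0,∞), dx)`: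
`φ_k^a(x) = (2 k! / Γ(k+a+1))^{1/2} L_k^a(x²) x^{a+1/2} e^{-x²/2}`. -/
def phi1 (a : ℝ) (k : ℕ) (x : ℝ) : ℝ :=
  Real.sqrt (2 * (Nat.factorial k : ℝ) / Real.Gamma (k + a + 1)) *
    laguerre a k (x ^ 2) * x ^ (a + 1 / 2) * Real.exp (-x ^ 2 / 2)

/-- The multi-dimensional Laguerre function of Hermite type (a tensor product). -/
def phi {d : ℕ} (α : Fin d → ℝ) (k : Fin d → ℕ) (x : Fin d → ℝ) : ℝ :=
  ∏ i, phi1 (α i) (k i) (x i)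

/-- Lebesgue measure on `(0,∞)^d`. -/
def mu (d : ℕ) : Measure (Fin d → ℝ) :=
  volume.restrict (Set.univ.pi fun _ => Set.Ioi 0)

/-- The eigenvalue `λ_k = 4|k| + 2|α| + 2d` of
`L = -Δ + |x|² + ∑ (α_i² - 1/4) / x_i²` at the eigenfunction `φ_k^α`. -/
def eigenvalue {d : ℕ} (α : Fin d → ℝ) (k : Fin d → ℕ) : ℝ :=
  4 * (∑ i, (k i : ℝ)) + 2 * (∑ i, α i) + 2 * d

/-- The partial derivative in the `i`-th variable. -/
def partialDeriv {d : ℕ} (i : Fin d) (g : (Fin d → ℝ) → ℝ) (x : Fin d → ℝ) : ℝ :=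
  deriv (fun t : ℝ => g (Function.update x i t)) (x i)

/-- The operator `δ_i = ∂_{x_i} + x_i - (α_i + 1/2) / x_i`. -/
def delta {d : ℕ} (α : Fin d → ℝ) (i : Fin d) (g : (Fin d → ℝ) → ℝ) (x : Fin d → ℝ) : ℝ :=
  partialDeriv i g x + (x i - (α i + 1 / 2) / x i) * g x

/-- The coefficient `⟨f, φ_k^α⟩` in `L²((0,∞)^d, dx)`. -/
def coeff {d : ℕ} (α : Fin d → ℝ) (f : (Fin d → ℝ) → ℝ) (k : Fin d → ℕ) : ℝ :=
  ∫ x, f x * phi α k x ∂(mu d)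

/-- `g = R_i f`, where `R_i = δ_i L^{-1/2}` is the `i`-th Riesz transform on `L²`: the function `g`
belongs to `L²` and it is the sum of the unconditionally `L²`-convergent series
`∑_k λ_k^{-1/2} ⟨f, φ_k^α⟩ δ_i φ_k^α`. -/
def IsRieszTransform {d : ℕ} (α : Fin d → ℝ) (i : Fin d) (f g : (Fin d → ℝ) → ℝ) : Prop :=
  MemLp g 2 (mu d) ∧
    Tendsto (fun s : Finset (Fin d → ℕ) =>
      eLpNorm (fun x => g x -
        ∑ k ∈ s, eigenvalue α k ^ (-(1 / 2) : ℝ) * coeff α f k * delta α i (phi α k) x) 2 (mu d))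
      atTop (𝓝 0)

/-- `T` extends the vector `𝐑 = (R_1, …, R_d)` of Riesz transforms from `L² ∩ L^p` to `L^p`. -/
def ExtendsRiesz {d : ℕ} (α : Fin d → ℝ) (p : ℝ≥0∞) [Fact (1 ≤ p)]
    (T : Lp ℝ p (mu d) →L[ℝ] Lp (EuclideanSpace ℝ (Fin d)) p (mu d)) : Prop :=
  ∀ f : Lp ℝ p (mu d), MemLp f 2 (mu d) → ∀ i, IsRieszTransform α i f (fun x => T f x i)

/-- `C(α) = max_i (α_i + 1/2) / (α_i - 1/2)`. -/
def constC {d : ℕ} [NeZero d] (α : Fin d → ℝ) : ℝ :=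
  Finset.univ.sup' Finset.univ_nonempty fun i => (α i + 1 / 2) / (α i - 1 / 2)

/-- `p^* = max(p, p/(p-1))`. -/
def pStar (p : ℝ) : ℝ := max p (p / (p - 1))

end

end LaguerreHermite

/-!
The argument rests on two facts: the operators `δ_i` move between Laguerre systems of neighbouring
types, and a Bellman function turns this into an `L^p` estimate with explicit constants.

**Ladder structure.** In one dimension `δ φ_k^a = -2 √k φ_{k-1}^{a+1}` (`hasDerivAt_phi1`), so
`δ_i φ_k^α = -2 √k_i φ_{k-e_i}^{α+e_i}` (`delta_phi_eq`). The Laguerre functions of a fixed type are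
orthonormal (`integral_phi_mul`) and `4 k_i ≤ λ_k`; hence the series of `R_i f` is an orthogonal
series of type `α + e_i` with square-summable coefficients, and it converges unconditionally in `L²`
(`exists_isRieszTransform`).

**Bilinear form.** For finite combinations `f = ∑ c_k φ_k^α` and `g_i` of type `α + e_i`, let
`U = ∑ c_k e^{-t √λ_k} φ_k^α`, and let `V_i` be the Poisson extension of `g_i` for
`M_i = L + [δ_i, δ_i^*]`, whose eigenfunctions `φ_m^{α+e_i}` have the eigenvalues `λ_m^{α+e_i} + 2`,
so that `φ_{k-e_i}^{α+e_i}` has the eigenvalue `λ_k`. Both extensions decay at the same rate, and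
`∑ ⟨R_i f, g_i⟩ = -4 ∫₀^∞ t ∫ ∑ δ_i U ∂_t V_i dx dt` (`integral_mul_integral_rieszPsi`). The
potential `r` of `L` dominates the zero-order part of the `δ_i` up to the factor `C(α)`, so the
integrand is at most `1 + √C(α)` times the product of the lengths of the generalized gradients
`(∂_t, ∇, √r)` of `U` and `V` (`rieszPsi_sq_le`). The potentials of the `M_i` are at least `r`.

**Bellman function.** The function `bell` of `n = |U|²` and `w = |V|²` is of size
`w^{q/2} + n^{p/2}` (`bell_sub_le`), and along straight lines its second derivative is at
least `τ |U'|² + τ⁻¹ |V'|²` with a weight `τ` (`bell_form`). Together with the equations satisfied by `U`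
and `V`, its space-time Laplacian is therefore at least twice the product of the lengths of the
generalized gradients (`two_mul_le_laplacian`). Integrated against `t dt dx`, the spatial part of
the Laplacian vanishes and the time part gives the value at `t = 0` (`integral_bellB2`,
`integral_mul_bellT2`), whence `bilinear_embedding`. All differentiations and boundary terms are
harmless because finite combinations of Laguerre functions have Gaussian decay and, as `α_i > 1/2`,
vanish to first order at the boundary of the orthant. For `p ≥ 2` the embedding is applied to
`(U, V)`, for `p ≤ 2` to `(V, U)`; scaling gives the constant `24 (1 + √C(α)) (p^* - 1)`
(`rieszForm_le`), and duality the `L^p` bound on finite combinations (`norm_rieszLp_le`).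

**Extension.** Finite combinations are dense in `L^p` (`exists_comb_eLpNorm_sub_le`), so the bound
extends. For the density, a function with compact support in the orthant is divided by the
ground state and approximated by polynomials in the `exp (-x_i² / 16)`; these exponentials are
expanded in Taylor series, which converge in a Gaussian-weighted uniform norm
(`approx_of_hasCompactSupport`). The same approximation shows that a function, of any integrability
class in question, is determined by its integrals against the `φ_k^β`
(`ae_eq_zero_of_integral_mul_phi`). This identifies the extension with `𝐑` on `L² ∩ L^p`
(`extendsRiesz_rieszExt`) and gives its uniqueness.
-/

namespace LaguerreHermite

noncomputable section

section

/-! ### Ladder relations for the one-dimensional Laguerre functions -/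

/-- The coefficient of `x ^ j` in `laguerre a k`. -/
def laguerreCoeff (a : ℝ) (k j : ℕ) : ℝ :=
  (-1) ^ j * Real.Gamma (k + a + 1) /
    (Real.Gamma (j + a + 1) * (Nat.factorial (k - j) : ℝ) * (Nat.factorial j : ℝ))

lemma laguerre_eq (a : ℝ) (k : ℕ) (x : ℝ) :
    laguerre a k x = ∑ j ∈ Finset.range (k + 1), laguerreCoeff a k j * x ^ j := rfl

lemma succ_mul_laguerreCoeff_succ (a : ℝ) (k j : ℕ) :
    ((j : ℝ) + 1) * laguerreCoeff a (k + 1) (j + 1) = -laguerreCoeff (a + 1) k j := by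
  unfold laguerreCoeff
  have h1 : ((k + 1 : ℕ) : ℝ) + a + 1 = k + (a + 1) + 1 := by push_cast; ring
  have h2 : ((j + 1 : ℕ) : ℝ) + a + 1 = j + (a + 1) + 1 := by push_cast; ring
  rw [h1, h2, Nat.factorial_succ, Nat.add_sub_add_right]
  have hj : ((j : ℝ) + 1) ≠ 0 := by positivity
  push_cast
  rw [pow_succ, mul_div_assoc', ← neg_div,
    ← mul_div_mul_left (-((-1) ^ j * Real.Gamma (k + (a + 1) + 1))) _ hj]
  congr 1 <;> ring

lemma sub_mul_laguerreCoeff {a : ℝ} (ha : -1 < a) {k j : ℕ} (hj : j ≤ k) :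
    ((k : ℝ) + 1 - j) * laguerreCoeff a (k + 1) j = (a + 1 + j) * laguerreCoeff (a + 1) k j := by
  unfold laguerreCoeff
  have h1 : ((k + 1 : ℕ) : ℝ) + a + 1 = k + (a + 1) + 1 := by push_cast; ring
  have h0 : (0 : ℝ) < j + a + 1 := by have : (0 : ℝ) ≤ j := by positivity
                                      linarith
  have h2 : Real.Gamma (j + (a + 1) + 1) = (j + a + 1) * Real.Gamma (j + a + 1) := by
    rw [← Real.Gamma_add_one h0.ne']; ring_nf
  have h3 : ((Nat.factorial (k + 1 - j) : ℕ) : ℝ) = ((k : ℝ) + 1 - j) * Nat.factorial (k - j) := by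
    rw [Nat.succ_sub hj, Nat.succ_eq_add_one, Nat.factorial_succ]
    push_cast [Nat.cast_sub hj]; ring
  have h4 : (0 : ℝ) < (k : ℝ) + 1 - j := by
    have : (j : ℝ) ≤ k := by exact_mod_cast hj
    linarith
  have h5 := Real.Gamma_pos_of_pos h0
  rw [h1, h2, h3]
  have h6 : (Nat.factorial (k - j) : ℝ) ≠ 0 := by positivity
  have h7 : (Nat.factorial j : ℝ) ≠ 0 := by positivity
  have h8 := h4.ne'
  have h9 := h5.ne'
  have h10 := h0.ne'
  field_simp
  ring

lemma hasDerivAt_laguerre_succ (a : ℝ) (k : ℕ) (x : ℝ) :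
    HasDerivAt (laguerre a (k + 1)) (-laguerre (a + 1) k x) x := by
  have h : HasDerivAt (fun x => ∑ j ∈ Finset.range (k + 1 + 1), laguerreCoeff a (k + 1) j * x ^ j)
      (∑ j ∈ Finset.range (k + 1 + 1), laguerreCoeff a (k + 1) j * (j * x ^ (j - 1))) x :=
    HasDerivAt.fun_sum fun j _ => (hasDerivAt_pow j x).const_mul _
  refine HasDerivAt.congr_deriv (f := laguerre a (k + 1)) h ?_
  rw [Finset.sum_range_succ', laguerre_eq, ← Finset.sum_neg_distrib]
  simp only [Nat.cast_zero, zero_mul, mul_zero, add_zero]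
  refine Finset.sum_congr rfl fun j _ => ?_
  rw [← neg_mul, ← succ_mul_laguerreCoeff_succ]
  simp only [Nat.add_sub_cancel, Nat.cast_add, Nat.cast_one]
  ring

lemma hasDerivAt_laguerre_zero (a : ℝ) (x : ℝ) : HasDerivAt (laguerre a 0) 0 x := by
  have : laguerre a 0 = fun _ => laguerreCoeff a 0 0 := by
    funext y; simp [laguerre_eq]
  rw [this]; exact hasDerivAt_const _ _

lemma succ_mul_laguerre_succ {a : ℝ} (ha : -1 < a) (k : ℕ) (y l' : ℝ)
    (hl : HasDerivAt (laguerre (a + 1) k) l' y) :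
    (a + 1 - y) * laguerre (a + 1) k y + y * l' = (k + 1) * laguerre a (k + 1) y := by
  have h : HasDerivAt (fun x => ∑ j ∈ Finset.range (k + 1), laguerreCoeff (a + 1) k j * x ^ j)
      (∑ j ∈ Finset.range (k + 1), laguerreCoeff (a + 1) k j * (j * y ^ (j - 1))) y :=
    HasDerivAt.fun_sum fun j _ => (hasDerivAt_pow j y).const_mul _
  rw [hl.unique h]
  have e1 : ((k : ℝ) + 1) * laguerre a (k + 1) y =
      ∑ j ∈ Finset.range (k + 1 + 1), (((k : ℝ) + 1 - j) * laguerreCoeff a (k + 1) j) * y ^ j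
      + ∑ j ∈ Finset.range (k + 1 + 1), (j * laguerreCoeff a (k + 1) j) * y ^ j := by
    rw [laguerre_eq, Finset.mul_sum, ← Finset.sum_add_distrib]
    exact Finset.sum_congr rfl fun j _ => by ring
  rw [e1, Finset.sum_range_succ (fun j : ℕ => ((k : ℝ) + 1 - j) * laguerreCoeff a (k + 1) j * y ^ j),
    Finset.sum_range_succ' _ (k + 1), laguerre_eq, Finset.mul_sum, Finset.mul_sum]
  push_cast
  simp only [sub_self, zero_mul, add_zero]
  rw [← Finset.sum_add_distrib, ← Finset.sum_add_distrib]
  refine Finset.sum_congr rfl fun j hj => ?_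
  rw [sub_mul_laguerreCoeff ha (Nat.lt_succ_iff.mp (Finset.mem_range.mp hj)),
    succ_mul_laguerreCoeff_succ]
  rcases j with _ | j
  · simp; ring
  · simp only [Nat.add_sub_cancel]; push_cast; ring

/-- The normalizing constant of `phi1`. -/
def phiConst (a : ℝ) (k : ℕ) : ℝ :=
  Real.sqrt (2 * (Nat.factorial k : ℝ) / Real.Gamma (k + a + 1))

lemma sqrt_mul_phiConst (a : ℝ) (k : ℕ) :
    √((k : ℝ) + 1) * phiConst (a + 1) k = phiConst a (k + 1) := by
  unfold phiConst
  rw [← Real.sqrt_mul (by positivity), Nat.factorial_succ]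
  congr 1
  push_cast
  rw [show (k : ℝ) + 1 + a + 1 = k + (a + 1) + 1 by ring]
  ring

lemma phi1_eq (a : ℝ) (k : ℕ) (x : ℝ) : phi1 a k x =
    phiConst a k * laguerre a k (x ^ 2) * x ^ (a + 1 / 2) * Real.exp (-x ^ 2 / 2) := rfl

lemma hasDerivAt_phi1_aux (a : ℝ) (k : ℕ) {x : ℝ} (hx : 0 < x) {l' : ℝ}
    (hl : HasDerivAt (laguerre a k) l' (x ^ 2)) :
    HasDerivAt (phi1 a k) (((a + 1 / 2) / x - x) * phi1 a k x +
      phiConst a k * (l' * (2 * x)) * x ^ (a + 1 / 2) * Real.exp (-x ^ 2 / 2)) x := by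
  have h1 : HasDerivAt (fun x : ℝ => laguerre a k (x ^ 2)) (l' * (2 * x)) x := by
    have h0 : HasDerivAt (fun x : ℝ => x ^ 2) (2 * x) x := by simpa using hasDerivAt_pow 2 x
    exact HasDerivAt.comp (h₂ := laguerre a k) (h := fun x => x ^ 2) x hl h0
  have h2 : HasDerivAt (fun x : ℝ => x ^ (a + 1 / 2)) ((a + 1 / 2) * x ^ (a + 1 / 2 - 1)) x :=
    Real.hasDerivAt_rpow_const (Or.inl hx.ne')
  have h3 : HasDerivAt (fun x : ℝ => Real.exp (-x ^ 2 / 2)) (Real.exp (-x ^ 2 / 2) * (-x)) x := by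
    have : HasDerivAt (fun x : ℝ => -x ^ 2 / 2) (-x) x := by
      refine HasDerivAt.congr_deriv (((hasDerivAt_pow 2 x).fun_neg).div_const 2) ?_
      simp
      ring
    exact this.exp
  refine HasDerivAt.congr_deriv (f := phi1 a k)
    (((h1.const_mul (phiConst a k)).fun_mul h2).fun_mul h3) ?_
  rw [phi1_eq, Real.rpow_sub_one hx.ne']
  field_simp
  ring

/-- The lowering relation: `δ φ_k^a = -2 √k φ_{k-1}^{a+1}`. -/
lemma hasDerivAt_phi1 (a : ℝ) (k : ℕ) {x : ℝ} (hx : 0 < x) :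
    HasDerivAt (phi1 a k) (((a + 1 / 2) / x - x) * phi1 a k x
      - 2 * √(k : ℝ) * phi1 (a + 1) (k - 1) x) x := by
  rcases k with _ | k
  · simpa using hasDerivAt_phi1_aux a 0 hx (hasDerivAt_laguerre_zero a _)
  · refine (hasDerivAt_phi1_aux a (k + 1) hx (hasDerivAt_laguerre_succ a k _)).congr_deriv ?_
    symm
    rw [phi1_eq (a + 1), ← sqrt_mul_phiConst, Nat.add_sub_cancel,
      show a + 1 + 1 / 2 = (a + 1 / 2) + 1 by ring, Real.rpow_add_one hx.ne']
    push_cast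
    ring

/-- The raising relation: `δ^* φ_k^{a+1} = -2 √(k+1) φ_{k+1}^a`. -/
lemma hasDerivAt_phi1_add_one {a : ℝ} (ha : -1 < a) (k : ℕ) {x : ℝ} (hx : 0 < x) :
    HasDerivAt (phi1 (a + 1) k) ((x - (a + 1 / 2) / x) * phi1 (a + 1) k x
      + 2 * √((k : ℝ) + 1) * phi1 a (k + 1) x) x := by
  obtain ⟨l', hl⟩ : ∃ l', HasDerivAt (laguerre (a + 1) k) l' (x ^ 2) := by
    rcases k with _ | k
    · exact ⟨_, hasDerivAt_laguerre_zero _ _⟩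
    · exact ⟨_, hasDerivAt_laguerre_succ _ _ _⟩
  refine (hasDerivAt_phi1_aux (a + 1) k hx hl).congr_deriv ?_
  symm
  have h := succ_mul_laguerre_succ ha k _ _ hl
  have hs : √((k : ℝ) + 1) * √((k : ℝ) + 1) = k + 1 := Real.mul_self_sqrt (by positivity)
  rw [phi1_eq (a + 1), phi1_eq a, ← sqrt_mul_phiConst,
    show a + 1 + 1 / 2 = (a + 1 / 2) + 1 by ring, Real.rpow_add_one hx.ne']
  have e : 2 * √((k : ℝ) + 1) * (√((k : ℝ) + 1) * phiConst (a + 1) k * laguerre a (k + 1) (x ^ 2)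
      * x ^ (a + 1 / 2) * Real.exp (-x ^ 2 / 2)) =
      2 * phiConst (a + 1) k * x ^ (a + 1 / 2) * Real.exp (-x ^ 2 / 2) *
      ((a + 1 - x ^ 2) * laguerre (a + 1) k (x ^ 2) + x ^ 2 * l') := by
    rw [h]; linear_combination (2 * phiConst (a + 1) k * laguerre a (k + 1) (x ^ 2)
      * x ^ (a + 1 / 2) * Real.exp (-x ^ 2 / 2)) * hs
  rw [e]
  field_simp
  ring

/-- The derivative of `phi1` on `(0, ∞)`. -/
def dphi1 (a : ℝ) (k : ℕ) (x : ℝ) : ℝ :=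
  ((a + 1 / 2) / x - x) * phi1 a k x - 2 * √(k : ℝ) * phi1 (a + 1) (k - 1) x

/-- The second derivative of `phi1` on `(0, ∞)`, as given by the eigenvalue equation. -/
def ddphi1 (a : ℝ) (k : ℕ) (x : ℝ) : ℝ :=
  (x ^ 2 + (a ^ 2 - 1 / 4) / x ^ 2 - (4 * k + 2 * a + 2)) * phi1 a k x

lemma hasDerivAt_dphi1 {a : ℝ} (ha : -1 < a) (k : ℕ) {x : ℝ} (hx : 0 < x) :
    HasDerivAt (dphi1 a k) (ddphi1 a k x) x := by
  have hq : HasDerivAt (fun x : ℝ => (a + 1 / 2) / x - x) (-(a + 1 / 2) / x ^ 2 - 1) x := by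
    refine HasDerivAt.congr_deriv
      (((hasDerivAt_inv hx.ne').const_mul (a + 1 / 2)).fun_sub (hasDerivAt_id' x)) ?_
    ring
  have h1 := hq.fun_mul (hasDerivAt_phi1 a k hx)
  rcases k with _ | k
  · have e : dphi1 a 0 = fun x => ((a + 1 / 2) / x - x) * phi1 a 0 x := by
      funext y; simp [dphi1]
    rw [e]
    refine h1.congr_deriv ?_
    simp only [ddphi1, Nat.cast_zero, Real.sqrt_zero]
    field_simp
    ring
  · have h2 := (hasDerivAt_phi1_add_one ha k hx).const_mul (2 * √((k + 1 : ℕ) : ℝ))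
    refine HasDerivAt.congr_deriv (f := dphi1 a (k + 1)) (h1.fun_sub h2) ?_
    have hs : √((k : ℝ) + 1) * √((k : ℝ) + 1) = k + 1 := Real.mul_self_sqrt (by positivity)
    simp only [ddphi1, Nat.add_sub_cancel]
    push_cast
    have e : ∀ z, 2 * √((k : ℝ) + 1) * (2 * √((k : ℝ) + 1) * z) = 4 * (k + 1) * z := by
      intro z; linear_combination 4 * z * hs
    rw [mul_add (2 * √((k : ℝ) + 1)), e]
    field_simp
    ring

lemma exists_rpow_le_exp {e : ℝ} (he : 0 ≤ e) :
    ∃ C : ℝ, 0 ≤ C ∧ ∀ x : ℝ, 0 < x → x ^ e ≤ C * Real.exp (x ^ 2 / 4) := by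
  obtain ⟨n, hn⟩ := exists_nat_ge e
  refine ⟨1 + n.factorial * 4 ^ n, by positivity, fun x hx => ?_⟩
  have hexp : 1 ≤ Real.exp (x ^ 2 / 4) := Real.one_le_exp (by positivity)
  rcases le_total x 1 with h | h
  · have : x ^ e ≤ 1 := Real.rpow_le_one hx.le h he
    nlinarith [show (0 : ℝ) ≤ n.factorial * 4 ^ n by positivity]
  · have h1 : x ^ e ≤ (x ^ 2) ^ n := by
      rw [← pow_mul, ← Real.rpow_natCast]
      exact Real.rpow_le_rpow_of_exponent_le h (by push_cast; linarith [(n.cast_nonneg : (0 : ℝ) ≤ n)])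
    have h2 := Real.pow_div_factorial_le_exp (x ^ 2 / 4) (by positivity) n
    rw [div_pow, div_div, div_le_iff₀ (by positivity)] at h2
    nlinarith [show (0 : ℝ) ≤ n.factorial * 4 ^ n by positivity]

/-- The decay and vanishing of `phi1` that make every boundary term negligible. -/
lemma exists_phi1_bound {b : ℝ} (hb : 1 / 2 ≤ b) (k : ℕ) :
    ∃ C : ℝ, 0 ≤ C ∧ ∀ x : ℝ, 0 < x →
      (1 + x ^ 4) * |phi1 b k x| ≤ C * (x * Real.exp (-x ^ 2 / 4)) := by
  have key : ∀ j : ℕ, ∃ C : ℝ, 0 ≤ C ∧ ∀ x : ℝ, 0 < x →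
      (1 + x ^ 4) * (x ^ (2 * j) * x ^ (b + 1 / 2) * Real.exp (-x ^ 2 / 2))
        ≤ C * (x * Real.exp (-x ^ 2 / 4)) := by
    intro j
    have he : 0 ≤ 2 * (j : ℝ) + b - 1 / 2 := by
      have : (0 : ℝ) ≤ j := j.cast_nonneg
      linarith
    obtain ⟨C1, hC1, h1⟩ := exists_rpow_le_exp he
    obtain ⟨C2, hC2, h2⟩ := exists_rpow_le_exp (e := 2 * (j : ℝ) + b - 1 / 2 + 4) (by linarith)
    refine ⟨C1 + C2, by positivity, fun x hx => ?_⟩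
    have e1 : x ^ (2 * j) * x ^ (b + 1 / 2) = x * x ^ (2 * (j : ℝ) + b - 1 / 2) := by
      rw [← Real.rpow_natCast x (2 * j), ← Real.rpow_add hx]
      nth_rw 2 [← Real.rpow_one x]
      rw [← Real.rpow_add hx]
      congr 1; push_cast; ring
    have e2 : x ^ 4 * x ^ (2 * (j : ℝ) + b - 1 / 2) = x ^ (2 * (j : ℝ) + b - 1 / 2 + 4) := by
      rw [Real.rpow_add hx, mul_comm]; norm_cast
    have e3 : Real.exp (-x ^ 2 / 4) = Real.exp (x ^ 2 / 4) * Real.exp (-x ^ 2 / 2) := by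
      rw [← Real.exp_add]; ring_nf
    have e4 : (1 + x ^ 4) * (x ^ (2 * j) * x ^ (b + 1 / 2) * Real.exp (-x ^ 2 / 2)) =
        (x * Real.exp (-x ^ 2 / 2)) *
          (x ^ (2 * (j : ℝ) + b - 1 / 2) + x ^ (2 * (j : ℝ) + b - 1 / 2 + 4)) := by
      rw [e1, ← e2]; ring
    rw [e4, e3]
    calc _ ≤ (x * Real.exp (-x ^ 2 / 2)) * (C1 * Real.exp (x ^ 2 / 4) + C2 * Real.exp (x ^ 2 / 4)) :=
          by gcongr <;> [exact h1 x hx; exact h2 x hx]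
      _ = _ := by ring
  choose C hC hle using key
  refine ⟨∑ j ∈ Finset.range (k + 1), |phiConst b k| * |laguerreCoeff b k j| * C j,
    Finset.sum_nonneg fun j _ => mul_nonneg (by positivity) (hC j), fun x hx => ?_⟩
  have e : phi1 b k x = ∑ j ∈ Finset.range (k + 1), phiConst b k * laguerreCoeff b k j *
      (x ^ (2 * j) * x ^ (b + 1 / 2) * Real.exp (-x ^ 2 / 2)) := by
    rw [phi1_eq, laguerre_eq, Finset.mul_sum, Finset.sum_mul, Finset.sum_mul]
    refine Finset.sum_congr rfl fun j _ => ?_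
    rw [← pow_mul]; ring
  rw [e, Finset.sum_mul]
  refine (mul_le_mul_of_nonneg_left (Finset.abs_sum_le_sum_abs _ _) (by positivity)).trans ?_
  rw [Finset.mul_sum]
  refine Finset.sum_le_sum fun j _ => ?_
  have hp : 0 ≤ x ^ (2 * j) * x ^ (b + 1 / 2) * Real.exp (-x ^ 2 / 2) := by positivity
  rw [abs_mul, abs_mul, abs_of_nonneg hp]
  calc _ = |phiConst b k| * |laguerreCoeff b k j| *
        ((1 + x ^ 4) * (x ^ (2 * j) * x ^ (b + 1 / 2) * Real.exp (-x ^ 2 / 2))) := by ring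
    _ ≤ _ := by
      rw [mul_assoc (|phiConst b k| * |laguerreCoeff b k j|)]
      exact mul_le_mul_of_nonneg_left (hle j x hx) (by positivity)

end

section

/-! ### Orthonormality in one dimension -/

/-- A general half-line version of the fundamental theorem of calculus for functions dominated by a
function tending to zero at both ends. -/
lemma integral_Ioi_deriv_eq_zero {f f' B : ℝ → ℝ} (hd : ∀ x, 0 < x → HasDerivAt f (f' x) x)
    (hB : ∀ x, 0 < x → |f x| ≤ B x) (hi : IntegrableOn f' (Set.Ioi 0))
    (h0 : Tendsto B (𝓝[>] 0) (𝓝 0)) (h1 : Tendsto B atTop (𝓝 0)) :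
    ∫ x in Set.Ioi (0 : ℝ), f' x = 0 := by
  have hz : Tendsto f (𝓝[>] 0) (𝓝 0) :=
    squeeze_zero_norm' (eventually_nhdsWithin_of_forall fun x hx => hB x hx) h0
  have hinf : Tendsto f atTop (𝓝 0) :=
    squeeze_zero_norm' ((eventually_gt_atTop 0).mono fun x hx => hB x hx) h1
  have hc : ContinuousWithinAt (fun x => if 0 < x then f x else 0) (Set.Ici 0) 0 := by
    rw [← continuousWithinAt_Ioi_iff_Ici]
    show Tendsto _ _ _
    simp only [lt_irrefl, if_false]
    refine hz.congr' (eventually_nhdsWithin_of_forall fun x hx => ?_)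
    simp [Set.mem_Ioi.mp hx]
  have := integral_Ioi_of_hasDerivAt_of_tendsto (f := fun x => if 0 < x then f x else 0) (f' := f')
    (a := 0) (m := 0) hc (fun x hx => ?_) hi ?_
  · simpa using this
  · refine (hd x hx).congr_of_eventuallyEq ?_
    filter_upwards [Ioi_mem_nhds (Set.mem_Ioi.mp hx)] with y hy
    simp [Set.mem_Ioi.mp hy]
  · refine hinf.congr' ?_
    filter_upwards [eventually_gt_atTop 0] with y hy
    simp [hy]

lemma continuousOn_phi1 (a : ℝ) (k : ℕ) : ContinuousOn (phi1 a k) (Set.Ioi 0) := fun _ hx =>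
  (hasDerivAt_phi1 a k hx).continuousAt.continuousWithinAt

lemma tendsto_rpow_mul_exp_atTop {c : ℝ} (hc : 0 < c) :
    Tendsto (fun x : ℝ => x ^ 2 * Real.exp (-c * x ^ 2)) atTop (𝓝 0) := by
  have h := (tendsto_rpow_mul_exp_neg_mul_atTop_nhds_zero 1 c hc).comp
    (tendsto_pow_atTop (α := ℝ) two_ne_zero)
  simpa [Function.comp_def] using h

lemma integrableOn_sq_mul_exp {c : ℝ} (hc : 0 < c) :
    IntegrableOn (fun x : ℝ => x ^ 2 * Real.exp (-c * x ^ 2)) (Set.Ioi 0) := by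
  have := integrableOn_rpow_mul_exp_neg_mul_sq hc (s := 2) (by norm_num)
  simpa using this

lemma phi1_bound {b : ℝ} (hb : 1 / 2 ≤ b) (k : ℕ) :
    ∃ C : ℝ, 0 ≤ C ∧ ∀ x : ℝ, 0 < x → |phi1 b k x| ≤ C * (x * Real.exp (-x ^ 2 / 4)) := by
  obtain ⟨C, hC, h⟩ := exists_phi1_bound hb k
  refine ⟨C, hC, fun x hx => le_trans ?_ (h x hx)⟩
  nlinarith [abs_nonneg (phi1 b k x), show 0 ≤ x ^ 4 by positivity]

lemma phi1_mul_bound {a b : ℝ} (ha : 1 / 2 ≤ a) (hb : 1 / 2 ≤ b) (k m : ℕ) :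
    ∃ C : ℝ, 0 ≤ C ∧ ∀ x : ℝ, 0 < x →
      |phi1 a k x * phi1 b m x| ≤ C * (x ^ 2 * Real.exp (-(1 / 2) * x ^ 2)) := by
  obtain ⟨C, hC, h⟩ := phi1_bound ha k
  obtain ⟨D, hD, h'⟩ := phi1_bound hb m
  refine ⟨C * D, by positivity, fun x hx => ?_⟩
  rw [abs_mul]
  have e : Real.exp (-(1 / 2) * x ^ 2) = Real.exp (-x ^ 2 / 4) * Real.exp (-x ^ 2 / 4) := by
    rw [← Real.exp_add]; ring_nf
  calc _ ≤ (C * (x * Real.exp (-x ^ 2 / 4))) * (D * (x * Real.exp (-x ^ 2 / 4))) :=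
        mul_le_mul (h x hx) (h' x hx) (abs_nonneg _) (by positivity)
    _ = _ := by rw [e]; ring

lemma integrableOn_phi1_mul {a b : ℝ} (ha : 1 / 2 ≤ a) (hb : 1 / 2 ≤ b) (k m : ℕ) :
    IntegrableOn (fun x => phi1 a k x * phi1 b m x) (Set.Ioi 0) := by
  obtain ⟨C, hC, h⟩ := phi1_mul_bound ha hb k m
  refine Integrable.mono' ((integrableOn_sq_mul_exp (c := 1 / 2) (by norm_num)).const_mul C)
    (((continuousOn_phi1 a k).mul (continuousOn_phi1 b m)).aestronglyMeasurable
      measurableSet_Ioi) ?_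
  exact (ae_restrict_iff' measurableSet_Ioi).mpr (ae_of_all _ fun x hx => h x hx)

/-- Integration by parts between consecutive types. -/
lemma sqrt_mul_integral_phi1 {a : ℝ} (ha : 1 / 2 ≤ a) (j m : ℕ) :
    √((j : ℝ) + 1) * ∫ x in Set.Ioi (0 : ℝ), phi1 a (j + 1) x * phi1 a m x =
      √(m : ℝ) * ∫ x in Set.Ioi (0 : ℝ), phi1 (a + 1) j x * phi1 (a + 1) (m - 1) x := by
  have ha1 : 1 / 2 ≤ a + 1 := by linarith
  have i1 := (integrableOn_phi1_mul ha ha (j + 1) m).const_mul (2 * √((j : ℝ) + 1))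
  have i2 := (integrableOn_phi1_mul ha1 ha1 j (m - 1)).const_mul (2 * √(m : ℝ))
  obtain ⟨C, hC, h⟩ := phi1_mul_bound ha1 ha j m
  have h0 := integral_Ioi_deriv_eq_zero (f := fun x => phi1 (a + 1) j x * phi1 a m x)
    (f' := fun x => 2 * √((j : ℝ) + 1) * (phi1 a (j + 1) x * phi1 a m x) -
      2 * √(m : ℝ) * (phi1 (a + 1) j x * phi1 (a + 1) (m - 1) x))
    (B := fun x => C * (x ^ 2 * Real.exp (-(1 / 2) * x ^ 2)))
    (fun x hx => by
      refine ((hasDerivAt_phi1_add_one (by linarith) j hx).mul (hasDerivAt_phi1 a m hx)).congr_deriv ?_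
      ring) h (i1.sub i2) ?_ ?_
  · have e := integral_sub i1 i2
    rw [h0, integral_const_mul, integral_const_mul] at e
    linarith
  · have : ContinuousAt (fun x : ℝ => C * (x ^ 2 * Real.exp (-(1 / 2) * x ^ 2))) 0 := by fun_prop
    simpa [ContinuousAt] using this.tendsto.mono_left (nhdsWithin_le_nhds (s := Set.Ioi 0))
  · simpa using (tendsto_rpow_mul_exp_atTop (c := 1 / 2) (by norm_num)).const_mul C

lemma integral_phi1_zero_sq {a : ℝ} (ha : 1 / 2 ≤ a) :
    ∫ x in Set.Ioi (0 : ℝ), phi1 a 0 x * phi1 a 0 x = 1 := by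
  have hG : 0 < Real.Gamma (a + 1) := Real.Gamma_pos_of_pos (by linarith)
  have e : ∀ x ∈ Set.Ioi (0 : ℝ), phi1 a 0 x * phi1 a 0 x =
      2 / Real.Gamma (a + 1) * (x ^ (2 * a + 1) * Real.exp (-1 * x ^ (2 : ℝ))) := by
    intro x hx
    have hx : 0 < x := hx
    have e1 : laguerre a 0 (x ^ 2) = 1 := by simp [laguerre, hG.ne']
    have e2 : phiConst a 0 * phiConst a 0 = 2 / Real.Gamma (a + 1) := by
      unfold phiConst
      rw [Real.mul_self_sqrt (by positivity)]
      · simp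
    have e3 : x ^ (2 * a + 1) = x ^ (a + 1 / 2) * x ^ (a + 1 / 2) := by
      rw [← Real.rpow_add hx]; ring_nf
    have e4 : Real.exp (-1 * x ^ (2 : ℝ)) = Real.exp (-x ^ 2 / 2) * Real.exp (-x ^ 2 / 2) := by
      rw [← Real.exp_add, Real.rpow_two]; ring_nf
    rw [phi1_eq, e1, e3, e4, ← e2]; ring
  rw [setIntegral_congr_fun measurableSet_Ioi e, integral_const_mul,
    integral_rpow_mul_exp_neg_mul_rpow (by norm_num) (by linarith) (by norm_num)]
  rw [show (2 * a + 1 + 1) / 2 = a + 1 by ring]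
  simp
  field_simp

/-- The Laguerre functions of Hermite type of a fixed type are orthonormal. -/
lemma integral_phi1_mul {a : ℝ} (ha : 1 / 2 ≤ a) (k m : ℕ) :
    ∫ x in Set.Ioi (0 : ℝ), phi1 a k x * phi1 a m x = if k = m then 1 else 0 := by
  have hcomm : ∀ (a : ℝ) (k m : ℕ), ∫ x in Set.Ioi (0 : ℝ), phi1 a k x * phi1 a m x =
      ∫ x in Set.Ioi (0 : ℝ), phi1 a m x * phi1 a k x := by
    intro a k m; simp_rw [mul_comm]
  have hs : ∀ n : ℕ, √((n : ℝ) + 1) * √((n : ℝ) + 1) = n + 1 := fun n =>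
    Real.mul_self_sqrt (by positivity)
  have hp : ∀ n : ℕ, √((n : ℝ) + 1) ≠ 0 := fun n => (Real.sqrt_pos.mpr (by positivity)).ne'
  induction k generalizing a m with
  | zero =>
    rcases m with _ | m
    · simpa using integral_phi1_zero_sq ha
    · have := sqrt_mul_integral_phi1 ha m 0
      rw [hcomm]
      simpa [hp m] using this
  | succ k ih =>
    have h1 := sqrt_mul_integral_phi1 ha k m
    rcases m with _ | m
    · simpa [hp k] using h1
    · rw [Nat.add_sub_cancel, ih (by linarith)] at h1
      push_cast at h1
      rcases eq_or_ne k m with rfl | hkm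
      · simpa [hp k] using h1
      · simpa [hp k, hkm] using h1

end

section

/-! ### The Bellman function -/

/-- The exponent `s = (2 - q) / 2 = (p - 2) / (2 (p - 1))`, where `1 / p + 1 / q = 1`. -/
def bellExp (p : ℝ) : ℝ := (p - 2) / (2 * (p - 1))

/-- The quantity `M = n ^ (p - 1) + w + e`; without the regularization `e` it is comparable to
`max (|U| ^ (2 (p - 1))) (|V| ^ 2)`. -/
def bellM (p e n w : ℝ) : ℝ := n ^ (p - 1) + (w + e)

/-- The Bellman function `6 (p - 1) (w + e) ^ (1 - s) + n M ^ s`, in the variables `n = |U|²`,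
`w = |V|²`. The regularization `e > 0` makes it twice differentiable up to `n = 0` and `w = 0`. -/
def bell (p e n w : ℝ) : ℝ :=
  6 * (p - 1) * (w + e) ^ (1 - bellExp p) + n * bellM p e n w ^ bellExp p

/-- `∂_n` of the Bellman function. -/
def bellN (p e n w : ℝ) : ℝ :=
  bellM p e n w ^ bellExp p +
    bellExp p * (p - 1) * n ^ (p - 1) * bellM p e n w ^ (bellExp p - 1)

/-- `∂_w` of the Bellman function. -/
def bellW (p e n w : ℝ) : ℝ :=
  6 * (p - 1) * (1 - bellExp p) * (w + e) ^ (-bellExp p) +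
    bellExp p * n * bellM p e n w ^ (bellExp p - 1)

/-- `∂_n ∂_n` of the Bellman function. -/
def bellNN (p e n w : ℝ) : ℝ :=
  bellExp p * (p - 1) * n ^ (p - 2) * (p * bellM p e n w ^ (bellExp p - 1) +
    (bellExp p - 1) * (p - 1) * n ^ (p - 1) * bellM p e n w ^ (bellExp p - 2))

/-- `∂_n ∂_w` of the Bellman function. -/
def bellNW (p e n w : ℝ) : ℝ :=
  bellExp p * bellM p e n w ^ (bellExp p - 1) +
    bellExp p * (p - 1) * (bellExp p - 1) * n ^ (p - 1) * bellM p e n w ^ (bellExp p - 2)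

/-- `∂_w ∂_w` of the Bellman function. -/
def bellWW (p e n w : ℝ) : ℝ :=
  -(6 * (p - 1) * (1 - bellExp p) * bellExp p * (w + e) ^ (-bellExp p - 1)) +
    bellExp p * (bellExp p - 1) * n * bellM p e n w ^ (bellExp p - 2)

lemma bellExp_nonneg {p : ℝ} (hp : 2 ≤ p) : 0 ≤ bellExp p :=
  div_nonneg (by linarith) (by linarith)

lemma one_sub_two_mul_bellExp {p : ℝ} (hp : 2 ≤ p) : 1 - 2 * bellExp p = 1 / (p - 1) := by
  unfold bellExp
  have : p - 1 ≠ 0 := by linarith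
  field_simp
  ring

lemma bellExp_lt {p : ℝ} (hp : 2 ≤ p) : bellExp p < 1 / 2 := by
  have h := one_sub_two_mul_bellExp hp
  have : 0 < 1 / (p - 1) := one_div_pos.mpr (by linarith)
  linarith

lemma bellM_pos {p e n w : ℝ} (he : 0 < e) (hn : 0 ≤ n) (hw : 0 ≤ w) : 0 < bellM p e n w := by
  unfold bellM
  have := Real.rpow_nonneg hn (p - 1)
  linarith

section chain

variable {p e : ℝ} {n w n' w' : ℝ → ℝ} {n'' w'' : ℝ} {t : ℝ}

lemma hasDerivAt_bellM (hp : 2 ≤ p) (hn' : HasDerivAt n (n' t) t) (hw' : HasDerivAt w (w' t) t) :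
    HasDerivAt (fun t => bellM p e (n t) (w t)) ((p - 1) * n t ^ (p - 2) * n' t + w' t) t := by
  have h := (hn'.rpow_const (p := p - 1) (Or.inr (by linarith))).fun_add (hw'.add_const e)
  refine HasDerivAt.congr_deriv h ?_
  rw [show p - 1 - 1 = p - 2 by ring]; ring

lemma hasDerivAt_bell (hp : 2 ≤ p) (he : 0 < e) (hn : 0 ≤ n t) (hw : 0 ≤ w t)
    (hn' : HasDerivAt n (n' t) t) (hw' : HasDerivAt w (w' t) t) :
    HasDerivAt (fun t => bell p e (n t) (w t))
      (bellN p e (n t) (w t) * n' t + bellW p e (n t) (w t) * w' t) t := by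
  have hM := hasDerivAt_bellM (e := e) hp hn' hw'
  have hMp := bellM_pos (p := p) he hn hw
  have h1 := ((hw'.add_const e).rpow_const (p := 1 - bellExp p)
    (Or.inl (by linarith))).const_mul (6 * (p - 1))
  have h2 := hn'.fun_mul (hM.rpow_const (p := bellExp p) (Or.inl hMp.ne'))
  refine HasDerivAt.congr_deriv (h1.fun_add h2) ?_
  unfold bellN bellW
  have e1 : n t * n t ^ (p - 2) = n t ^ (p - 1) := by
    rw [mul_comm, ← Real.rpow_add_one' hn (by linarith)]; ring_nf
  rw [← e1, show 1 - bellExp p - 1 = -bellExp p by ring]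
  ring

lemma hasDerivAt_bell_deriv (hp : 2 ≤ p) (he : 0 < e) (hn : 0 ≤ n t) (hw : 0 ≤ w t)
    (hn' : HasDerivAt n (n' t) t) (hw' : HasDerivAt w (w' t) t)
    (hn'' : HasDerivAt n' n'' t) (hw'' : HasDerivAt w' w'' t) :
    HasDerivAt (fun t => bellN p e (n t) (w t) * n' t + bellW p e (n t) (w t) * w' t)
      (bellNN p e (n t) (w t) * n' t ^ 2 + 2 * bellNW p e (n t) (w t) * (n' t * w' t) +
        bellWW p e (n t) (w t) * w' t ^ 2 + bellN p e (n t) (w t) * n'' +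
        bellW p e (n t) (w t) * w'') t := by
  have hM := hasDerivAt_bellM (e := e) hp hn' hw'
  have hMp := bellM_pos (p := p) he hn hw
  have hMs := hM.rpow_const (p := bellExp p) (Or.inl hMp.ne')
  have hMs1 := hM.rpow_const (p := bellExp p - 1) (Or.inl hMp.ne')
  have hpow := (hn'.rpow_const (p := p - 1) (Or.inr (by linarith))).const_mul (bellExp p * (p - 1))
  have hN := hMs.fun_add (hpow.fun_mul hMs1)
  have hY := ((hw'.add_const e).rpow_const (p := -bellExp p)
    (Or.inl (by linarith))).const_mul (6 * (p - 1) * (1 - bellExp p))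
  have hW := hY.fun_add ((hn'.const_mul (bellExp p)).fun_mul hMs1)
  refine HasDerivAt.congr_deriv ((hN.fun_mul hn'').fun_add (hW.fun_mul hw'')) ?_
  have e1 : n t * n t ^ (p - 2) = n t ^ (p - 1) := by
    rw [mul_comm, ← Real.rpow_add_one' hn (by linarith)]; ring_nf
  have e2 : bellM p e (n t) (w t) * bellM p e (n t) (w t) ^ (bellExp p - 2) =
      bellM p e (n t) (w t) ^ (bellExp p - 1) := by
    rw [mul_comm, ← Real.rpow_add_one hMp.ne']; ring_nf
  unfold bellN bellW bellNN bellNW bellWW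
  rw [← e1, show bellExp p - 1 - 1 = bellExp p - 2 by ring, show p - 1 - 1 = p - 2 by ring]
  ring

end chain

set_option maxHeartbeats 1000000 in
/-- The algebraic core of the convexity of the Bellman function: here `T = M ^ s` and
`Z = (w + e) ^ (-s)`. The negative contributions are the mixed derivative and the second derivative in
`w`. One part of the former is absorbed by the second derivative in `n`, everything else by the terms
in `P` and `R`; the factor `6 (p - 1)` makes the latter large enough. -/
lemma bell_form_aux {p s n w l e M T Z P R α β : ℝ} (hp : 2 ≤ p) (hs : s = (p - 2) / (2 * (p - 1)))
    (hn : 0 ≤ n) (hw : 0 ≤ w) (hl : 0 ≤ l) (he : 0 < e) (hM : M = n * l + (w + e)) (hT : 0 < T)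
    (hnT : n * T ^ 2 ≤ M) (hZ : 1 ≤ Z * T) (hP : 0 ≤ P) (hR : 0 ≤ R)
    (hα : α ^ 2 ≤ n * P) (hβ : β ^ 2 ≤ w * R) :
    T * P + T⁻¹ * R ≤
      4 * (s * (p - 1) * l * (p * (T / M) + (s - 1) * (p - 1) * (n * l) * (T / M ^ 2))) * α ^ 2
      + 8 * (s * (T / M) + s * (p - 1) * (s - 1) * (n * l) * (T / M ^ 2)) * (α * β)
      + 4 * (-(6 * (p - 1) * (1 - s) * s * (Z / (w + e))) + s * (s - 1) * n * (T / M ^ 2)) * β ^ 2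
      + 2 * (T + s * (p - 1) * (n * l) * (T / M)) * P
      + 2 * (6 * (p - 1) * (1 - s) * Z + s * n * (T / M)) * R := by
  have hp1 : 0 < p - 1 := by linarith
  have hs0 : 0 ≤ s := by rw [hs]; exact div_nonneg (by linarith) (by linarith)
  have hc : (1 - 2 * s) * (p - 1) = 1 := by rw [hs]; field_simp; ring
  have hd : (1 - s) * (p - 1) = p / 2 := by rw [hs]; field_simp; ring
  have hs1 : 0 < 1 - 2 * s := by
    by_contra h
    nlinarith [not_lt.mp h]
  have hMp : 0 < M := by rw [hM]; positivity
  -- normalized ratios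
  set τ := T / M with hτ
  have hτp : 0 < τ := div_pos hT hMp
  set x := n * l / M with hx
  set z := w / M with hz
  have hx0 : 0 ≤ x := by positivity
  have hz0 : 0 ≤ z := by positivity
  have hxz : x + z ≤ 1 := by
    rw [hx, hz, ← add_div, div_le_one hMp, hM]; linarith
  have e1 : T / M ^ 2 = τ / M := by rw [hτ]; field_simp
  have e2 : n * l * (T / M ^ 2) = x * τ := by rw [hx, hτ]; field_simp
  -- the pure second derivative in `n`
  have b1 : 2 * s * (p - 1) * l * p * τ * α ^ 2 ≤
      4 * (s * (p - 1) * l * (p * τ + (s - 1) * (p - 1) * (n * l) * (T / M ^ 2))) * α ^ 2 := by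
    have : (s - 1) * (p - 1) * (n * l) * (T / M ^ 2) = -(p / 2) * (x * τ) := by
      rw [mul_assoc, e2]; linear_combination (-(x * τ)) * hd
    rw [this]
    have h0 : 0 ≤ 2 * s * (p - 1) * l * p * τ * (1 - x) * α ^ 2 := by
      have : 0 ≤ 1 - x := by linarith
      have : 0 ≤ p := by linarith
      positivity
    linarith
  -- the part of the mixed derivative absorbed by it
  have b2 : -(2 * s * (p - 1) * l * p * τ * α ^ 2) - 4 * s * (1 - s) * x * (n * τ / M) * β ^ 2
      ≤ 8 * (s * (p - 1) * (s - 1) * (n * l) * (T / M ^ 2)) * (α * β) := by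
    have h0 : 0 ≤ 4 * s * (1 - s) * l * τ * ((p - 1) * α - n / M * β) ^ 2 := by
      have : 0 ≤ 1 - s := by linarith
      positivity
    have e3 : 8 * (s * (p - 1) * (s - 1) * (n * l) * (T / M ^ 2)) * (α * β)
        = -(8 * s * (1 - s) * l * τ * (p - 1) * (n / M) * (α * β)) := by
      rw [hτ]; field_simp; ring
    have e4 : 4 * s * (1 - s) * x * (n * τ / M) * β ^ 2 =
        4 * s * (1 - s) * l * τ * (n / M) ^ 2 * β ^ 2 := by
      rw [hx]; field_simp
    have e5 : 2 * s * (p - 1) * l * p * τ * α ^ 2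
        = 4 * s * (1 - s) * l * τ * (p - 1) ^ 2 * α ^ 2 := by
      linear_combination (-4 * s * l * τ * (p - 1) * α ^ 2) * hd
    rw [e3, e4, e5]
    linarith
  -- the remaining part of the mixed derivative
  have b3 : -(T * P + 16 * s ^ 2 * (T⁻¹ * R)) ≤ 8 * (s * τ) * (α * β) := by
    have h1 : (τ * (α * β)) ^ 2 ≤ P * R := by
      have : (α * β) ^ 2 ≤ (n * P) * (w * R) := by
        rw [mul_pow]; exact mul_le_mul hα hβ (sq_nonneg _) (by positivity)
      have h2 : τ ^ 2 * (n * w) ≤ 1 := by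
        have : τ ^ 2 * (n * w) = (n * T ^ 2 / M) * z := by rw [hτ, hz]; field_simp
        rw [this]
        have h3 : n * T ^ 2 / M ≤ 1 := (div_le_one hMp).mpr hnT
        have h4 : z ≤ 1 := by linarith
        calc _ ≤ 1 * 1 := mul_le_mul h3 h4 hz0 (by norm_num)
          _ = 1 := by norm_num
      calc (τ * (α * β)) ^ 2 = τ ^ 2 * (α * β) ^ 2 := by ring
        _ ≤ τ ^ 2 * ((n * P) * (w * R)) := by gcongr
        _ = (τ ^ 2 * (n * w)) * (P * R) := by ring
        _ ≤ 1 * (P * R) := by gcongr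
        _ = P * R := one_mul _
    have h5 : |8 * (s * τ) * (α * β)| ≤ T * P + 16 * s ^ 2 * (T⁻¹ * R) := by
      refine abs_le_of_sq_le_sq ?_ (by positivity)
      have h6 : (T * P + 16 * s ^ 2 * (T⁻¹ * R)) ^ 2 =
          (T * P - 16 * s ^ 2 * (T⁻¹ * R)) ^ 2 + 64 * s ^ 2 * (P * R) := by
        field_simp; ring
      rw [h6]
      linarith [sq_nonneg (T * P - 16 * s ^ 2 * (T⁻¹ * R)), mul_le_mul_of_nonneg_left h1
        (show 0 ≤ 64 * s ^ 2 by positivity)]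
    linarith [neg_abs_le (8 * (s * τ) * (α * β))]
  -- the coefficient of `R`
  have hτn : n * τ ≤ T⁻¹ := by
    rw [hτ, ← mul_div_assoc, div_le_iff₀ hMp, inv_mul_eq_div, le_div_iff₀ hT]
    linarith
  have hZT : T⁻¹ ≤ Z := by rw [inv_le_iff_one_le_mul₀ hT]; linarith
  have hTi : 0 < T⁻¹ := inv_pos.mpr hT
  have hZp : 0 < Z := lt_of_lt_of_le hTi hZT
  have b4 : -(6 * (p - 1) * (1 - s) * s * Z * 4 * R) ≤
      -(4 * (6 * (p - 1) * (1 - s) * s * (Z / (w + e))) * β ^ 2) := by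
    have h1 : β ^ 2 / (w + e) ≤ R := by
      rw [div_le_iff₀ (by linarith)]
      linarith [mul_nonneg hR he.le]
    have h2 : 0 ≤ 6 * (p - 1) * (1 - s) * s * Z * 4 := by
      have : 0 ≤ 1 - s := by linarith
      positivity
    have := mul_le_mul_of_nonneg_left h1 h2
    have e6 : 4 * (6 * (p - 1) * (1 - s) * s * (Z / (w + e))) * β ^ 2 =
      6 * (p - 1) * (1 - s) * s * Z * 4 * (β ^ 2 / (w + e)) := by ring
    rw [e6]; linarith
  have b5 : -(4 * s * (1 - s) * (n * τ) * (z + x * z) * R) ≤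
      4 * (s * (s - 1) * n * (T / M ^ 2)) * β ^ 2 - 4 * s * (1 - s) * x * (n * τ / M) * β ^ 2 := by
    have h1 : β ^ 2 / M ≤ z * R := by
      rw [hz, div_mul_eq_mul_div]; gcongr
    have h2 : 0 ≤ 4 * s * (1 - s) * (n * τ) * (1 + x) := by
      have : 0 ≤ 1 - s := by linarith
      positivity
    have := mul_le_mul_of_nonneg_left h1 h2
    have e7 : 4 * (s * (s - 1) * n * (T / M ^ 2)) * β ^ 2 - 4 * s * (1 - s) * x * (n * τ / M) * β ^ 2
        = -(4 * s * (1 - s) * (n * τ) * (1 + x) * (β ^ 2 / M)) := by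
      rw [e1]; ring
    rw [e7]; linarith
  have b6 : -(2 * s * (1 - 2 * s) * T⁻¹) ≤
      2 * s * (n * τ) - 4 * s * (1 - s) * (n * τ) * (z + x * z) := by
    have h1 : z + x * z ≤ 1 := by
      have := mul_le_mul_of_nonneg_right (show x ≤ 1 - z by linarith) hz0
      linarith [sq_nonneg (1 - z)]
    have h2 : 0 ≤ n * τ := by positivity
    have h3 : 4 * s * (1 - s) * (n * τ) * (z + x * z) ≤ 4 * s * (1 - s) * (n * τ) * 1 := by
      have : 0 ≤ 1 - s := by linarith
      gcongr
    have h4 : 2 * s * (1 - 2 * s) * (n * τ) ≤ 2 * s * (1 - 2 * s) * T⁻¹ := by gcongr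
    linarith
  have b7 : 12 * (1 - s) * T⁻¹ ≤
      2 * (6 * (p - 1) * (1 - s) * Z) - 6 * (p - 1) * (1 - s) * s * Z * 4 := by
    have : 2 * (6 * (p - 1) * (1 - s) * Z) - 6 * (p - 1) * (1 - s) * s * Z * 4
        = 12 * (1 - s) * Z := by linear_combination (12 * (1 - s) * Z) * hc
    rw [this]
    have : 0 ≤ 1 - s := by linarith
    gcongr
  have b8 : T⁻¹ * R ≤ (12 * (1 - s) * T⁻¹ - 2 * s * (1 - 2 * s) * T⁻¹ - 16 * s ^ 2 * T⁻¹) * R := by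
    refine mul_le_mul_of_nonneg_right ?_ hR
    have : 1 ≤ 12 * (1 - s) - 2 * s * (1 - 2 * s) - 16 * s ^ 2 := by
      linarith [mul_nonneg hs0 hs1.le]
    linarith [mul_le_mul_of_nonneg_right this hTi.le]
  have b6' := mul_le_mul_of_nonneg_right b6 hR
  have b7' := mul_le_mul_of_nonneg_right b7 hR
  have b9 : 0 ≤ 2 * (s * (p - 1) * (n * l) * τ) * P := by positivity
  linarith

variable {p e n w : ℝ}

/-- This lower bound and `bellW_ge` make the zero-order terms favourable that arise when the second
derivatives of `U` and `V` are eliminated through their equations. -/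
lemma bellN_ge (hp : 2 ≤ p) (he : 0 < e) (hn : 0 ≤ n) (hw : 0 ≤ w) :
    bellM p e n w ^ bellExp p ≤ bellN p e n w := by
  have h1 := bellM_pos (p := p) he hn hw
  have h2 := bellExp_nonneg hp
  have h3 : 0 ≤ p - 1 := by linarith
  unfold bellN
  have : 0 ≤ bellExp p * (p - 1) * n ^ (p - 1) * bellM p e n w ^ (bellExp p - 1) := by positivity
  linarith

lemma rpow_neg_bellM_le (hp : 2 ≤ p) (he : 0 < e) (hn : 0 ≤ n) (hw : 0 ≤ w) :
    bellM p e n w ^ (-bellExp p) ≤ (w + e) ^ (-bellExp p) := by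
  refine Real.rpow_le_rpow_of_nonpos (by linarith) ?_ (by linarith [bellExp_nonneg hp])
  unfold bellM
  linarith [Real.rpow_nonneg hn (p - 1)]

lemma bellW_ge (hp : 2 ≤ p) (he : 0 < e) (hn : 0 ≤ n) (hw : 0 ≤ w) :
    bellM p e n w ^ (-bellExp p) ≤ bellW p e n w := by
  have h1 := bellM_pos (p := p) he hn hw
  have h2 := bellExp_nonneg hp
  have h4 := bellExp_lt hp
  have h5 := rpow_neg_bellM_le hp he hn hw
  unfold bellW
  have h6 : 0 ≤ bellExp p * n * bellM p e n w ^ (bellExp p - 1) := by positivity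
  have h7 : 0 ≤ (w + e) ^ (-bellExp p) := Real.rpow_nonneg (by linarith) _
  have h8 : 1 ≤ 6 * (p - 1) * (1 - bellExp p) := by nlinarith
  nlinarith

/-- The convexity of the Bellman function along straight lines: `P` and `R` stand for the squared lengths
of the derivatives of `U` and `V`, and `α`, `β` for half the derivatives of `|U|²` and `|V|²`. -/
lemma bell_form (hp : 2 ≤ p) (he : 0 < e) (hn : 0 ≤ n) (hw : 0 ≤ w) {P R α β : ℝ} (hP : 0 ≤ P)
    (hR : 0 ≤ R) (hα : α ^ 2 ≤ n * P) (hβ : β ^ 2 ≤ w * R) :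
    bellM p e n w ^ bellExp p * P + bellM p e n w ^ (-bellExp p) * R ≤
      bellNN p e n w * (2 * α) ^ 2 + 2 * bellNW p e n w * ((2 * α) * (2 * β)) +
        bellWW p e n w * (2 * β) ^ 2 + bellN p e n w * (2 * P) + bellW p e n w * (2 * R) := by
  have hM := bellM_pos (p := p) he hn hw
  have hs := bellExp_nonneg hp
  have hT : 0 < bellM p e n w ^ bellExp p := Real.rpow_pos_of_pos hM _
  have e1 : n ^ (p - 1) = n * n ^ (p - 2) := by
    rw [mul_comm, ← Real.rpow_add_one' hn (by linarith)]; ring_nf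
  have hnT : n * (bellM p e n w ^ bellExp p) ^ 2 ≤ bellM p e n w := by
    have h1 : n ≤ bellM p e n w ^ (1 - 2 * bellExp p) := by
      rw [one_sub_two_mul_bellExp hp]
      have : n = (n ^ (p - 1)) ^ (1 / (p - 1)) := by
        rw [← Real.rpow_mul hn, mul_one_div_cancel (by linarith), Real.rpow_one]
      nth_rw 1 [this]
      refine Real.rpow_le_rpow (Real.rpow_nonneg hn _) ?_ (one_div_nonneg.mpr (by linarith))
      unfold bellM; linarith
    calc _ ≤ bellM p e n w ^ (1 - 2 * bellExp p) * (bellM p e n w ^ bellExp p) ^ 2 := by gcongr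
      _ = bellM p e n w := by
        rw [← Real.rpow_natCast, ← Real.rpow_mul hM.le, ← Real.rpow_add hM]
        push_cast
        rw [show 1 - 2 * bellExp p + bellExp p * 2 = 1 by ring, Real.rpow_one]
  have hZ : 1 ≤ (w + e) ^ (-bellExp p) * bellM p e n w ^ bellExp p := by
    have h := rpow_neg_bellM_le hp he hn hw
    rw [Real.rpow_neg hM.le] at h
    calc 1 = (bellM p e n w ^ bellExp p)⁻¹ * bellM p e n w ^ bellExp p := (inv_mul_cancel₀ hT.ne').symm
      _ ≤ _ := by gcongr
  have h := bell_form_aux (l := n ^ (p - 2)) (M := bellM p e n w) hp rfl hn hw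
    (Real.rpow_nonneg hn _) he
    (by rw [bellM, e1]) hT hnT hZ hP hR hα hβ
  rw [← Real.rpow_neg hM.le] at h
  refine h.trans (le_of_eq ?_)
  unfold bellNN bellNW bellWW bellN bellW
  rw [e1, Real.rpow_sub hM _ 2, Real.rpow_sub_one hM.ne', Real.rpow_sub_one (show w + e ≠ 0 by linarith),
    Real.rpow_two]
  simp only [show ((p - 2) / (2 * (p - 1))) = bellExp p from rfl]
  ring

/-- The error in the size estimate of the Bellman function caused by the regularization. For `p = 2`
the exponent vanishes and `M ^ s = 1` regardless of `e`, so there is no error. -/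
def bellErr (p e : ℝ) : ℝ := if p = 2 then 0 else e ^ bellExp p

lemma tendsto_bellErr (hp : 2 ≤ p) : Tendsto (bellErr p) (𝓝[>] 0) (𝓝 0) := by
  unfold bellErr
  by_cases h : p = 2
  · simp [h]
  · simp only [h, if_false]
    have hs : 0 < bellExp p :=
      div_pos (sub_pos.mpr (lt_of_le_of_ne hp (Ne.symm h))) (by linarith)
    have := (Real.continuous_rpow_const hs.le).tendsto 0
    rw [Real.zero_rpow hs.ne'] at this
    exact this.mono_left nhdsWithin_le_nhds

lemma bell_zero : bell p e 0 0 = 6 * (p - 1) * e ^ (1 - bellExp p) := by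
  simp [bell]

lemma bell_sub_nonneg (hp : 2 ≤ p) (he : 0 < e) (hn : 0 ≤ n) (hw : 0 ≤ w) :
    0 ≤ bell p e n w - bell p e 0 0 := by
  rw [bell_zero]
  have h1 : e ^ (1 - bellExp p) ≤ (w + e) ^ (1 - bellExp p) :=
    Real.rpow_le_rpow he.le (by linarith) (by linarith [bellExp_lt hp])
  have h2 := Real.rpow_nonneg (bellM_pos (p := p) he hn hw).le (bellExp p)
  unfold bell
  nlinarith [mul_nonneg hn h2]

/-- The size of the Bellman function. The cross term `n w ^ s` is estimated by `w ^ (1 - s)` where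
`n ^ (p - 1) ≤ w`, and by `n ^ (p / 2)` elsewhere. -/
lemma bell_sub_le (hp : 2 ≤ p) (he : 0 < e) (hn : 0 ≤ n) (hw : 0 ≤ w) :
    bell p e n w - bell p e 0 0 ≤
      (6 * (p - 1) + 1) * w ^ (1 - bellExp p) + 2 * n ^ (p / 2) + bellErr p e * n := by
  have hs := bellExp_nonneg hp
  have hs2 := bellExp_lt hp
  have hm := Real.rpow_nonneg hn (p - 1)
  have h1 : (w + e) ^ (1 - bellExp p) ≤ w ^ (1 - bellExp p) + e ^ (1 - bellExp p) :=
    Real.rpow_add_le_add_rpow hw he.le (by linarith) (by linarith)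
  have hnn : 0 ≤ n ^ (p / 2) := Real.rpow_nonneg hn _
  have hww : 0 ≤ w ^ (1 - bellExp p) := Real.rpow_nonneg hw _
  have h2 : n * bellM p e n w ^ bellExp p ≤
      w ^ (1 - bellExp p) + 2 * n ^ (p / 2) + bellErr p e * n := by
    unfold bellErr
    by_cases h : p = 2
    · have : bellExp p = 0 := by simp [bellExp, h]
      rw [this] at hww ⊢
      simp only [h, if_true] at hnn ⊢
      simp only [Real.rpow_zero]
      norm_num at hnn hww ⊢
      linarith
    · simp only [h, if_false]
      have hs0 : 0 < bellExp p :=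
        div_pos (sub_pos.mpr (lt_of_le_of_ne hp (Ne.symm h))) (by linarith)
      have a1 : bellM p e n w ^ bellExp p ≤
          (n ^ (p - 1)) ^ bellExp p + (w ^ bellExp p + e ^ bellExp p) := by
        unfold bellM
        refine (Real.rpow_add_le_add_rpow hm (by linarith) hs (by linarith)).trans ?_
        gcongr
        exact Real.rpow_add_le_add_rpow hw he.le hs (by linarith)
      have a2 : n * (n ^ (p - 1)) ^ bellExp p = n ^ (p / 2) := by
        have : p / 2 = (p - 1) * bellExp p + 1 := by
          unfold bellExp
          have : p - 1 ≠ 0 := by linarith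
          field_simp; ring
        rw [← Real.rpow_mul hn, this, Real.rpow_add_one' hn (by nlinarith), mul_comm]
      have a3 : n * w ^ bellExp p ≤ w ^ (1 - bellExp p) + n ^ (p / 2) := by
        have ep : (p - 1) * (1 - 2 * bellExp p) = 1 := by
          rw [one_sub_two_mul_bellExp hp]; exact mul_one_div_cancel (by linarith)
        rcases le_total (n ^ (p - 1)) w with hcase | hcase
        · have b1 : n ≤ w ^ (1 - 2 * bellExp p) := by
            calc n = (n ^ (p - 1)) ^ (1 - 2 * bellExp p) := by
                  rw [← Real.rpow_mul hn, ep, Real.rpow_one]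
              _ ≤ _ := Real.rpow_le_rpow hm hcase (by linarith)
          have b2 : n * w ^ bellExp p ≤ w ^ (1 - 2 * bellExp p) * w ^ bellExp p := by gcongr
          rw [← Real.rpow_add' hw (by linarith)] at b2
          rw [show 1 - 2 * bellExp p + bellExp p = 1 - bellExp p by ring] at b2
          linarith
        · have b1 : w ^ bellExp p ≤ (n ^ (p - 1)) ^ bellExp p := Real.rpow_le_rpow hw hcase hs
          have b2 : n * w ^ bellExp p ≤ n * (n ^ (p - 1)) ^ bellExp p := by gcongr
          linarith
      calc n * bellM p e n w ^ bellExp p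
          ≤ n * ((n ^ (p - 1)) ^ bellExp p + (w ^ bellExp p + e ^ bellExp p)) := by gcongr
        _ = n * (n ^ (p - 1)) ^ bellExp p + n * w ^ bellExp p + e ^ bellExp p * n := by ring
        _ ≤ _ := by rw [a2]; linarith
  rw [bell_zero]
  unfold bell
  nlinarith

lemma exists_bound_of_continuousOn {F : ℝ → ℝ → ℝ} (K : ℝ)
    (hF : ContinuousOn (fun z : ℝ × ℝ => F z.1 z.2) (Set.Icc 0 K ×ˢ Set.Icc 0 K)) :
    ∃ C, 0 ≤ C ∧ ∀ n w, 0 ≤ n → n ≤ K → 0 ≤ w → w ≤ K → |F n w| ≤ C := by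
  obtain ⟨C, hC⟩ := (isCompact_Icc.prod isCompact_Icc).exists_bound_of_continuousOn hF
  exact ⟨max C 0, le_max_right _ _, fun n w h1 h2 h3 h4 =>
    (hC (n, w) ⟨⟨h1, h2⟩, ⟨h3, h4⟩⟩).trans (le_max_left _ _)⟩

section cont

variable {S : Set (ℝ × ℝ)}

lemma continuousOn_bellM_rpow (hp : 2 ≤ p) (he : 0 < e) (hS : ∀ z ∈ S, 0 ≤ z.1 ∧ 0 ≤ z.2)
    (r : ℝ) : ContinuousOn (fun z : ℝ × ℝ => bellM p e z.1 z.2 ^ r) S := by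
  refine ContinuousOn.rpow_const ?_ fun z hz => Or.inl (bellM_pos he (hS z hz).1 (hS z hz).2).ne'
  unfold bellM
  exact (continuousOn_fst.rpow_const fun _ _ => Or.inr (by linarith)).add
    (continuousOn_snd.add continuousOn_const)

lemma continuousOn_add_rpow (he : 0 < e) (hS : ∀ z ∈ S, 0 ≤ z.1 ∧ 0 ≤ z.2)
    (r : ℝ) : ContinuousOn (fun z : ℝ × ℝ => (z.2 + e) ^ r) S :=
  (continuousOn_snd.add continuousOn_const).rpow_const fun z hz =>
    Or.inl (add_pos_of_nonneg_of_pos (hS z hz).2 he).ne'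

lemma continuousOn_fst_rpow {r : ℝ} (hr : 0 ≤ r) : ContinuousOn (fun z : ℝ × ℝ => z.1 ^ r) S :=
  continuousOn_fst.rpow_const fun _ _ => Or.inr hr

lemma continuousOn_bell_all (hp : 2 ≤ p) (he : 0 < e) (hS : ∀ z ∈ S, 0 ≤ z.1 ∧ 0 ≤ z.2) :
    ContinuousOn (fun z : ℝ × ℝ => bell p e z.1 z.2) S ∧
    ContinuousOn (fun z : ℝ × ℝ => bellN p e z.1 z.2) S ∧
    ContinuousOn (fun z : ℝ × ℝ => bellW p e z.1 z.2) S ∧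
    ContinuousOn (fun z : ℝ × ℝ => bellNN p e z.1 z.2) S ∧
    ContinuousOn (fun z : ℝ × ℝ => bellNW p e z.1 z.2) S ∧
    ContinuousOn (fun z : ℝ × ℝ => bellWW p e z.1 z.2) S := by
  have hM := continuousOn_bellM_rpow hp he hS
  have hY := continuousOn_add_rpow he hS
  have h1 := continuousOn_fst_rpow (S := S) (r := p - 1) (by linarith)
  have h2 := continuousOn_fst_rpow (S := S) (r := p - 2) (by linarith)
  have hf : ContinuousOn (fun z : ℝ × ℝ => z.1) S := continuousOn_fst
  have hM0 := hM (bellExp p)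
  have hM1 := hM (bellExp p - 1)
  have hM2 := hM (bellExp p - 2)
  have hY0 := hY (1 - bellExp p)
  have hY1 := hY (-bellExp p)
  have hY2 := hY (-bellExp p - 1)
  unfold bell bellN bellW bellNN bellNW bellWW
  have hc : ∀ c : ℝ, ContinuousOn (fun _ : ℝ × ℝ => c) S := fun _ => continuousOn_const
  exact ⟨((hc _).mul hY0).add (hf.mul hM0), hM0.add (((hc _).mul h1).mul hM1),
    ((hc _).mul hY1).add (((hc _).mul hf).mul hM1),
    ((hc _).mul h2).mul (((hc _).mul hM1).add (((hc _).mul h1).mul hM2)),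
    ((hc _).mul hM1).add (((hc _).mul h1).mul hM2),
    ((hc _).mul hY2).neg.add (((hc _).mul hf).mul hM2)⟩

end cont

end

section

/-! ### Laguerre functions on the orthant -/

variable {d : ℕ}

/-- The open orthant `(0, ∞)^d`. -/
def orthant (d : ℕ) : Set (Fin d → ℝ) := Set.univ.pi fun _ => Set.Ioi 0

lemma mem_orthant {x : Fin d → ℝ} : x ∈ orthant d ↔ ∀ i, 0 < x i := by
  simp [orthant, Set.mem_pi]

lemma isOpen_orthant : IsOpen (orthant d) :=
  isOpen_set_pi Set.finite_univ fun _ _ => isOpen_Ioi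

lemma measurableSet_orthant : MeasurableSet (orthant d) := isOpen_orthant.measurableSet

lemma update_mem_orthant {x : Fin d → ℝ} (hx : x ∈ orthant d) (j : Fin d) {s : ℝ} (hs : 0 < s) :
    Function.update x j s ∈ orthant d := by
  rw [mem_orthant] at hx ⊢
  intro i
  rcases eq_or_ne i j with rfl | h
  · simpa using hs
  · simpa [h] using hx i

lemma mu_eq_restrict : mu d = volume.restrict (orthant d) := rfl

lemma mu_eq_pi : mu d = Measure.pi fun _ => (volume : Measure ℝ).restrict (Set.Ioi 0) := by
  rw [mu, volume_pi, Measure.restrict_pi_pi]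

instance : SFinite (mu d) := by unfold mu; infer_instance

lemma ae_mu {P : (Fin d → ℝ) → Prop} (h : ∀ x ∈ orthant d, P x) : ∀ᵐ x ∂(mu d), P x :=
  (ae_restrict_iff' measurableSet_orthant).mpr (ae_of_all _ h)

lemma aestronglyMeasurable_mu {E : Type*} [NormedAddCommGroup E]
    {f : (Fin d → ℝ) → E} (h : ContinuousOn f (orthant d)) :
    AEStronglyMeasurable f (mu d) :=
  h.aestronglyMeasurable measurableSet_orthant

/-- The Gaussian `exp (-c |x|²)`. -/
def gauss (c : ℝ) (x : Fin d → ℝ) : ℝ := Real.exp (-c * ∑ i, x i ^ 2)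

lemma gauss_pos (c : ℝ) (x : Fin d → ℝ) : 0 < gauss c x := Real.exp_pos _

lemma gauss_mul (a b : ℝ) (x : Fin d → ℝ) : gauss a x * gauss b x = gauss (a + b) x := by
  rw [gauss, gauss, gauss, ← Real.exp_add]; ring_nf

lemma gauss_le_one {c : ℝ} (hc : 0 ≤ c) (x : Fin d → ℝ) : gauss c x ≤ 1 := by
  rw [gauss, Real.exp_le_one_iff]
  have : 0 ≤ ∑ i, x i ^ 2 := Finset.sum_nonneg fun i _ => sq_nonneg _
  nlinarith

lemma gauss_rpow (c p : ℝ) (x : Fin d → ℝ) : gauss c x ^ p = gauss (c * p) x := by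
  rw [gauss, gauss, ← Real.exp_mul]; ring_nf

lemma gauss_eq_prod (c : ℝ) (x : Fin d → ℝ) : gauss c x = ∏ i, Real.exp (-c * x i ^ 2) := by
  rw [gauss, Finset.mul_sum, Real.exp_sum]

lemma continuous_gauss (c : ℝ) : Continuous (gauss c : (Fin d → ℝ) → ℝ) := by
  unfold gauss; fun_prop

lemma gauss_update (c : ℝ) (x : Fin d → ℝ) (j : Fin d) (s : ℝ) :
    gauss c (Function.update x j s) = gauss c (Function.update x j 0) * Real.exp (-c * s ^ 2) := by
  rw [gauss, gauss, ← Real.exp_add]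
  congr 1
  have h : ∀ r : ℝ, ∑ i, Function.update x j r i ^ 2 = r ^ 2 + ∑ i ∈ {j}ᶜ, x i ^ 2 := by
    intro r
    rw [Fintype.sum_eq_add_sum_compl j]
    congr 1
    · simp
    · refine Finset.sum_congr rfl fun i hi => ?_
      rw [Function.update_of_ne (by simpa using hi)]
  rw [h, h]; ring

lemma integrable_gauss {c : ℝ} (hc : 0 < c) : Integrable (gauss c) (mu d) := by
  rw [mu_eq_pi]
  have h : (gauss c : (Fin d → ℝ) → ℝ) = fun x => ∏ i, Real.exp (-c * x i ^ 2) := by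
    funext x; exact gauss_eq_prod c x
  rw [h]
  exact Integrable.fintype_prod (f := fun _ : Fin d => fun t : ℝ => Real.exp (-c * t ^ 2))
    fun i => (integrable_exp_neg_mul_sq hc).restrict

/-- Fubini in one coordinate: a function with vanishing integrals along all lines parallel to a
coordinate axis has vanishing integral. -/
lemma integral_mu_eq_zero (j : Fin d) {f : (Fin d → ℝ) → ℝ} (hf : Integrable f (mu d))
    (h : ∀ x ∈ orthant d, ∫ s in Set.Ioi (0 : ℝ), f (Function.update x j s) = 0) :
    ∫ x, f x ∂(mu d) = 0 := by
  rcases d with _ | n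
  · exact j.elim0
  have hp := measurePreserving_piFinSuccAbove
    (fun _ : Fin (n + 1) => (volume : Measure ℝ).restrict (Set.Ioi 0)) j
  rw [← mu_eq_pi, ← mu_eq_pi] at hp
  have hs := hp.symm
  rw [← hs.integral_comp' f]
  have hi : Integrable (fun z => f ((MeasurableEquiv.piFinSuccAbove (fun _ => ℝ) j).symm z))
      (((volume : Measure ℝ).restrict (Set.Ioi 0)).prod (mu n)) :=
    (hs.integrable_comp_emb (MeasurableEquiv.measurableEmbedding _)).mpr hf
  rw [integral_prod_symm _ hi]
  refine integral_eq_zero_of_ae (ae_mu fun y hy => ?_)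
  have h1 : Fin.insertNth (α := fun _ => ℝ) j 1 y ∈ orthant (n + 1) := by
    rw [mem_orthant] at hy ⊢
    intro i
    rcases eq_or_ne i j with rfl | hij
    · simp
    · obtain ⟨k, rfl⟩ := Fin.exists_succAbove_eq hij
      simpa using hy k
  have h2 := h _ h1
  simp only [Fin.update_insertNth] at h2
  exact h2

/-- The tensor product of functions of one variable. -/
def tens (f : Fin d → ℝ → ℝ) (x : Fin d → ℝ) : ℝ := ∏ i, f i (x i)

lemma tens_update_left (f : Fin d → ℝ → ℝ) (x : Fin d → ℝ) (j : Fin d) (g : ℝ → ℝ) :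
    tens (Function.update f j g) x = g (x j) * ∏ i ∈ {j}ᶜ, f i (x i) := by
  rw [tens, Fintype.prod_eq_mul_prod_compl j]
  congr 1
  · simp
  · refine Finset.prod_congr rfl fun i hi => ?_
    rw [Function.update_of_ne (by simpa using hi)]

lemma tens_eq (f : Fin d → ℝ → ℝ) (x : Fin d → ℝ) (j : Fin d) :
    tens f x = f j (x j) * ∏ i ∈ {j}ᶜ, f i (x i) := by
  rw [tens, Fintype.prod_eq_mul_prod_compl j]

lemma hasDerivAt_tens {f : Fin d → ℝ → ℝ} {j : Fin d} {g g' : ℝ → ℝ} {x : Fin d → ℝ}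
    (h : HasDerivAt g (g' (x j)) (x j)) :
    HasDerivAt (fun s => tens (Function.update f j g) (Function.update x j s))
      (tens (Function.update f j g') x) (x j) := by
  have e : (fun s => tens (Function.update f j g) (Function.update x j s)) =
      fun s => g s * ∏ i ∈ {j}ᶜ, f i (x i) := by
    funext s
    rw [tens_update_left]
    congr 1
    · simp
    · refine Finset.prod_congr rfl fun i hi => ?_
      rw [Function.update_of_ne (by simpa using hi)]
  rw [e, tens_update_left]
  exact h.mul_const _

lemma continuousOn_tens {f : Fin d → ℝ → ℝ} (h : ∀ i, ContinuousOn (f i) (Set.Ioi 0)) :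
    ContinuousOn (tens f) (orthant d) := by
  unfold tens
  refine continuousOn_finsetProd _ fun i _ => ?_
  exact (h i).comp (continuous_apply i).continuousOn fun x hx => mem_orthant.mp hx i

lemma phi_eq_tens (α : Fin d → ℝ) (k : Fin d → ℕ) : phi α k = tens fun i => phi1 (α i) (k i) := rfl

/-- The partial derivative `∂_j φ_k^α`. -/
def dphi (α : Fin d → ℝ) (k : Fin d → ℕ) (j : Fin d) : (Fin d → ℝ) → ℝ :=
  tens (Function.update (fun i => phi1 (α i) (k i)) j (dphi1 (α j) (k j)))

/-- The second partial derivative `∂_j² φ_k^α`. -/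
def ddphi (α : Fin d → ℝ) (k : Fin d → ℕ) (j : Fin d) : (Fin d → ℝ) → ℝ :=
  tens (Function.update (fun i => phi1 (α i) (k i)) j (ddphi1 (α j) (k j)))

lemma hasDerivAt_phi (α : Fin d → ℝ) (k : Fin d → ℕ) (j : Fin d) {x : Fin d → ℝ}
    (hx : x ∈ orthant d) :
    HasDerivAt (fun s => phi α k (Function.update x j s)) (dphi α k j x) (x j) := by
  have := hasDerivAt_tens (f := fun i => phi1 (α i) (k i)) (j := j) (x := x)
    (g' := dphi1 (α j) (k j)) (hasDerivAt_phi1 (α j) (k j) (mem_orthant.mp hx j))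
  rwa [Function.update_eq_self j (fun i => phi1 (α i) (k i))] at this

lemma hasDerivAt_dphi {α : Fin d → ℝ} (hα : ∀ i, -1 < α i) (k : Fin d → ℕ) (j : Fin d)
    {x : Fin d → ℝ} (hx : x ∈ orthant d) :
    HasDerivAt (fun s => dphi α k j (Function.update x j s)) (ddphi α k j x) (x j) :=
  hasDerivAt_tens (hasDerivAt_dphi1 (hα j) (k j) (mem_orthant.mp hx j))

/-- The potential `|x|² + ∑ (α_i² - 1/4) / x_i²`. -/
def pot (α : Fin d → ℝ) (x : Fin d → ℝ) : ℝ := ∑ i, (x i ^ 2 + (α i ^ 2 - 1 / 4) / x i ^ 2)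

lemma sum_ddphi (α : Fin d → ℝ) (k : Fin d → ℕ) (x : Fin d → ℝ) :
    ∑ j, ddphi α k j x = (pot α x - eigenvalue α k) * phi α k x := by
  have h : ∀ j, ddphi α k j x = (x j ^ 2 + (α j ^ 2 - 1 / 4) / x j ^ 2
      - (4 * k j + 2 * α j + 2)) * phi α k x := by
    intro j
    rw [ddphi, tens_update_left, phi_eq_tens, tens_eq _ x j, ddphi1]
    ring
  rw [Finset.sum_congr rfl fun j _ => h j, ← Finset.sum_mul]
  congr 1
  rw [Finset.sum_sub_distrib, pot, eigenvalue]
  simp only [Finset.sum_add_distrib, Finset.mul_sum, Finset.sum_const, Finset.card_univ,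
    Fintype.card_fin, nsmul_eq_mul]
  ring

lemma delta_phi (α : Fin d → ℝ) (k : Fin d → ℕ) (i : Fin d) {x : Fin d → ℝ}
    (hx : x ∈ orthant d) :
    delta α i (phi α k) x = dphi α k i x + (x i - (α i + 1 / 2) / x i) * phi α k x := by
  rw [delta, partialDeriv, (hasDerivAt_phi α k i hx).deriv]

/-- The type `α + e_i` of the functions `δ_i φ_k^α`. -/
def raise (α : Fin d → ℝ) (i : Fin d) : Fin d → ℝ := Function.update α i (α i + 1)

/-- The multi-index `k - e_i`, truncated at `0`. -/
def lower (k : Fin d → ℕ) (i : Fin d) : Fin d → ℕ := Function.update k i (k i - 1)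

/-- The lowering relation `δ_i φ_k^α = -2 √k_i φ_{k - e_i}^{α + e_i}`. -/
lemma delta_phi_eq (α : Fin d → ℝ) (k : Fin d → ℕ) (i : Fin d) {x : Fin d → ℝ}
    (hx : x ∈ orthant d) :
    delta α i (phi α k) x = -2 * √(k i : ℝ) * phi (raise α i) (lower k i) x := by
  rw [delta_phi α k i hx, dphi, tens_update_left, phi_eq_tens, phi_eq_tens, tens_eq _ x i,
    tens_eq _ x i, dphi1]
  have : ∏ j ∈ {i}ᶜ, phi1 (raise α i j) (lower k i j) (x j) =
      ∏ j ∈ {i}ᶜ, phi1 (α j) (k j) (x j) := by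
    refine Finset.prod_congr rfl fun j hj => ?_
    have : j ≠ i := by simpa using hj
    simp [raise, lower, this]
  rw [this]
  simp only [raise, lower, Function.update_self]
  ring

lemma raise_gt {α : Fin d → ℝ} {c : ℝ} (hα : ∀ i, c < α i) (i j : Fin d) : c < raise α i j := by
  unfold raise
  rcases eq_or_ne j i with rfl | h
  · simp; linarith [hα j]
  · simpa [h] using hα j

/-- Orthonormality of the multi-dimensional Laguerre functions. -/
lemma integral_phi_mul {α : Fin d → ℝ} (hα : ∀ i, 1 / 2 < α i) (k m : Fin d → ℕ) :
    ∫ x, phi α k x * phi α m x ∂(mu d) = if k = m then 1 else 0 := by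
  rw [mu_eq_pi]
  have : (fun x : Fin d → ℝ => phi α k x * phi α m x) =
      fun x => ∏ i, phi1 (α i) (k i) (x i) * phi1 (α i) (m i) (x i) := by
    funext x; rw [phi, phi, Finset.prod_mul_distrib]
  rw [this, integral_fintype_prod_eq_prod (𝕜 := ℝ)
    (f := fun i t => phi1 (α i) (k i) t * phi1 (α i) (m i) t)]
  simp_rw [fun i => integral_phi1_mul (hα i).le (k i) (m i)]
  rcases eq_or_ne k m with rfl | h
  · simp
  · obtain ⟨i, hi⟩ := Function.ne_iff.mp h
    rw [if_neg h]
    exact Finset.prod_eq_zero (Finset.mem_univ i) (by simp [hi])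

/-- Gaussian bounds for `phi1` and its derivatives. The second derivative may blow up at `0`, but no
faster than `1 / x`, which the first-order vanishing of `phi1` itself compensates. -/
lemma phi1_jet_bound {b : ℝ} (hb : 1 / 2 < b) (k : ℕ) :
    ∃ C : ℝ, 0 ≤ C ∧ ∀ x : ℝ, 0 < x →
      |phi1 b k x| ≤ C * (x * Real.exp (-(1 / 4) * x ^ 2)) ∧
      |phi1 b k x| ≤ C * Real.exp (-(1 / 4) * x ^ 2) ∧
      |dphi1 b k x| ≤ C * Real.exp (-(1 / 4) * x ^ 2) ∧
      x * |ddphi1 b k x| ≤ C * Real.exp (-(1 / 4) * x ^ 2) := by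
  obtain ⟨C, hC, h⟩ := exists_phi1_bound hb.le k
  obtain ⟨D, hD, h'⟩ := exists_phi1_bound (b := b + 1) (by linarith) (k - 1)
  set c₁ := |b + 1 / 2| with hc₁
  set c₂ := |b ^ 2 - 1 / 4| with hc₂
  set c₃ := |4 * (k : ℝ) + 2 * b + 2| with hc₃
  have hc1 : 0 ≤ c₁ := abs_nonneg _
  have hc2 : 0 ≤ c₂ := abs_nonneg _
  have hc3 : 0 ≤ c₃ := abs_nonneg _
  set K := C + (c₁ + 1) * C + 2 * √(k : ℝ) * D + (1 + c₂ + c₃) * C with hK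
  have hk : 0 ≤ √(k : ℝ) := Real.sqrt_nonneg _
  have hCD : 0 ≤ 2 * √(k : ℝ) * D := by positivity
  have hA : 0 ≤ (c₁ + 1) * C := by positivity
  have hB : 0 ≤ (1 + c₂ + c₃) * C := by positivity
  have hKC : C ≤ K := by linarith
  have hK0 : 0 ≤ K := by linarith
  refine ⟨K, hK0, fun x hx => ?_⟩
  have e : Real.exp (-x ^ 2 / 4) = Real.exp (-(1 / 4) * x ^ 2) := by ring_nf
  have h1 := h x hx
  have h2 := h' x hx
  rw [e] at h1 h2
  set E := Real.exp (-(1 / 4) * x ^ 2)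
  have hE : 0 < E := Real.exp_pos _
  set f := |phi1 b k x| with hf
  set g := |phi1 (b + 1) (k - 1) x| with hg
  have hf0 : 0 ≤ f := abs_nonneg _
  have hg0 : 0 ≤ g := abs_nonneg _
  have hx4 : 0 < 1 + x ^ 4 := by positivity
  -- `x ^ j f ≤ C E` for small powers
  have key : ∀ (u r : ℝ), 0 ≤ u → 0 ≤ r → r * x ≤ 1 + x ^ 4 → ∀ B ≥ 0,
      (1 + x ^ 4) * u ≤ B * (x * E) → r * u ≤ B * E := by
    intro u r hu hr hrx B hB hBu
    have : x * (r * u) ≤ x * (B * E) := by nlinarith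
    exact le_of_mul_le_mul_left this hx
  have q1 : x ≤ 1 + x ^ 4 := by
    linarith [sq_nonneg (x ^ 2 - 1 / 2), sq_nonneg (x - 1 / 2)]
  have q2 : x ^ 2 ≤ 1 + x ^ 4 := by nlinarith [sq_nonneg (x ^ 2 - 1)]
  have q3 : x ^ 3 * x ≤ 1 + x ^ 4 := by nlinarith
  have f0 : f ≤ C * E := by
    have := key f 1 hf0 zero_le_one (by linarith) C hC h1; linarith
  have g0 : g ≤ D * E := by
    have := key g 1 hg0 zero_le_one (by linarith) D hD h2; linarith
  have f1 : x * f ≤ C * E := key f x hf0 hx.le (by nlinarith) C hC h1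
  have f3 : x ^ 3 * f ≤ C * E := key f (x ^ 3) hf0 (by positivity) q3 C hC h1
  have fm : x⁻¹ * f ≤ C * E := key f x⁻¹ hf0 (by positivity)
    (by rw [inv_mul_cancel₀ hx.ne']; linarith [show 0 ≤ x ^ 4 by positivity]) C hC h1
  refine ⟨?_, ?_, ?_, ?_⟩
  · have : f ≤ C * (x * E) := by nlinarith [show 0 ≤ x ^ 4 by positivity]
    exact this.trans (by gcongr)
  · exact f0.trans (by gcongr)
  · have : |dphi1 b k x| ≤ c₁ * (x⁻¹ * f) + x * f + 2 * √(k : ℝ) * g := by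
      have e1 : dphi1 b k x = (b + 1 / 2) * (x⁻¹ * phi1 b k x) - x * phi1 b k x -
          2 * √(k : ℝ) * phi1 (b + 1) (k - 1) x := by rw [dphi1]; ring
      rw [e1]
      refine (abs_sub _ _).trans (add_le_add ((abs_sub _ _).trans (add_le_add ?_ ?_)) ?_)
      · rw [abs_mul, abs_mul, abs_of_pos (inv_pos.mpr hx)]
      · rw [abs_mul, abs_of_pos hx]
      · rw [abs_mul, abs_of_nonneg (by positivity)]
    calc _ ≤ c₁ * (x⁻¹ * f) + x * f + 2 * √(k : ℝ) * g := this
      _ ≤ c₁ * (C * E) + C * E + 2 * √(k : ℝ) * (D * E) := by gcongr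
      _ = ((c₁ + 1) * C + 2 * √(k : ℝ) * D) * E := by ring
      _ ≤ K * E := by gcongr; linarith
  · have : x * |ddphi1 b k x| ≤ x ^ 3 * f + c₂ * (x⁻¹ * f) + c₃ * (x * f) := by
      rw [ddphi1, abs_mul]
      have : |x ^ 2 + (b ^ 2 - 1 / 4) / x ^ 2 - (4 * ↑k + 2 * b + 2)| ≤
          x ^ 2 + c₂ / x ^ 2 + c₃ := by
        refine (abs_sub _ _).trans (add_le_add ((abs_add_le _ _).trans (add_le_add ?_ ?_)) le_rfl)
        · rw [abs_of_nonneg (sq_nonneg x)]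
        · rw [abs_div, abs_of_nonneg (sq_nonneg x)]
      calc x * (|x ^ 2 + (b ^ 2 - 1 / 4) / x ^ 2 - (4 * ↑k + 2 * b + 2)| * |phi1 b k x|)
          ≤ x * ((x ^ 2 + c₂ / x ^ 2 + c₃) * f) := by gcongr
        _ = _ := by field_simp
    calc _ ≤ x ^ 3 * f + c₂ * (x⁻¹ * f) + c₃ * (x * f) := this
      _ ≤ C * E + c₂ * (C * E) + c₃ * (C * E) := by gcongr
      _ = ((1 + c₂ + c₃) * C) * E := by ring
      _ ≤ K * E := by gcongr; linarith

/-- Gaussian bounds for `phi` and its partial derivatives. -/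
lemma phi_jet_bound {α : Fin d → ℝ} (hα : ∀ i, 1 / 2 < α i) (k : Fin d → ℕ) :
    ∃ C : ℝ, 0 ≤ C ∧ ∀ x ∈ orthant d,
      |phi α k x| ≤ C * gauss (1 / 4) x ∧ ∀ j,
      |phi α k x| ≤ C * (x j * gauss (1 / 4) x) ∧
      |dphi α k j x| ≤ C * gauss (1 / 4) x ∧
      x j * |ddphi α k j x| ≤ C * gauss (1 / 4) x := by
  choose C hC h using fun i => phi1_jet_bound (hα i) (k i)
  have hP : 0 ≤ ∏ i, C i := Finset.prod_nonneg fun i _ => hC i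
  refine ⟨∏ i, C i, hP, fun x hx => ?_⟩
  rw [mem_orthant] at hx
  have comp : ∀ j, |∏ i ∈ {j}ᶜ, phi1 (α i) (k i) (x i)| ≤
      (∏ i ∈ {j}ᶜ, C i) * ∏ i ∈ {j}ᶜ, Real.exp (-(1 / 4) * x i ^ 2) := by
    intro j
    rw [Finset.abs_prod, ← Finset.prod_mul_distrib]
    exact Finset.prod_le_prod (fun i _ => abs_nonneg _) fun i _ => (h i (x i) (hx i)).2.1
  have hg : ∀ j, gauss (1 / 4) x = Real.exp (-(1 / 4) * x j ^ 2) *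
      ∏ i ∈ {j}ᶜ, Real.exp (-(1 / 4) * x i ^ 2) := fun j => by
    rw [gauss_eq_prod, Fintype.prod_eq_mul_prod_compl j]
  have hCp : ∀ j, ∏ i, C i = C j * ∏ i ∈ {j}ᶜ, C i := fun j => Fintype.prod_eq_mul_prod_compl j _
  have hnn : ∀ j, 0 ≤ (∏ i ∈ {j}ᶜ, C i) := fun j => Finset.prod_nonneg fun i _ => hC i
  refine ⟨?_, fun j => ⟨?_, ?_, ?_⟩⟩
  · rw [phi, Finset.abs_prod, gauss_eq_prod, ← Finset.prod_mul_distrib]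
    exact Finset.prod_le_prod (fun i _ => abs_nonneg _) fun i _ => (h i (x i) (hx i)).2.1
  · rw [phi_eq_tens, tens_eq _ x j, abs_mul, hg j, hCp j]
    calc _ ≤ (C j * (x j * Real.exp (-(1 / 4) * x j ^ 2))) *
          ((∏ i ∈ {j}ᶜ, C i) * ∏ i ∈ {j}ᶜ, Real.exp (-(1 / 4) * x i ^ 2)) :=
          mul_le_mul (h j (x j) (hx j)).1 (comp j) (abs_nonneg _)
            (mul_nonneg (hC j) (mul_nonneg (hx j).le (Real.exp_pos _).le))
      _ = _ := by ring
  · rw [dphi, tens_update_left, abs_mul, hg j, hCp j]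
    calc _ ≤ (C j * Real.exp (-(1 / 4) * x j ^ 2)) *
          ((∏ i ∈ {j}ᶜ, C i) * ∏ i ∈ {j}ᶜ, Real.exp (-(1 / 4) * x i ^ 2)) :=
          mul_le_mul (h j (x j) (hx j)).2.2.1 (comp j) (abs_nonneg _)
            (mul_nonneg (hC j) (Real.exp_pos _).le)
      _ = _ := by ring
  · rw [ddphi, tens_update_left, abs_mul, hg j, hCp j, ← mul_assoc]
    calc _ ≤ (C j * Real.exp (-(1 / 4) * x j ^ 2)) *
          ((∏ i ∈ {j}ᶜ, C i) * ∏ i ∈ {j}ᶜ, Real.exp (-(1 / 4) * x i ^ 2)) :=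
          mul_le_mul (h j (x j) (hx j)).2.2.2 (comp j) (abs_nonneg _)
            (mul_nonneg (hC j) (Real.exp_pos _).le)
      _ = _ := by ring

lemma continuousOn_phi (α : Fin d → ℝ) (k : Fin d → ℕ) :
    ContinuousOn (phi α k) (orthant d) :=
  continuousOn_tens fun i => continuousOn_phi1 (α i) (k i)

lemma continuousOn_dphi1 {a : ℝ} (ha : -1 < a) (k : ℕ) : ContinuousOn (dphi1 a k) (Set.Ioi 0) :=
  fun _ hx => (hasDerivAt_dphi1 ha k hx).continuousAt.continuousWithinAt

lemma continuousOn_ddphi1 (a : ℝ) (k : ℕ) : ContinuousOn (ddphi1 a k) (Set.Ioi 0) := by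
  unfold ddphi1
  refine ContinuousOn.mul (ContinuousOn.sub (ContinuousOn.add (by fun_prop)
    (ContinuousOn.div (by fun_prop) (by fun_prop) fun x hx => ?_)) (by fun_prop))
    (continuousOn_phi1 a k)
  exact pow_ne_zero 2 (ne_of_gt hx)

lemma continuousOn_dphi {α : Fin d → ℝ} (hα : ∀ i, -1 < α i) (k : Fin d → ℕ) (j : Fin d) :
    ContinuousOn (dphi α k j) (orthant d) := by
  refine continuousOn_tens fun i => ?_
  rcases eq_or_ne i j with rfl | h
  · simpa using continuousOn_dphi1 (hα i) (k i)
  · simpa [h] using continuousOn_phi1 (α i) (k i)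

lemma continuousOn_ddphi (α : Fin d → ℝ) (k : Fin d → ℕ) (j : Fin d) :
    ContinuousOn (ddphi α k j) (orthant d) := by
  refine continuousOn_tens fun i => ?_
  rcases eq_or_ne i j with rfl | h
  · simpa using continuousOn_ddphi1 (α i) (k i)
  · simpa [h] using continuousOn_phi1 (α i) (k i)

end

section

/-! ### Poisson extensions -/

variable {d : ℕ}

/-- The space-time weight `e^{-t} e^{-|x|²/4}` dominating all functions below. -/
def wt (x : Fin d → ℝ) (t : ℝ) : ℝ := Real.exp (-t) * gauss (1 / 4) x

lemma wt_pos (x : Fin d → ℝ) (t : ℝ) : 0 < wt x t := mul_pos (Real.exp_pos _) (gauss_pos _ _)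

lemma wt_le_one (x : Fin d → ℝ) {t : ℝ} (ht : 0 ≤ t) : wt x t ≤ 1 :=
  mul_le_one₀ (Real.exp_le_one_iff.mpr (by linarith)) (gauss_pos _ _).le
    (gauss_le_one (by norm_num) x)

lemma wt_sq (x : Fin d → ℝ) (t : ℝ) : wt x t ^ 2 = Real.exp (-(2 * t)) * gauss (1 / 2) x := by
  rw [wt, mul_pow, ← Real.exp_nat_mul, sq (gauss _ _), gauss_mul]
  norm_num

/-- A smooth function `F` on the orthant times the time axis, with its first and second partial
derivatives in space (`D`, `DD`) and time (`T`, `TT`), which solves `(∂_t² + Δ) F = W F` and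
is dominated by `wt`, with the derivatives other than `DD`. In addition `F` vanishes to first order at
the boundary of the orthant, and `DD j` is dominated after multiplication by `x j`; hence the
products `F * DD j` are bounded. -/
structure Sol (d : ℕ) where
  F : (Fin d → ℝ) → ℝ → ℝ
  D : Fin d → (Fin d → ℝ) → ℝ → ℝ
  DD : Fin d → (Fin d → ℝ) → ℝ → ℝ
  T : (Fin d → ℝ) → ℝ → ℝ
  TT : (Fin d → ℝ) → ℝ → ℝ
  W : (Fin d → ℝ) → ℝ
  hasD : ∀ x ∈ orthant d, ∀ t j, HasDerivAt (fun s => F (Function.update x j s) t) (D j x t) (x j)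
  hasDD : ∀ x ∈ orthant d, ∀ t j,
    HasDerivAt (fun s => D j (Function.update x j s) t) (DD j x t) (x j)
  hasT : ∀ x t, HasDerivAt (F x) (T x t) t
  hasTT : ∀ x t, HasDerivAt (T x) (TT x t) t
  eq : ∀ x ∈ orthant d, ∀ t, ∑ j, DD j x t + TT x t = W x * F x t
  contF : ContinuousOn (Function.uncurry F) (orthant d ×ˢ Set.univ)
  contT : ContinuousOn (Function.uncurry T) (orthant d ×ˢ Set.univ)
  contTT : ContinuousOn (Function.uncurry TT) (orthant d ×ˢ Set.univ)
  contD : ∀ j t, ContinuousOn (fun x => D j x t) (orthant d)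
  contDD : ∀ j t, ContinuousOn (fun x => DD j x t) (orthant d)
  bound : ∃ C : ℝ, 0 ≤ C ∧ ∀ x ∈ orthant d, ∀ t, 0 ≤ t →
    |F x t| ≤ C * wt x t ∧ |T x t| ≤ C * wt x t ∧ |TT x t| ≤ C * wt x t ∧
    ∀ j, |F x t| ≤ C * (x j * wt x t) ∧ |D j x t| ≤ C * wt x t ∧ x j * |DD j x t| ≤ C * wt x t

lemma Sol.contF_slice (u : Sol d) (t : ℝ) : ContinuousOn (fun x => u.F x t) (orthant d) :=
  u.contF.comp (f := fun x => (x, t)) (by fun_prop) fun _ hx => ⟨hx, Set.mem_univ t⟩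

lemma Sol.exists_common_bound {ι : Type*} [Fintype ι] (u : ι → Sol d) :
    ∃ C : ℝ, 0 ≤ C ∧ ∀ a, ∀ x ∈ orthant d, ∀ t, 0 ≤ t →
    |(u a).F x t| ≤ C * wt x t ∧ |(u a).T x t| ≤ C * wt x t ∧ |(u a).TT x t| ≤ C * wt x t ∧
    ∀ j, |(u a).F x t| ≤ C * (x j * wt x t) ∧ |(u a).D j x t| ≤ C * wt x t ∧
      x j * |(u a).DD j x t| ≤ C * wt x t := by
  choose C hC h using fun a => (u a).bound
  refine ⟨∑ a, C a, Finset.sum_nonneg fun a _ => hC a, fun a x hx t ht => ?_⟩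
  have hle : C a ≤ ∑ a, C a := Finset.single_le_sum (fun a _ => hC a) (Finset.mem_univ a)
  have hw := (wt_pos x t).le
  have hx' := mem_orthant.mp hx
  obtain ⟨h1, h2, h3, h4⟩ := h a x hx t ht
  refine ⟨h1.trans (by gcongr), h2.trans (by gcongr), h3.trans (by gcongr), fun j => ?_⟩
  obtain ⟨h5, h6, h7⟩ := h4 j
  have := (hx' j).le
  exact ⟨h5.trans (by gcongr), h6.trans (by gcongr), h7.trans (by gcongr)⟩

lemma one_le_eigenvalue [NeZero d] {α : Fin d → ℝ} (hα : ∀ i, 1 / 2 < α i) (k : Fin d → ℕ) :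
    1 ≤ eigenvalue α k := by
  unfold eigenvalue
  have h1 : (1 : ℝ) ≤ d := by exact_mod_cast NeZero.one_le
  have h2 : 0 ≤ ∑ i, (k i : ℝ) := Finset.sum_nonneg fun i _ => by positivity
  have h3 : 0 ≤ ∑ i, α i := Finset.sum_nonneg fun i _ => by linarith [hα i]
  linarith

/-- The Poisson extension `∑ c_k e^{-t √(λ_k + w)} φ_k^α` of a finite combination of Laguerre
functions. -/
def poisson [NeZero d] (α : Fin d → ℝ) (hα : ∀ i, 1 / 2 < α i) (w : ℝ) (hw : 0 ≤ w)
    (c : (Fin d → ℕ) →₀ ℝ) : Sol d where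
  F x t := ∑ k ∈ c.support, c k * Real.exp (-√(eigenvalue α k + w) * t) * phi α k x
  D j x t := ∑ k ∈ c.support, c k * Real.exp (-√(eigenvalue α k + w) * t) * dphi α k j x
  DD j x t := ∑ k ∈ c.support, c k * Real.exp (-√(eigenvalue α k + w) * t) * ddphi α k j x
  T x t := ∑ k ∈ c.support, c k * (Real.exp (-√(eigenvalue α k + w) * t) *
    (-√(eigenvalue α k + w))) * phi α k x
  TT x t := ∑ k ∈ c.support, c k * (Real.exp (-√(eigenvalue α k + w) * t) *
    (eigenvalue α k + w)) * phi α k x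
  W x := pot α x + w
  hasD x hx t j := HasDerivAt.fun_sum fun k _ => (hasDerivAt_phi α k j hx).const_mul _
  hasDD x hx t j := HasDerivAt.fun_sum fun k _ =>
    (hasDerivAt_dphi (fun i => by linarith [hα i]) k j hx).const_mul _
  hasT x t := HasDerivAt.fun_sum fun k _ =>
    ((((hasDerivAt_id' t).const_mul _).exp.congr_deriv (by ring)).const_mul _).mul_const _
  hasTT x t := HasDerivAt.fun_sum fun k _ => by
    have h := one_le_eigenvalue hα k
    refine HasDerivAt.mul_const (HasDerivAt.const_mul _ ?_) _
    refine ((((hasDerivAt_id' t).const_mul _).exp).mul_const _).congr_deriv ?_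
    rw [mul_assoc]
    congr 1
    rw [mul_one, neg_mul_neg, Real.mul_self_sqrt (by linarith)]
  eq x hx t := by
    rw [Finset.sum_comm, ← Finset.sum_add_distrib, Finset.mul_sum]
    refine Finset.sum_congr rfl fun k _ => ?_
    rw [← Finset.mul_sum, sum_ddphi]
    ring
  contF := by
    refine continuousOn_finsetSum _ fun k _ => ContinuousOn.mul (by fun_prop) ?_
    exact (continuousOn_phi α k).comp continuousOn_fst fun z hz => hz.1
  contT := by
    refine continuousOn_finsetSum _ fun k _ => ContinuousOn.mul (by fun_prop) ?_
    exact (continuousOn_phi α k).comp continuousOn_fst fun z hz => hz.1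
  contTT := by
    refine continuousOn_finsetSum _ fun k _ => ContinuousOn.mul (by fun_prop) ?_
    exact (continuousOn_phi α k).comp continuousOn_fst fun z hz => hz.1
  contD j t := continuousOn_finsetSum _ fun k _ =>
    continuousOn_const.mul (continuousOn_dphi (fun i => by linarith [hα i]) k j)
  contDD j t := continuousOn_finsetSum _ fun k _ => continuousOn_const.mul (continuousOn_ddphi α k j)
  bound := by
    choose C hC h using fun k => phi_jet_bound hα k
    set κ : (Fin d → ℕ) → ℝ := fun k => eigenvalue α k + w with hκ
    have hκ1 : ∀ k, 1 ≤ κ k := fun k => by linarith [one_le_eigenvalue hα k]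
    have hs1 : ∀ k, 1 ≤ √(κ k) := fun k => by rw [Real.one_le_sqrt]; exact hκ1 k
    have hs2 : ∀ k, √(κ k) ≤ κ k := fun k => by
      nlinarith [Real.mul_self_sqrt (show 0 ≤ κ k by linarith [hκ1 k]), hs1 k]
    set K : ℝ := ∑ k ∈ c.support, |c k| * κ k * C k with hK
    have hK0 : ∀ k, 0 ≤ |c k| * κ k * C k := fun k =>
      mul_nonneg (mul_nonneg (abs_nonneg _) (by linarith [hκ1 k])) (hC k)
    have key : ∀ (f : (Fin d → ℕ) → ℝ) (B : ℝ), (∀ k, |f k| ≤ |c k| * κ k * C k * B) →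
        |∑ k ∈ c.support, f k| ≤ K * B := by
      intro f B hf
      rw [hK, Finset.sum_mul]
      exact (Finset.abs_sum_le_sum_abs _ _).trans (Finset.sum_le_sum fun k _ => hf k)
    have hexp : ∀ k, ∀ t, 0 ≤ t → Real.exp (-√(κ k) * t) ≤ Real.exp (-t) := fun k t ht => by
      rw [Real.exp_le_exp]; nlinarith [hs1 k]
    -- one term: a factor bounded by `κ e^{-t}` times a factor bounded by `C b`
    have term : ∀ k t, 0 ≤ t → ∀ r a b : ℝ, |r| ≤ κ k → |a| ≤ C k * b →
        |c k * (Real.exp (-√(κ k) * t) * r) * a| ≤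
          |c k| * κ k * C k * (Real.exp (-t) * b) := by
      intro k t ht r a b hr ha
      have hb : 0 ≤ C k * b := (abs_nonneg _).trans ha
      rw [abs_mul, abs_mul, abs_mul, abs_of_pos (Real.exp_pos _)]
      have hκ0 : 0 ≤ κ k := by linarith [hκ1 k]
      calc _ ≤ |c k| * (Real.exp (-t) * κ k) * (C k * b) :=
            mul_le_mul (mul_le_mul_of_nonneg_left (mul_le_mul (hexp k t ht) hr (abs_nonneg _)
              (Real.exp_pos _).le) (abs_nonneg _)) ha (abs_nonneg _) (by positivity)
        _ = _ := by ring
    have term' : ∀ k t, 0 ≤ t → ∀ a b : ℝ, |a| ≤ C k * b →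
        |c k * Real.exp (-√(κ k) * t) * a| ≤ |c k| * κ k * C k * (Real.exp (-t) * b) := by
      intro k t ht a b ha
      have := term k t ht 1 a b (by simpa using hκ1 k) ha
      simpa using this
    refine ⟨K, Finset.sum_nonneg fun k _ => hK0 k, fun x hx t ht => ⟨?_, ?_, ?_, fun j =>
      ⟨?_, ?_, ?_⟩⟩⟩
    · exact key _ _ fun k => term' k t ht _ _ (h k x hx).1
    · refine key _ _ fun k => term k t ht _ _ _ ?_ (h k x hx).1
      rw [abs_neg, abs_of_nonneg (Real.sqrt_nonneg _)]; exact hs2 k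
    · refine key _ _ fun k => term k t ht _ _ _ ?_ (h k x hx).1
      rw [abs_of_nonneg (by linarith [hκ1 k])]
    · rw [wt, mul_left_comm (x j)]
      exact key _ _ fun k => term' k t ht _ _ ((h k x hx).2 j).1
    · exact key _ _ fun k => term' k t ht _ _ ((h k x hx).2 j).2.1
    · have hxj := mem_orthant.mp hx j
      rw [← abs_of_pos hxj, ← abs_mul, Finset.mul_sum]
      refine key _ _ fun k => ?_
      have := term' k t ht (x j * ddphi α k j x) (gauss (1 / 4) x)
        (by rw [abs_mul, abs_of_pos hxj]; exact ((h k x hx).2 j).2.2)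
      rw [wt]
      refine le_trans (le_of_eq ?_) this
      congr 1
      ring

/-! ### The Bellman function along a pair of vector-valued curves -/

section bd

variable {ι ι' : Type*} [Fintype ι] [Fintype ι']

/-- First derivative of the Bellman function along curves with values `F`, `V` and velocities `D`,
`E`. -/
def bd1 (p e : ℝ) (F D : ι → ℝ) (V E : ι' → ℝ) : ℝ :=
  bellN p e (∑ a, F a ^ 2) (∑ b, V b ^ 2) * (2 * ∑ a, F a * D a) +
    bellW p e (∑ a, F a ^ 2) (∑ b, V b ^ 2) * (2 * ∑ b, V b * E b)

/-- Second derivative of the Bellman function along curves with values `F`, `V`, velocities `D`,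
`E` and accelerations `DD`, `EE`. -/
def bd2 (p e : ℝ) (F D DD : ι → ℝ) (V E EE : ι' → ℝ) : ℝ :=
  bellNN p e (∑ a, F a ^ 2) (∑ b, V b ^ 2) * (2 * ∑ a, F a * D a) ^ 2 +
    2 * bellNW p e (∑ a, F a ^ 2) (∑ b, V b ^ 2) * ((2 * ∑ a, F a * D a) * (2 * ∑ b, V b * E b)) +
    bellWW p e (∑ a, F a ^ 2) (∑ b, V b ^ 2) * (2 * ∑ b, V b * E b) ^ 2 +
    bellN p e (∑ a, F a ^ 2) (∑ b, V b ^ 2) * (2 * ∑ a, (D a * D a + F a * DD a)) +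
    bellW p e (∑ a, F a ^ 2) (∑ b, V b ^ 2) * (2 * ∑ b, (E b * E b + V b * EE b))

variable {p e t : ℝ} {f f' : ι → ℝ → ℝ} {f'' : ι → ℝ} {g g' : ι' → ℝ → ℝ} {g'' : ι' → ℝ}

lemma hasDerivAt_sum_sq (hf : ∀ a, HasDerivAt (f a) (f' a t) t) :
    HasDerivAt (fun t => ∑ a, f a t ^ 2) (2 * ∑ a, f a t * f' a t) t := by
  refine (HasDerivAt.fun_sum fun a _ => (hf a).fun_pow 2).congr_deriv ?_
  rw [Finset.mul_sum]
  exact Finset.sum_congr rfl fun a _ => by push_cast; ring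

lemma hasDerivAt_two_mul_sum (hf : ∀ a, HasDerivAt (f a) (f' a t) t)
    (hf' : ∀ a, HasDerivAt (f' a) (f'' a) t) :
    HasDerivAt (fun t => 2 * ∑ a, f a t * f' a t)
      (2 * ∑ a, (f' a t * f' a t + f a t * f'' a)) t :=
  (HasDerivAt.fun_sum fun a _ => (hf a).fun_mul (hf' a)).const_mul 2

lemma hasDerivAt_bell_comp (hp : 2 ≤ p) (he : 0 < e) (hf : ∀ a, HasDerivAt (f a) (f' a t) t)
    (hg : ∀ b, HasDerivAt (g b) (g' b t) t) :
    HasDerivAt (fun t => bell p e (∑ a, f a t ^ 2) (∑ b, g b t ^ 2))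
      (bd1 p e (fun a => f a t) (fun a => f' a t) (fun b => g b t) (fun b => g' b t)) t :=
  hasDerivAt_bell (n' := fun t => 2 * ∑ a, f a t * f' a t) (w' := fun t => 2 * ∑ b, g b t * g' b t)
    hp he (Finset.sum_nonneg fun _ _ => sq_nonneg _) (Finset.sum_nonneg fun _ _ => sq_nonneg _)
    (hasDerivAt_sum_sq hf) (hasDerivAt_sum_sq hg)

lemma hasDerivAt_bd1 (hp : 2 ≤ p) (he : 0 < e) (hf : ∀ a, HasDerivAt (f a) (f' a t) t)
    (hf' : ∀ a, HasDerivAt (f' a) (f'' a) t) (hg : ∀ b, HasDerivAt (g b) (g' b t) t)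
    (hg' : ∀ b, HasDerivAt (g' b) (g'' b) t) :
    HasDerivAt (fun t => bd1 p e (fun a => f a t) (fun a => f' a t) (fun b => g b t)
      (fun b => g' b t)) (bd2 p e (fun a => f a t) (fun a => f' a t) f'' (fun b => g b t)
      (fun b => g' b t) g'') t :=
  hasDerivAt_bell_deriv (n' := fun t => 2 * ∑ a, f a t * f' a t)
    (w' := fun t => 2 * ∑ b, g b t * g' b t)
    hp he (Finset.sum_nonneg fun _ _ => sq_nonneg _) (Finset.sum_nonneg fun _ _ => sq_nonneg _)
    (hasDerivAt_sum_sq hf) (hasDerivAt_sum_sq hg) (hasDerivAt_two_mul_sum hf hf')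
    (hasDerivAt_two_mul_sum hg hg')

/-- The convexity of the Bellman function along vector-valued curves: Cauchy-Schwarz provides the
hypotheses of `bell_form`, and the accelerations stay as separate terms. -/
lemma bd2_ge (hp : 2 ≤ p) (he : 0 < e) (F D DD : ι → ℝ) (V E EE : ι' → ℝ) :
    bellM p e (∑ a, F a ^ 2) (∑ b, V b ^ 2) ^ bellExp p * (∑ a, D a ^ 2) +
      bellM p e (∑ a, F a ^ 2) (∑ b, V b ^ 2) ^ (-bellExp p) * (∑ b, E b ^ 2) +
      bellN p e (∑ a, F a ^ 2) (∑ b, V b ^ 2) * (2 * ∑ a, F a * DD a) +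
      bellW p e (∑ a, F a ^ 2) (∑ b, V b ^ 2) * (2 * ∑ b, V b * EE b) ≤ bd2 p e F D DD V E EE := by
  have h := bell_form hp he (n := ∑ a, F a ^ 2) (w := ∑ b, V b ^ 2)
    (Finset.sum_nonneg fun a _ => sq_nonneg _) (Finset.sum_nonneg fun a _ => sq_nonneg _)
    (P := ∑ a, D a ^ 2) (R := ∑ b, E b ^ 2) (α := ∑ a, F a * D a) (β := ∑ b, V b * E b)
    (Finset.sum_nonneg fun a _ => sq_nonneg _) (Finset.sum_nonneg fun a _ => sq_nonneg _)
    (Finset.sum_mul_sq_le_sq_mul_sq _ _ _) (Finset.sum_mul_sq_le_sq_mul_sq _ _ _)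
  unfold bd2
  simp only [Finset.sum_add_distrib, ← sq]
  linarith

/-- The derivatives of the Bellman function are bounded on the compact set `[0, K]²`, so `bd1` and
`bd2` are controlled by the derivatives of the squared lengths. -/
lemma exists_bd_bound (hp : 2 ≤ p) (he : 0 < e) (K : ℝ) {B₀ : ℝ} (hB₀ : 0 ≤ B₀) :
    ∃ C : ℝ, 0 ≤ C ∧ ∀ (F D DD : ι → ℝ) (V E EE : ι' → ℝ) (B : ℝ),
      ∑ a, F a ^ 2 ≤ K → ∑ b, V b ^ 2 ≤ K → |∑ a, F a * D a| ≤ B → |∑ b, V b * E b| ≤ B →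
      |bd1 p e F D V E| ≤ C * B ∧
      (B ≤ B₀ → |∑ a, (D a * D a + F a * DD a)| ≤ B → |∑ b, (E b * E b + V b * EE b)| ≤ B →
        |bd2 p e F D DD V E EE| ≤ C * B) := by
  have hc := continuousOn_bell_all (S := Set.Icc 0 K ×ˢ Set.Icc 0 K) hp he
    fun z hz => ⟨hz.1.1, hz.2.1⟩
  obtain ⟨C1, hC1, h1⟩ := exists_bound_of_continuousOn K hc.2.1
  obtain ⟨C2, hC2, h2⟩ := exists_bound_of_continuousOn K hc.2.2.1
  obtain ⟨C3, hC3, h3⟩ := exists_bound_of_continuousOn K hc.2.2.2.1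
  obtain ⟨C4, hC4, h4⟩ := exists_bound_of_continuousOn K hc.2.2.2.2.1
  obtain ⟨C5, hC5, h5⟩ := exists_bound_of_continuousOn K hc.2.2.2.2.2
  refine ⟨(4 * C3 + 8 * C4 + 4 * C5) * B₀ + 2 * C1 + 2 * C2, by positivity,
    fun F D DD V E EE B hF hV hFD hVE => ?_⟩
  have hF0 : 0 ≤ ∑ a, F a ^ 2 := Finset.sum_nonneg fun a _ => sq_nonneg _
  have hV0 : 0 ≤ ∑ b, V b ^ 2 := Finset.sum_nonneg fun a _ => sq_nonneg _
  have hB0 : 0 ≤ B := (abs_nonneg _).trans hFD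
  have a1 := h1 _ _ hF0 hF hV0 hV
  have a2 := h2 _ _ hF0 hF hV0 hV
  have a3 := h3 _ _ hF0 hF hV0 hV
  have a4 := h4 _ _ hF0 hF hV0 hV
  have a5 := h5 _ _ hF0 hF hV0 hV
  have lin : ∀ {x y c : ℝ}, |x| ≤ c → |y| ≤ B → |x * (2 * y)| ≤ 2 * c * B := by
    intro x y c hx hy
    have hc : 0 ≤ c := (abs_nonneg _).trans hx
    rw [abs_mul, abs_mul, abs_two]
    calc |x| * (2 * |y|) ≤ c * (2 * B) := by gcongr
      _ = _ := by ring
  have quad : B ≤ B₀ → ∀ {x y z c : ℝ}, |x| ≤ c → |y| ≤ B → |z| ≤ B →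
      |x * ((2 * y) * (2 * z))| ≤ 4 * c * (B₀ * B) := by
    intro hB x y z c hx hy hz
    have hc : 0 ≤ c := (abs_nonneg _).trans hx
    rw [abs_mul, abs_mul, abs_mul, abs_mul, abs_two]
    calc |x| * ((2 * |y|) * (2 * |z|)) ≤ c * ((2 * B) * (2 * B)) := by gcongr
      _ = 4 * c * (B * B) := by ring
      _ ≤ _ := by gcongr
  refine ⟨?_, fun hB hDD hEE => ?_⟩
  · have := (abs_add_le _ _).trans (add_le_add (lin a1 hFD) (lin a2 hVE))
    refine this.trans ?_
    have : 0 ≤ (4 * C3 + 8 * C4 + 4 * C5) * B₀ * B := by positivity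
    linarith
  · unfold bd2
    have b3 := quad hB a3 hFD hFD
    have b4 := quad hB a4 hFD hVE
    have b5 := quad hB a5 hVE hVE
    have b1 := lin a1 hDD
    have b2 := lin a2 hEE
    rw [sq (2 * ∑ a, F a * D a), sq (2 * ∑ b, V b * E b), mul_assoc 2 (bellNW p e _ _)]
    have b4' : |2 * (bellNW p e (∑ a, F a ^ 2) (∑ b, V b ^ 2) *
        ((2 * ∑ a, F a * D a) * (2 * ∑ b, V b * E b)))| ≤ 8 * C4 * (B₀ * B) := by
      rw [abs_mul, abs_two]; linarith
    have := (abs_add_le _ _).trans (add_le_add ((abs_add_le _ _).trans (add_le_add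
      ((abs_add_le _ _).trans (add_le_add ((abs_add_le _ _).trans (add_le_add b3 b4')) b5)) b1)) b2)
    refine this.trans (le_of_eq ?_)
    ring

end bd

end

section

/-! ### The Bellman function of a pair of solutions -/

variable {d : ℕ} {ι ι' : Type*} [Fintype ι] [Fintype ι']

/-- Bounds for the squared length of a vector of solutions and its derivatives. The factor `x j` in
the bound of the spatial derivative removes the boundary term at `x j = 0`. -/
lemma Sol.exists_sum_bound (u : ι → Sol d) :
    ∃ K : ℝ, 0 ≤ K ∧ ∀ x ∈ orthant d, ∀ t, 0 ≤ t →
      ∑ a, (u a).F x t ^ 2 ≤ K * wt x t ^ 2 ∧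
      |∑ a, (u a).F x t * (u a).T x t| ≤ K * wt x t ^ 2 ∧
      |∑ a, ((u a).T x t * (u a).T x t + (u a).F x t * (u a).TT x t)| ≤ K * wt x t ^ 2 ∧
      ∀ j, |∑ a, (u a).F x t * (u a).D j x t| ≤ K * (x j * wt x t ^ 2) ∧
        |∑ a, (u a).F x t * (u a).D j x t| ≤ K * wt x t ^ 2 ∧
        |∑ a, ((u a).D j x t * (u a).D j x t + (u a).F x t * (u a).DD j x t)| ≤
          K * wt x t ^ 2 := by
  obtain ⟨C, hC, h⟩ := Sol.exists_common_bound u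
  refine ⟨Fintype.card ι * (2 * C ^ 2), by positivity, fun x hx t ht => ?_⟩
  have hw := wt_pos x t
  have hx' := mem_orthant.mp hx
  have sum : ∀ (f : ι → ℝ) (B : ℝ), (∀ a, |f a| ≤ 2 * C ^ 2 * B) →
      |∑ a, f a| ≤ Fintype.card ι * (2 * C ^ 2) * B := by
    intro f B hf
    refine (Finset.abs_sum_le_sum_abs _ _).trans
      ((Finset.sum_le_sum fun a _ => hf a).trans (le_of_eq ?_))
    rw [Finset.sum_const, Finset.card_univ, nsmul_eq_mul]; ring
  have prod : ∀ {y z : ℝ}, |y| ≤ C * wt x t → |z| ≤ C * wt x t →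
      |y * z| ≤ C ^ 2 * wt x t ^ 2 := by
    intro y z hy hz
    rw [abs_mul]
    calc _ ≤ (C * wt x t) * (C * wt x t) := mul_le_mul hy hz (abs_nonneg _) (by positivity)
      _ = _ := by ring
  have hpos : 0 ≤ C ^ 2 * wt x t ^ 2 := by positivity
  refine ⟨?_, ?_, ?_, fun j => ⟨?_, ?_, ?_⟩⟩
  · refine (le_abs_self _).trans (sum _ _ fun a => ?_)
    have := prod (h a x hx t ht).1 (h a x hx t ht).1
    rw [sq]; linarith
  · refine sum _ _ fun a => ?_
    have := prod (h a x hx t ht).1 (h a x hx t ht).2.1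
    linarith
  · refine sum _ _ fun a => (abs_add_le _ _).trans ?_
    have h1 := prod (h a x hx t ht).2.1 (h a x hx t ht).2.1
    have h2 := prod (h a x hx t ht).1 (h a x hx t ht).2.2.1
    linarith
  · refine sum _ _ fun a => ?_
    obtain ⟨h1, h2, h3⟩ := (h a x hx t ht).2.2.2 j
    have hxj := hx' j
    rw [abs_mul]
    calc _ ≤ (C * (x j * wt x t)) * (C * wt x t) := mul_le_mul h1 h2 (abs_nonneg _) (by positivity)
      _ = C ^ 2 * (x j * wt x t ^ 2) := by ring
      _ ≤ 2 * C ^ 2 * (x j * wt x t ^ 2) := by gcongr; nlinarith [sq_nonneg C]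
  · refine sum _ _ fun a => ?_
    have := prod (h a x hx t ht).1 ((h a x hx t ht).2.2.2 j).2.1
    linarith
  · refine sum _ _ fun a => (abs_add_le _ _).trans ?_
    obtain ⟨h1, h2, h3⟩ := (h a x hx t ht).2.2.2 j
    have hxj := hx' j
    have h4 := prod h2 h2
    have h5 : |(u a).F x t * (u a).DD j x t| ≤ C ^ 2 * wt x t ^ 2 := by
      rw [abs_mul]
      calc _ ≤ (C * (x j * wt x t)) * |(u a).DD j x t| := by gcongr
        _ = (C * wt x t) * (x j * |(u a).DD j x t|) := by ring
        _ ≤ (C * wt x t) * (C * wt x t) := by gcongr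
        _ = _ := by ring
    linarith

variable (p e : ℝ) (u : ι → Sol d) (v : ι' → Sol d)

/-- The Bellman function composed with the pair of solutions. -/
def bellB (x : Fin d → ℝ) (t : ℝ) : ℝ :=
  bell p e (∑ a, (u a).F x t ^ 2) (∑ b, (v b).F x t ^ 2)

/-- First spatial derivative of `bellB`. -/
def bellB1 (j : Fin d) (x : Fin d → ℝ) (t : ℝ) : ℝ :=
  bd1 p e (fun a => (u a).F x t) (fun a => (u a).D j x t) (fun b => (v b).F x t)
    (fun b => (v b).D j x t)

/-- Second spatial derivative of `bellB`. -/
def bellB2 (j : Fin d) (x : Fin d → ℝ) (t : ℝ) : ℝ :=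
  bd2 p e (fun a => (u a).F x t) (fun a => (u a).D j x t) (fun a => (u a).DD j x t)
    (fun b => (v b).F x t) (fun b => (v b).D j x t) (fun b => (v b).DD j x t)

/-- First time derivative of `bellB`. -/
def bellT1 (x : Fin d → ℝ) (t : ℝ) : ℝ :=
  bd1 p e (fun a => (u a).F x t) (fun a => (u a).T x t) (fun b => (v b).F x t)
    (fun b => (v b).T x t)

/-- Second time derivative of `bellB`. -/
def bellT2 (x : Fin d → ℝ) (t : ℝ) : ℝ :=
  bd2 p e (fun a => (u a).F x t) (fun a => (u a).T x t) (fun a => (u a).TT x t)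
    (fun b => (v b).F x t) (fun b => (v b).T x t) (fun b => (v b).TT x t)

variable {p e u v}

/-- Gaussian bounds for the derivatives of `bellB`; the factor `x j` makes the boundary term of the
integration in `x j` vanish. -/
lemma exists_bellB_bound (hp : 2 ≤ p) (he : 0 < e) :
    ∃ C : ℝ, 0 ≤ C ∧ ∀ x ∈ orthant d, ∀ t, 0 ≤ t →
      |bellT1 p e u v x t| ≤ C * wt x t ^ 2 ∧ |bellT2 p e u v x t| ≤ C * wt x t ^ 2 ∧
      ∀ j, |bellB1 p e u v j x t| ≤ C * (x j * wt x t ^ 2) ∧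
        |bellB2 p e u v j x t| ≤ C * wt x t ^ 2 := by
  obtain ⟨K1, hK1, h1⟩ := Sol.exists_sum_bound u
  obtain ⟨K2, hK2, h2⟩ := Sol.exists_sum_bound v
  obtain ⟨C, hC, h⟩ := exists_bd_bound (ι := ι) (ι' := ι') hp he (K1 + K2) (B₀ := K1 + K2)
    (by positivity)
  refine ⟨C * (K1 + K2), by positivity, fun x hx t ht => ?_⟩
  have hw := wt_pos x t
  have hw2 : wt x t ^ 2 ≤ 1 := pow_le_one₀ hw.le (wt_le_one x ht)
  have hw20 : 0 < wt x t ^ 2 := by positivity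
  have hx' := mem_orthant.mp hx
  obtain ⟨a1, a2, a3, a4⟩ := h1 x hx t ht
  obtain ⟨b1, b2, b3, b4⟩ := h2 x hx t ht
  have l1 : ∀ {y B : ℝ}, 0 ≤ B → y ≤ K1 * B → y ≤ (K1 + K2) * B := by
    intro y B hB hy; nlinarith [mul_nonneg hK2 hB]
  have l2 : ∀ {y B : ℝ}, 0 ≤ B → y ≤ K2 * B → y ≤ (K1 + K2) * B := by
    intro y B hB hy; nlinarith [mul_nonneg hK1 hB]
  have hle : (K1 + K2) * wt x t ^ 2 ≤ K1 + K2 := mul_le_of_le_one_right (by positivity) hw2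
  have n1 := (l1 hw20.le a1).trans hle
  have n2 := (l2 hw20.le b1).trans hle
  have hT := h (fun a => (u a).F x t) (fun a => (u a).T x t) (fun a => (u a).TT x t)
    (fun b => (v b).F x t) (fun b => (v b).T x t) (fun b => (v b).TT x t) _ n1 n2
    (l1 hw20.le a2) (l2 hw20.le b2)
  refine ⟨?_, ?_, fun j => ⟨?_, ?_⟩⟩
  · rw [mul_assoc]; exact hT.1
  · rw [mul_assoc]; exact hT.2 hle (l1 hw20.le a3) (l2 hw20.le b3)
  · have hxw : 0 ≤ x j * wt x t ^ 2 := mul_nonneg (hx' j).le hw20.le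
    rw [mul_assoc]
    exact (h (fun a => (u a).F x t) (fun a => (u a).D j x t) (fun a => (u a).DD j x t)
      (fun b => (v b).F x t) (fun b => (v b).D j x t) (fun b => (v b).DD j x t) _ n1 n2
      (l1 hxw (a4 j).1) (l2 hxw (b4 j).1)).1
  · rw [mul_assoc]
    exact (h (fun a => (u a).F x t) (fun a => (u a).D j x t) (fun a => (u a).DD j x t)
      (fun b => (v b).F x t) (fun b => (v b).D j x t) (fun b => (v b).DD j x t) _ n1 n2
      (l1 hw20.le (a4 j).2.1) (l2 hw20.le (b4 j).2.1)).2 hle (l1 hw20.le (a4 j).2.2)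
      (l2 hw20.le (b4 j).2.2)

lemma continuousOn_bd2 {Z : Type*} [TopologicalSpace Z] {A : Set Z} (hp : 2 ≤ p) (he : 0 < e)
    {F D DD : ι → Z → ℝ} {V E EE : ι' → Z → ℝ} (hF : ∀ a, ContinuousOn (F a) A)
    (hD : ∀ a, ContinuousOn (D a) A) (hDD : ∀ a, ContinuousOn (DD a) A)
    (hV : ∀ b, ContinuousOn (V b) A) (hE : ∀ b, ContinuousOn (E b) A)
    (hEE : ∀ b, ContinuousOn (EE b) A) :
    ContinuousOn (fun z => bd2 p e (fun a => F a z) (fun a => D a z) (fun a => DD a z)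
      (fun b => V b z) (fun b => E b z) (fun b => EE b z)) A := by
  have hn : ContinuousOn (fun z => ∑ a, F a z ^ 2) A :=
    continuousOn_finsetSum _ fun a _ => (hF a).pow 2
  have hw : ContinuousOn (fun z => ∑ b, V b z ^ 2) A :=
    continuousOn_finsetSum _ fun a _ => (hV a).pow 2
  obtain ⟨-, c1, c2, c3, c4, c5⟩ := continuousOn_bell_all (S := {z : ℝ × ℝ | 0 ≤ z.1 ∧ 0 ≤ z.2})
    hp he fun z hz => hz
  have hm : Set.MapsTo (fun z => (∑ a, F a z ^ 2, ∑ b, V b z ^ 2)) A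
      {z : ℝ × ℝ | 0 ≤ z.1 ∧ 0 ≤ z.2} := fun z _ =>
    ⟨Finset.sum_nonneg fun a _ => sq_nonneg _, Finset.sum_nonneg fun a _ => sq_nonneg _⟩
  have hnw := hn.prodMk hw
  have k1 := c1.comp hnw hm
  have k2 := c2.comp hnw hm
  have k3 := c3.comp hnw hm
  have k4 := c4.comp hnw hm
  have k5 := c5.comp hnw hm
  have s1 : ContinuousOn (fun z => 2 * ∑ a, F a z * D a z) A :=
    continuousOn_const.mul (continuousOn_finsetSum _ fun a _ => (hF a).mul (hD a))
  have s2 : ContinuousOn (fun z => 2 * ∑ b, V b z * E b z) A :=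
    continuousOn_const.mul (continuousOn_finsetSum _ fun a _ => (hV a).mul (hE a))
  have s3 : ContinuousOn (fun z => 2 * ∑ a, (D a z * D a z + F a z * DD a z)) A :=
    continuousOn_const.mul (continuousOn_finsetSum _ fun a _ =>
      ((hD a).mul (hD a)).add ((hF a).mul (hDD a)))
  have s4 : ContinuousOn (fun z => 2 * ∑ b, (E b z * E b z + V b z * EE b z)) A :=
    continuousOn_const.mul (continuousOn_finsetSum _ fun a _ =>
      ((hE a).mul (hE a)).add ((hV a).mul (hEE a)))
  exact ((((k3.mul (s1.pow 2)).add ((continuousOn_const.mul k4).mul (s1.mul s2))).add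
    (k5.mul (s2.pow 2))).add (k1.mul s3)).add (k2.mul s4)

lemma integrable_bellB2 (hp : 2 ≤ p) (he : 0 < e) (j : Fin d) {t : ℝ} (ht : 0 ≤ t) :
    Integrable (fun x => bellB2 p e u v j x t) (mu d) := by
  obtain ⟨C, hC, h⟩ := exists_bellB_bound (u := u) (v := v) hp he
  refine Integrable.mono' (((integrable_gauss (c := 1 / 2) (by norm_num)).const_mul
    (Real.exp (-(2 * t)))).const_mul C) (aestronglyMeasurable_mu ?_) (ae_mu fun x hx => ?_)
  · exact continuousOn_bd2 hp he (fun a => (u a).contF_slice t) (fun a => (u a).contD j t)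
      (fun a => (u a).contDD j t) (fun a => (v a).contF_slice t) (fun a => (v a).contD j t)
      (fun a => (v a).contDD j t)
  · rw [← wt_sq]
    exact ((h x hx t ht).2.2 j).2

/-- The spatial second derivatives of the Bellman function integrate to zero. -/
lemma integral_bellB2 (hp : 2 ≤ p) (he : 0 < e) (j : Fin d) {t : ℝ} (ht : 0 ≤ t) :
    ∫ x, bellB2 p e u v j x t ∂(mu d) = 0 := by
  refine integral_mu_eq_zero j (integrable_bellB2 hp he j ht) fun x hx => ?_
  obtain ⟨C, hC, h⟩ := exists_bellB_bound (u := u) (v := v) hp he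
  set G := Real.exp (-(2 * t)) * gauss (1 / 2) (Function.update x j 0) with hG
  have hG0 : 0 ≤ G := mul_nonneg (Real.exp_pos _).le (gauss_pos _ _).le
  have hw : ∀ s, wt (Function.update x j s) t ^ 2 = G * Real.exp (-(1 / 2) * s ^ 2) := by
    intro s; rw [wt_sq, gauss_update, hG]; ring
  refine integral_Ioi_deriv_eq_zero (f := fun s => bellB1 p e u v j (Function.update x j s) t)
    (B := fun s => C * (s * (G * Real.exp (-(1 / 2) * s ^ 2)))) (fun s hs => ?_) (fun s hs => ?_)
    ?_ ?_ ?_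
  · have hxs := update_mem_orthant hx j hs
    refine hasDerivAt_bd1 (f := fun a s => (u a).F (Function.update x j s) t)
      (f' := fun a s => (u a).D j (Function.update x j s) t)
      (g := fun a s => (v a).F (Function.update x j s) t)
      (g' := fun a s => (v a).D j (Function.update x j s) t) hp he
      (fun a => ?_) (fun a => ?_) (fun a => ?_) (fun a => ?_)
    · simpa using (u a).hasD _ hxs t j
    · simpa using (u a).hasDD _ hxs t j
    · simpa using (v a).hasD _ hxs t j
    · simpa using (v a).hasDD _ hxs t j
  · have := ((h _ (update_mem_orthant hx j hs) t ht).2.2 j).1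
    simpa [hw] using this
  · have hm : ContinuousOn (fun s => bellB2 p e u v j (Function.update x j s) t) (Set.Ioi 0) := by
      have hcont : ContinuousOn (fun x => bellB2 p e u v j x t) (orthant d) :=
        continuousOn_bd2 hp he (fun a => (u a).contF_slice t) (fun a => (u a).contD j t)
        (fun a => (u a).contDD j t) (fun a => (v a).contF_slice t) (fun a => (v a).contD j t)
        (fun a => (v a).contDD j t)
      exact hcont.comp (f := fun s : ℝ => Function.update x j s)
        (Continuous.update (f := fun _ : ℝ => x) continuous_const j continuous_id).continuousOn
        fun s hs => update_mem_orthant hx j hs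
    refine Integrable.mono' (((integrable_exp_neg_mul_sq (b := 1 / 2) (by norm_num)).const_mul
      (C * G)).restrict) (hm.aestronglyMeasurable measurableSet_Ioi) ?_
    refine (ae_restrict_iff' measurableSet_Ioi).mpr (ae_of_all _ fun s hs => ?_)
    have := ((h _ (update_mem_orthant hx j hs) t ht).2.2 j).2
    rw [hw] at this
    rw [mul_assoc]; exact this
  · have : ContinuousAt (fun s : ℝ => C * (s * (G * Real.exp (-(1 / 2) * s ^ 2)))) 0 := by fun_prop
    simpa [ContinuousAt] using this.tendsto.mono_left (nhdsWithin_le_nhds (s := Set.Ioi 0))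
  · have h1 := (tendsto_rpow_mul_exp_atTop (c := 1 / 2) (by norm_num)).const_mul (C * G)
    rw [mul_zero] at h1
    refine squeeze_zero' ?_ ?_ h1
    · filter_upwards [eventually_ge_atTop 0] with s hs
      positivity
    · filter_upwards [eventually_ge_atTop 1] with s hs
      have : s ≤ s ^ 2 := by nlinarith
      calc C * (s * (G * Real.exp (-(1 / 2) * s ^ 2)))
          = C * G * (s * Real.exp (-(1 / 2) * s ^ 2)) := by ring
        _ ≤ C * G * (s ^ 2 * Real.exp (-(1 / 2) * s ^ 2)) := by gcongr

lemma continuousOn_bellT2 (hp : 2 ≤ p) (he : 0 < e) :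
    ContinuousOn (Function.uncurry (bellT2 p e u v)) (orthant d ×ˢ Set.univ) :=
  continuousOn_bd2 (Z := (Fin d → ℝ) × ℝ) (F := fun a => Function.uncurry (u a).F)
    (D := fun a => Function.uncurry (u a).T) (DD := fun a => Function.uncurry (u a).TT)
    (V := fun a => Function.uncurry (v a).F)
    (E := fun a => Function.uncurry (v a).T) (EE := fun a => Function.uncurry (v a).TT)
    hp he (fun a => (u a).contF) (fun a => (u a).contT) (fun a => (u a).contTT)
    (fun a => (v a).contF) (fun a => (v a).contT) (fun a => (v a).contTT)

lemma integrableOn_mul_exp : IntegrableOn (fun t : ℝ => t * Real.exp (-(2 * t))) (Set.Ioi 0) := by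
  have := integrableOn_rpow_mul_exp_neg_mul_rpow (s := 1) (p := 1) (b := 2) (by norm_num) one_pos
    (by norm_num)
  simpa using this

lemma integrable_bellT2_slice (hp : 2 ≤ p) (he : 0 < e) {t : ℝ} (ht : 0 ≤ t) :
    Integrable (fun x => bellT2 p e u v x t) (mu d) := by
  obtain ⟨C, hC, h⟩ := exists_bellB_bound (u := u) (v := v) hp he
  refine Integrable.mono' (((integrable_gauss (c := 1 / 2) (by norm_num)).const_mul
    (Real.exp (-(2 * t)))).const_mul C) (aestronglyMeasurable_mu ?_) (ae_mu fun x hx => ?_)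
  · exact (continuousOn_bellT2 hp he).comp (f := fun x => (x, t)) (by fun_prop)
      fun _ hx => ⟨hx, Set.mem_univ t⟩
  · rw [← wt_sq]
    exact (h x hx t ht).2.1

lemma integrable_mul_bellT2 (hp : 2 ≤ p) (he : 0 < e) :
    Integrable (Function.uncurry fun (t : ℝ) x => t * bellT2 p e u v x t)
      (((volume : Measure ℝ).restrict (Set.Ioi 0)).prod (mu d)) := by
  obtain ⟨C, hC, h⟩ := exists_bellB_bound (u := u) (v := v) hp he
  have hi := (Integrable.mul_prod integrableOn_mul_exp
    (integrable_gauss (d := d) (c := 1 / 2) (by norm_num))).const_mul C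
  have hm : MeasurableSet (Set.Ioi (0 : ℝ) ×ˢ orthant d) :=
    measurableSet_Ioi.prod measurableSet_orthant
  rw [mu_eq_restrict, Measure.prod_restrict]
  rw [mu_eq_restrict, Measure.prod_restrict] at hi
  refine Integrable.mono' hi (ContinuousOn.aestronglyMeasurable ?_ hm) ?_
  · refine ContinuousOn.mul (by fun_prop) ?_
    exact (continuousOn_bellT2 hp he).comp (f := fun z : ℝ × (Fin d → ℝ) => (z.2, z.1))
      (by fun_prop) fun z hz => ⟨hz.2, Set.mem_univ _⟩
  · refine (ae_restrict_iff' hm).mpr (ae_of_all _ fun z hz => ?_)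
    have ht : 0 < z.1 := hz.1
    have := (h z.2 hz.2 z.1 ht.le).2.1
    rw [wt_sq] at this
    simp only [Function.uncurry, Real.norm_eq_abs, abs_mul, abs_of_pos ht]
    calc z.1 * |bellT2 p e u v z.2 z.1|
        ≤ z.1 * (C * (Real.exp (-(2 * z.1)) * gauss (1 / 2) z.2)) := by gcongr
      _ = _ := by ring

lemma Sol.tendsto_sum_sq (u : ι → Sol d) {x : Fin d → ℝ} (hx : x ∈ orthant d) :
    Tendsto (fun t => ∑ a, (u a).F x t ^ 2) atTop (𝓝 0) := by
  obtain ⟨K, hK, hb⟩ := Sol.exists_sum_bound u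
  have hexp0 : Tendsto (fun t : ℝ => Real.exp (-(2 * t))) atTop (𝓝 0) := by
    have := tendsto_rpow_mul_exp_neg_mul_atTop_nhds_zero 0 2 (by norm_num)
    simpa using this
  have := hexp0.const_mul (K * gauss (1 / 2) x)
  rw [mul_zero] at this
  refine squeeze_zero' (Eventually.of_forall fun t => Finset.sum_nonneg fun a _ => sq_nonneg _)
    ?_ this
  filter_upwards [eventually_ge_atTop 0] with t ht
  have := (hb x hx t ht).1
  rw [wt_sq] at this
  linarith

lemma tendsto_bell_zero (hp : 2 ≤ p) (he : 0 < e) :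
    Tendsto (fun z : ℝ × ℝ => bell p e z.1 z.2) (𝓝[{z : ℝ × ℝ | 0 ≤ z.1 ∧ 0 ≤ z.2}] (0, 0))
      (𝓝 (bell p e 0 0)) :=
  (continuousOn_bell_all (S := {z : ℝ × ℝ | 0 ≤ z.1 ∧ 0 ≤ z.2}) hp he
    fun _ hz => hz).1 (0, 0) ⟨le_rfl, le_rfl⟩

/-- Integration by parts in time; the boundary terms at infinity vanish by the exponential decay. -/
lemma integral_mul_bellT2 (hp : 2 ≤ p) (he : 0 < e) {x : Fin d → ℝ} (hx : x ∈ orthant d) :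
    ∫ t in Set.Ioi (0 : ℝ), t * bellT2 p e u v x t = bellB p e u v x 0 - bell p e 0 0 := by
  obtain ⟨C, hC, h⟩ := exists_bellB_bound (u := u) (v := v) hp he
  have hw : ∀ t, wt x t ^ 2 = Real.exp (-(2 * t)) * gauss (1 / 2) x := wt_sq x
  have hexp : Tendsto (fun t : ℝ => t * Real.exp (-(2 * t))) atTop (𝓝 0) := by
    have := tendsto_rpow_mul_exp_neg_mul_atTop_nhds_zero 1 2 (by norm_num)
    simpa using this
  have key := integral_Ioi_of_hasDerivAt_of_tendsto' (a := 0) (m := 0)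
    (f := fun t => t * bellT1 p e u v x t - (bellB p e u v x t - bell p e 0 0))
    (f' := fun t => t * bellT2 p e u v x t) (fun t _ => ?_) ?_ ?_
  · rw [key]; simp
  · have h1 : HasDerivAt (bellT1 p e u v x) (bellT2 p e u v x t) t :=
      hasDerivAt_bd1 (f := fun a s => (u a).F x s) (f' := fun a s => (u a).T x s)
        (g := fun a s => (v a).F x s) (g' := fun a s => (v a).T x s) hp he
        (fun a => (u a).hasT x t) (fun a => (u a).hasTT x t)
        (fun a => (v a).hasT x t) (fun a => (v a).hasTT x t)
    have h2 : HasDerivAt (bellB p e u v x) (bellT1 p e u v x t) t :=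
      hasDerivAt_bell_comp (f := fun a s => (u a).F x s) (f' := fun a s => (u a).T x s)
        (g := fun a s => (v a).F x s) (g' := fun a s => (v a).T x s) hp he
        (fun a => (u a).hasT x t) (fun a => (v a).hasT x t)
    refine (((hasDerivAt_id' t).fun_mul h1).fun_sub (h2.sub_const _)).congr_deriv ?_
    ring
  · have hm : Continuous (bellT2 p e u v x) := by
      rw [← continuousOn_univ]
      exact (continuousOn_bellT2 hp he).comp (f := fun t => (x, t)) (by fun_prop)
        fun t _ => ⟨hx, Set.mem_univ t⟩
    refine Integrable.mono' ((integrableOn_mul_exp.const_mul (C * gauss (1 / 2) x)))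
      (by fun_prop) ?_
    refine (ae_restrict_iff' measurableSet_Ioi).mpr (ae_of_all _ fun t (ht : 0 < t) => ?_)
    have := (h x hx t ht.le).2.1
    rw [hw] at this
    rw [Real.norm_eq_abs, abs_mul, abs_of_pos ht]
    calc t * |bellT2 p e u v x t| ≤ t * (C * (Real.exp (-(2 * t)) * gauss (1 / 2) x)) := by gcongr
      _ = _ := by ring
  · have t1 : Tendsto (fun t => t * bellT1 p e u v x t) atTop (𝓝 0) := by
      have := hexp.const_mul (C * gauss (1 / 2) x)
      rw [mul_zero] at this
      refine squeeze_zero_norm' ?_ this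
      filter_upwards [eventually_gt_atTop 0] with t ht
      have := (h x hx t ht.le).1
      rw [hw] at this
      rw [Real.norm_eq_abs, abs_mul, abs_of_pos ht]
      calc t * |bellT1 p e u v x t| ≤ t * (C * (Real.exp (-(2 * t)) * gauss (1 / 2) x)) := by
            gcongr
        _ = _ := by ring
    have t2 : Tendsto (fun t => bellB p e u v x t) atTop (𝓝 (bell p e 0 0)) := by
      have hz : Tendsto (fun t => (∑ a, (u a).F x t ^ 2, ∑ b, (v b).F x t ^ 2)) atTop
          (𝓝[{z : ℝ × ℝ | 0 ≤ z.1 ∧ 0 ≤ z.2}] (0, 0)) := by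
        refine tendsto_nhdsWithin_iff.mpr
          ⟨(Sol.tendsto_sum_sq u hx).prodMk_nhds (Sol.tendsto_sum_sq v hx),
            Eventually.of_forall fun t => ?_⟩
        exact ⟨Finset.sum_nonneg fun a _ => sq_nonneg _, Finset.sum_nonneg fun a _ => sq_nonneg _⟩
      have h3 := (tendsto_bell_zero hp he).comp hz
      exact h3
    have t3 : Tendsto (fun t => bellB p e u v x t - bell p e 0 0) atTop (𝓝 0) := by
      simpa only [sub_self] using Tendsto.sub t2 (tendsto_const_nhds (x := bell p e 0 0))
    simpa only [sub_zero] using Tendsto.sub t1 t3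

/-- The squared length of the generalized gradient `(∂_t, ∇, √r)` of a vector of solutions. -/
def gradSq (r : (Fin d → ℝ) → ℝ) (u : ι → Sol d) (x : Fin d → ℝ) (t : ℝ) : ℝ :=
  ∑ j, ∑ a, (u a).D j x t ^ 2 + ∑ a, (u a).T x t ^ 2 + r x * ∑ a, (u a).F x t ^ 2

lemma gradSq_nonneg {r : (Fin d → ℝ) → ℝ} (u : ι → Sol d) {x : Fin d → ℝ} (hr : 0 ≤ r x) (t : ℝ) :
    0 ≤ gradSq r u x t := by
  have h1 : 0 ≤ ∑ j, ∑ a, (u a).D j x t ^ 2 :=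
    Finset.sum_nonneg fun j _ => Finset.sum_nonneg fun a _ => sq_nonneg _
  have h2 : 0 ≤ ∑ a, (u a).T x t ^ 2 := Finset.sum_nonneg fun a _ => sq_nonneg _
  have h3 : 0 ≤ ∑ a, (u a).F x t ^ 2 := Finset.sum_nonneg fun a _ => sq_nonneg _
  unfold gradSq
  positivity

/-- The equation of a vector of solutions, paired with the vector itself, when the potentials are at
least `c`. -/
lemma Sol.mul_sum_sq_le (u : ι → Sol d) {c : ℝ} {x : Fin d → ℝ} (hx : x ∈ orthant d)
    (hu : ∀ a, c ≤ (u a).W x) (t : ℝ) :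
    c * ∑ a, (u a).F x t ^ 2 ≤
      ∑ j, ∑ a, (u a).F x t * (u a).DD j x t + ∑ a, (u a).F x t * (u a).TT x t := by
  rw [Finset.sum_comm, ← Finset.sum_add_distrib, Finset.mul_sum]
  refine Finset.sum_le_sum fun a _ => ?_
  rw [← Finset.mul_sum, ← mul_add, (u a).eq x hx t]
  have := mul_le_mul_of_nonneg_right (hu a) (sq_nonneg ((u a).F x t))
  linarith

/-- The lower bound for the space-time Laplacian of the Bellman function. It is at least
`τ |∇U|² + τ⁻¹ |∇V|²` for the generalized gradients, with `τ = M ^ s`; the product of their lengths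
appears by the inequality of the arithmetic and geometric mean. -/
lemma two_mul_le_laplacian (hp : 2 ≤ p) (he : 0 < e) {r : (Fin d → ℝ) → ℝ} {x : Fin d → ℝ}
    (hx : x ∈ orthant d) (hr : 0 ≤ r x) (hu : ∀ a, r x ≤ (u a).W x) (hv : ∀ b, r x ≤ (v b).W x)
    (t : ℝ) {Ψ : ℝ} (hΨ : Ψ ^ 2 ≤ gradSq r u x t * gradSq r v x t) :
    2 * Ψ ≤ ∑ j, bellB2 p e u v j x t + bellT2 p e u v x t := by
  set n := ∑ a, (u a).F x t ^ 2 with hn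
  set w := ∑ b, (v b).F x t ^ 2 with hw
  have hn0 : 0 ≤ n := Finset.sum_nonneg fun a _ => sq_nonneg _
  have hw0 : 0 ≤ w := Finset.sum_nonneg fun a _ => sq_nonneg _
  have hM := bellM_pos (p := p) he hn0 hw0
  set τ := bellM p e n w ^ bellExp p with hτ
  have hτp : 0 < τ := Real.rpow_pos_of_pos hM _
  have hτi : bellM p e n w ^ (-bellExp p) = τ⁻¹ := Real.rpow_neg hM.le _
  have hJ := fun j => bd2_ge hp he (fun a => (u a).F x t) (fun a => (u a).D j x t)
    (fun a => (u a).DD j x t) (fun b => (v b).F x t) (fun b => (v b).D j x t)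
    (fun b => (v b).DD j x t)
  have hT := bd2_ge hp he (fun a => (u a).F x t) (fun a => (u a).T x t)
    (fun a => (u a).TT x t) (fun b => (v b).F x t) (fun b => (v b).T x t)
    (fun b => (v b).TT x t)
  have hS := add_le_add (Finset.sum_le_sum fun j (_ : j ∈ Finset.univ) => hJ j) hT
  simp only [← hn, ← hw, ← hτ, hτi] at hS
  have hN := bellN_ge hp he hn0 hw0
  have hW := bellW_ge hp he hn0 hw0
  rw [hτi] at hW
  have e1 := Sol.mul_sum_sq_le u hx hu t
  have e2 := Sol.mul_sum_sq_le v hx hv t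
  rw [← hn] at e1
  rw [← hw] at e2
  have hτi0 : 0 < τ⁻¹ := inv_pos.mpr hτp
  have f1 : τ * (r x * n) ≤ bellN p e n w * (2 * (∑ j, ∑ a, (u a).F x t * (u a).DD j x t +
      ∑ a, (u a).F x t * (u a).TT x t)) := by
    have h0 : 0 ≤ r x * n := mul_nonneg hr hn0
    exact mul_le_mul hN (by linarith) h0 (hτp.le.trans hN)
  have f2 : τ⁻¹ * (r x * w) ≤ bellW p e n w * (2 * (∑ j, ∑ a, (v a).F x t * (v a).DD j x t +
      ∑ a, (v a).F x t * (v a).TT x t)) := by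
    have h0 : 0 ≤ r x * w := mul_nonneg hr hw0
    exact mul_le_mul hW (by linarith) h0 (hτi0.le.trans hW)
  have hsum : τ * gradSq r u x t + τ⁻¹ * gradSq r v x t ≤
      ∑ j, bellB2 p e u v j x t + bellT2 p e u v x t := by
    refine le_trans ?_ hS
    simp only [Finset.sum_add_distrib, ← Finset.mul_sum]
    unfold gradSq
    rw [← hn, ← hw]
    linarith
  have hgu := gradSq_nonneg u hr t
  have hgv := gradSq_nonneg v hr t
  refine le_trans ?_ hsum
  refine (le_abs_self _).trans (abs_le_of_sq_le_sq ?_ (by positivity))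
  have : (τ * gradSq r u x t + τ⁻¹ * gradSq r v x t) ^ 2 =
      (τ * gradSq r u x t - τ⁻¹ * gradSq r v x t) ^ 2 + 4 * (gradSq r u x t * gradSq r v x t) := by
    field_simp; ring
  rw [this]
  linarith [sq_nonneg (τ * gradSq r u x t - τ⁻¹ * gradSq r v x t)]

end

section

/-! ### The bilinear embedding -/

variable {d : ℕ} {ι ι' : Type*} [Fintype ι] [Fintype ι']

lemma Sol.integrable_rpow (u : ι → Sol d) {s : ℝ} (hs : 0 < s) :
    Integrable (fun x => (∑ a, (u a).F x 0 ^ 2) ^ s) (mu d) := by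
  obtain ⟨K, hK, h⟩ := Sol.exists_sum_bound u
  refine Integrable.mono' ((integrable_gauss (c := 1 / 2 * s) (by positivity)).const_mul (K ^ s))
    (aestronglyMeasurable_mu ?_) (ae_mu fun x hx => ?_)
  · exact (continuousOn_finsetSum _ fun a _ => ((u a).contF_slice 0).pow 2).rpow_const
      fun _ _ => Or.inr hs.le
  · have h1 := (h x hx 0 le_rfl).1
    have h0 : 0 ≤ ∑ a, (u a).F x 0 ^ 2 := Finset.sum_nonneg fun a _ => sq_nonneg _
    rw [wt_sq] at h1
    rw [Real.norm_eq_abs, abs_of_nonneg (Real.rpow_nonneg h0 _), ← gauss_rpow,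
      ← Real.mul_rpow hK (gauss_pos _ _).le]
    refine Real.rpow_le_rpow h0 ?_ hs.le
    simpa using h1

/-- The bilinear embedding, obtained by integrating the lower bound for the Laplacian of the
Bellman function against `t dt dx`. -/
theorem bilinear_embedding {p : ℝ} (hp : 2 ≤ p) (u : ι → Sol d) (v : ι' → Sol d)
    {r : (Fin d → ℝ) → ℝ} (hr : ∀ x ∈ orthant d, 0 ≤ r x)
    (hu : ∀ a, ∀ x ∈ orthant d, r x ≤ (u a).W x) (hv : ∀ b, ∀ x ∈ orthant d, r x ≤ (v b).W x)
    {Ψ : (Fin d → ℝ) → ℝ → ℝ}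
    (hΨ : ∀ x ∈ orthant d, ∀ t, 0 < t → Ψ x t ^ 2 ≤ gradSq r u x t * gradSq r v x t)
    (hi : ∀ t, 0 < t → Integrable (fun x => Ψ x t) (mu d))
    (hI : IntegrableOn (fun t => t * ∫ x, Ψ x t ∂(mu d)) (Set.Ioi 0)) :
    2 * ∫ t in Set.Ioi (0 : ℝ), t * ∫ x, Ψ x t ∂(mu d) ≤
      (6 * (p - 1) + 1) * ∫ x, (∑ b, (v b).F x 0 ^ 2) ^ (1 - bellExp p) ∂(mu d) +
        2 * ∫ x, (∑ a, (u a).F x 0 ^ 2) ^ (p / 2) ∂(mu d) := by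
  have hs : 0 < 1 - bellExp p := by linarith [bellExp_lt hp]
  have i1 := (Sol.integrable_rpow v hs).const_mul (6 * (p - 1) + 1)
  have i2 := (Sol.integrable_rpow u (s := p / 2) (by linarith)).const_mul 2
  have i3 : Integrable (fun x => ∑ a, (u a).F x 0 ^ 2) (mu d) := by
    simpa using Sol.integrable_rpow u one_pos
  -- the estimate for the regularized Bellman function
  have key : ∀ e : ℝ, 0 < e → 2 * ∫ t in Set.Ioi (0 : ℝ), t * ∫ x, Ψ x t ∂(mu d) ≤
      (6 * (p - 1) + 1) * ∫ x, (∑ b, (v b).F x 0 ^ 2) ^ (1 - bellExp p) ∂(mu d) +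
        2 * ∫ x, (∑ a, (u a).F x 0 ^ 2) ^ (p / 2) ∂(mu d) +
        bellErr p e * ∫ x, ∑ a, (u a).F x 0 ^ 2 ∂(mu d) := by
    intro e he
    have hprod := integrable_mul_bellT2 (u := u) (v := v) hp he
    have s1 : 2 * ∫ t in Set.Ioi (0 : ℝ), t * ∫ x, Ψ x t ∂(mu d) ≤
        ∫ t in Set.Ioi (0 : ℝ), ∫ x, t * bellT2 p e u v x t ∂(mu d) := by
      rw [← integral_const_mul]
      refine setIntegral_mono_on (hI.const_mul 2) hprod.integral_prod_left measurableSet_Ioi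
        fun t (ht : 0 < t) => ?_
      rw [integral_const_mul]
      have h1 : ∫ x, 2 * Ψ x t ∂(mu d) ≤
          ∫ x, (∑ j, bellB2 p e u v j x t + bellT2 p e u v x t) ∂(mu d) := by
        refine integral_mono_ae ((hi t ht).const_mul 2)
          ((integrable_finsetSum _ fun j _ => integrable_bellB2 hp he j ht.le).add
            (integrable_bellT2_slice hp he ht.le)) (ae_mu fun x hx => ?_)
        exact two_mul_le_laplacian hp he hx (hr x hx) (fun a => hu a x hx) (fun b => hv b x hx) t
          (hΨ x hx t ht)
      rw [integral_const_mul, integral_add (integrable_finsetSum _ fun j _ =>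
        integrable_bellB2 hp he j ht.le) (integrable_bellT2_slice hp he ht.le),
        integral_finsetSum _ fun j _ => integrable_bellB2 hp he j ht.le,
        Finset.sum_eq_zero fun j _ => integral_bellB2 hp he j ht.le, zero_add] at h1
      calc 2 * (t * ∫ x, Ψ x t ∂(mu d)) = t * (2 * ∫ x, Ψ x t ∂(mu d)) := by ring
        _ ≤ _ := mul_le_mul_of_nonneg_left h1 ht.le
    have s2 : ∫ t in Set.Ioi (0 : ℝ), ∫ x, t * bellT2 p e u v x t ∂(mu d) =
        ∫ x, (bellB p e u v x 0 - bell p e 0 0) ∂(mu d) := by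
      rw [integral_integral_swap hprod]
      exact integral_congr_ae (ae_mu fun x hx => integral_mul_bellT2 hp he hx)
    have s3 : ∫ x, (bellB p e u v x 0 - bell p e 0 0) ∂(mu d) ≤
        ∫ x, ((6 * (p - 1) + 1) * (∑ b, (v b).F x 0 ^ 2) ^ (1 - bellExp p) +
          2 * (∑ a, (u a).F x 0 ^ 2) ^ (p / 2) + bellErr p e * ∑ a, (u a).F x 0 ^ 2) ∂(mu d) := by
      refine integral_mono_of_nonneg (ae_of_all _ fun x => ?_)
        ((i1.add i2).add (i3.const_mul _)) (ae_of_all _ fun x => ?_)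
      · exact bell_sub_nonneg hp he (Finset.sum_nonneg fun a _ => sq_nonneg _)
          (Finset.sum_nonneg fun a _ => sq_nonneg _)
      · exact bell_sub_le hp he (Finset.sum_nonneg fun a _ => sq_nonneg _)
          (Finset.sum_nonneg fun a _ => sq_nonneg _)
    have i12 : Integrable (fun x => (6 * (p - 1) + 1) * (∑ b, (v b).F x 0 ^ 2) ^ (1 - bellExp p) +
        2 * (∑ a, (u a).F x 0 ^ 2) ^ (p / 2)) (mu d) := i1.add i2
    rw [integral_add i12 (i3.const_mul _), integral_add i1 i2, integral_const_mul,
      integral_const_mul, integral_const_mul] at s3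
    linarith
  have hlim : Tendsto (fun e => (6 * (p - 1) + 1) *
      ∫ x, (∑ b, (v b).F x 0 ^ 2) ^ (1 - bellExp p) ∂(mu d) +
        2 * ∫ x, (∑ a, (u a).F x 0 ^ 2) ^ (p / 2) ∂(mu d) +
        bellErr p e * ∫ x, ∑ a, (u a).F x 0 ^ 2 ∂(mu d)) (𝓝[>] 0) (𝓝 ((6 * (p - 1) + 1) *
      ∫ x, (∑ b, (v b).F x 0 ^ 2) ^ (1 - bellExp p) ∂(mu d) +
        2 * ∫ x, (∑ a, (u a).F x 0 ^ 2) ^ (p / 2) ∂(mu d) +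
        0 * ∫ x, ∑ a, (u a).F x 0 ^ 2 ∂(mu d))) :=
    tendsto_const_nhds.add ((tendsto_bellErr hp).mul_const _)
  rw [zero_mul, add_zero] at hlim
  exact ge_of_tendsto hlim (eventually_nhdsWithin_of_forall fun e he => key e he)

/-! ### The Riesz transform of finite combinations -/

lemma memLp_of_gauss_bound {E : Type*} [NormedAddCommGroup E] {f : (Fin d → ℝ) → E}
    (hf : ContinuousOn f (orthant d)) {c C : ℝ} (hc : 0 < c)
    (h : ∀ x ∈ orthant d, ‖f x‖ ≤ C * gauss c x) {p : ℝ≥0∞} (hp : p ≠ 0) (hp' : p ≠ ∞) :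
    MemLp f p (mu d) := by
  have hpr : 0 < p.toReal := ENNReal.toReal_pos hp hp'
  have hg : MemLp (fun x : Fin d → ℝ => C * gauss c x) p (mu d) := by
    refine MemLp.const_mul ?_ C
    rw [← integrable_norm_rpow_iff (continuous_gauss c).aestronglyMeasurable hp hp']
    have : (fun x : Fin d → ℝ => ‖gauss c x‖ ^ p.toReal) = gauss (c * p.toReal) := by
      funext x
      rw [Real.norm_eq_abs, abs_of_pos (gauss_pos _ _), gauss_rpow]
    rw [this]
    exact integrable_gauss (by positivity)
  exact hg.mono' (aestronglyMeasurable_mu hf) (ae_mu h)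

lemma memLp_phi {α : Fin d → ℝ} (hα : ∀ i, 1 / 2 < α i) (k : Fin d → ℕ) {p : ℝ≥0∞}
    (hp : p ≠ 0) (hp' : p ≠ ∞) : MemLp (phi α k) p (mu d) := by
  obtain ⟨C, -, h⟩ := phi_jet_bound hα k
  exact memLp_of_gauss_bound (continuousOn_phi α k) (by norm_num) (fun x hx => (h x hx).1) hp hp'

lemma integrable_phi_mul {α β : Fin d → ℝ} (hα : ∀ i, 1 / 2 < α i) (hβ : ∀ i, 1 / 2 < β i)
    (k m : Fin d → ℕ) : Integrable (fun x => phi α k x * phi β m x) (mu d) :=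
  (memLp_phi hα k two_ne_zero (by simp)).integrable_mul (memLp_phi hβ m two_ne_zero (by simp))

/-- The finite combination `∑ c_k φ_k^α`. -/
def comb (α : Fin d → ℝ) (c : (Fin d → ℕ) →₀ ℝ) (x : Fin d → ℝ) : ℝ :=
  ∑ k ∈ c.support, c k * phi α k x

/-- The `i`-th Riesz transform of `comb α c`. -/
def rieszComb (α : Fin d → ℝ) (c : (Fin d → ℕ) →₀ ℝ) (i : Fin d) (x : Fin d → ℝ) : ℝ :=
  ∑ k ∈ c.support, eigenvalue α k ^ (-(1 / 2) : ℝ) * c k * (-2 * √(k i : ℝ)) *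
    phi (raise α i) (lower k i) x

/-- The pairing of the Riesz transforms of `comb α c` with the functions `comb (raise α i) (g i)`. -/
def rieszForm (α : Fin d → ℝ) (c : (Fin d → ℕ) →₀ ℝ) (g : Fin d → (Fin d → ℕ) →₀ ℝ) : ℝ :=
  ∑ i, ∑ k ∈ c.support, eigenvalue α k ^ (-(1 / 2) : ℝ) * c k * (-2 * √(k i : ℝ)) *
    g i (lower k i)

lemma integral_sum_mul_sum {β : Fin d → ℝ} (hβ : ∀ i, 1 / 2 < β i) {κ : Type*} (S : Finset κ)
    (a : κ → ℝ) (σ : κ → Fin d → ℕ) (g : (Fin d → ℕ) →₀ ℝ) (ρ : (Fin d → ℕ) → ℝ) :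
    Integrable (fun x => (∑ k ∈ S, a k * phi β (σ k) x) *
      ∑ m ∈ g.support, g m * ρ m * phi β m x) (mu d) ∧
    ∫ x, (∑ k ∈ S, a k * phi β (σ k) x) * (∑ m ∈ g.support, g m * ρ m * phi β m x) ∂(mu d) =
      ∑ k ∈ S, a k * (g (σ k) * ρ (σ k)) := by
  have e : (fun x => (∑ k ∈ S, a k * phi β (σ k) x) * (∑ m ∈ g.support, g m * ρ m * phi β m x)) =
      fun x => ∑ k ∈ S, ∑ m ∈ g.support, a k * (g m * ρ m) * (phi β (σ k) x * phi β m x) := by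
    funext x
    rw [Finset.sum_mul_sum]
    exact Finset.sum_congr rfl fun k _ => Finset.sum_congr rfl fun m _ => by ring
  have hi : ∀ k m, Integrable (fun x => a k * (g m * ρ m) * (phi β (σ k) x * phi β m x)) (mu d) :=
    fun k m => (integrable_phi_mul hβ hβ _ _).const_mul _
  rw [e]
  refine ⟨integrable_finsetSum _ fun k _ => integrable_finsetSum _ fun m _ => hi k m, ?_⟩
  rw [integral_finsetSum _ fun k _ => integrable_finsetSum _ fun m _ => hi k m]
  refine Finset.sum_congr rfl fun k _ => ?_
  rw [integral_finsetSum _ fun m _ => hi k m]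
  simp_rw [integral_const_mul, integral_phi_mul hβ, mul_ite, mul_one, mul_zero]
  rw [Finset.sum_ite_eq]
  split_ifs with h
  · rfl
  · rw [Finsupp.notMem_support_iff.mp h]; simp

lemma integral_rieszComb_mul_comb {α : Fin d → ℝ} (hα : ∀ i, 1 / 2 < α i)
    (c : (Fin d → ℕ) →₀ ℝ) (g : (Fin d → ℕ) →₀ ℝ) (i : Fin d) :
    ∫ x, rieszComb α c i x * comb (raise α i) g x ∂(mu d) =
      ∑ k ∈ c.support, eigenvalue α k ^ (-(1 / 2) : ℝ) * c k * (-2 * √(k i : ℝ)) *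
        g (lower k i) := by
  have := (integral_sum_mul_sum (raise_gt hα i) c.support
    (fun k => eigenvalue α k ^ (-(1 / 2) : ℝ) * c k * (-2 * √(k i : ℝ)))
    (fun k => lower k i) g (fun _ => 1)).2
  simpa [rieszComb, comb] using this

lemma integral_mul_exp {b : ℝ} (hb : 0 < b) :
    IntegrableOn (fun t : ℝ => t * Real.exp (-b * t)) (Set.Ioi 0) ∧
    ∫ t in Set.Ioi (0 : ℝ), t * Real.exp (-b * t) = 1 / b ^ 2 := by
  constructor
  · have := integrableOn_rpow_mul_exp_neg_mul_rpow (s := 1) (p := 1) (b := b) (by norm_num) one_pos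
      hb
    simpa using this
  · have := Real.integral_rpow_mul_exp_neg_mul_Ioi (a := 2) two_pos hb
    rw [show (2 : ℝ) - 1 = 1 by norm_num] at this
    simp only [Real.rpow_one, neg_mul] at this ⊢
    rw [this, Real.Gamma_two]
    simp

/-- The eigenvalue of `M_i` at `δ_i φ_k^α` is `λ_k`. -/
lemma eigenvalue_raise {α : Fin d → ℝ} {k : Fin d → ℕ} {i : Fin d} (h : k i ≠ 0) :
    eigenvalue (raise α i) (lower k i) + 2 = eigenvalue α k := by
  obtain ⟨n, hn⟩ := Nat.exists_eq_succ_of_ne_zero h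
  have h1 : ∑ j, (lower k i j : ℝ) = ∑ j, (k j : ℝ) - 1 := by
    rw [Fintype.sum_eq_add_sum_compl i, Fintype.sum_eq_add_sum_compl i (fun j => (k j : ℝ))]
    have : ∑ j ∈ {i}ᶜ, (lower k i j : ℝ) = ∑ j ∈ {i}ᶜ, (k j : ℝ) := by
      refine Finset.sum_congr rfl fun j hj => ?_
      have : j ≠ i := by simpa using hj
      simp [lower, this]
    rw [this, lower, Function.update_self, hn]
    simp
    ring
  have h2 : ∑ j, raise α i j = ∑ j, α j + 1 := by
    rw [Fintype.sum_eq_add_sum_compl i, Fintype.sum_eq_add_sum_compl i α]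
    have : ∑ j ∈ {i}ᶜ, raise α i j = ∑ j ∈ {i}ᶜ, α j := by
      refine Finset.sum_congr rfl fun j hj => ?_
      have : j ≠ i := by simpa using hj
      simp [raise, this]
    rw [this, raise, Function.update_self]
    ring
  rw [eigenvalue, eigenvalue, h1, h2]
  ring

lemma pot_nonneg {α : Fin d → ℝ} (hα : ∀ i, 1 / 2 < α i) (x : Fin d → ℝ) : 0 ≤ pot α x := by
  refine Finset.sum_nonneg fun i _ => add_nonneg (sq_nonneg _) (div_nonneg ?_ (sq_nonneg _))
  nlinarith [hα i]

lemma pot_le_pot_raise {α : Fin d → ℝ} (hα : ∀ i, 1 / 2 < α i) (i : Fin d) (x : Fin d → ℝ) :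
    pot α x ≤ pot (raise α i) x := by
  refine Finset.sum_le_sum fun j _ => ?_
  have : α j ^ 2 ≤ raise α i j ^ 2 := by
    rcases eq_or_ne j i with rfl | h
    · simp only [raise, Function.update_self]; nlinarith [hα j]
    · simp [raise, h]
  gcongr

variable [NeZero d]

lemma le_constC (α : Fin d → ℝ) (i : Fin d) : (α i + 1 / 2) / (α i - 1 / 2) ≤ constC α :=
  Finset.le_sup' (fun i => (α i + 1 / 2) / (α i - 1 / 2)) (Finset.mem_univ i)

lemma one_le_constC {α : Fin d → ℝ} (hα : ∀ i, 1 / 2 < α i) : 1 ≤ constC α := by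
  refine le_trans ?_ (le_constC α 0)
  rw [le_div_iff₀ (by linarith [hα 0])]
  linarith

/-- The zero-order part of `δ` is controlled by the potential. -/
lemma sum_sq_le_constC_mul_pot {α : Fin d → ℝ} (hα : ∀ i, 1 / 2 < α i) {x : Fin d → ℝ}
    (hx : x ∈ orthant d) :
    ∑ i, (x i - (α i + 1 / 2) / x i) ^ 2 ≤ constC α * pot α x := by
  rw [pot, Finset.mul_sum]
  refine Finset.sum_le_sum fun i _ => ?_
  have hxi := mem_orthant.mp hx i
  have h1 := one_le_constC hα
  have h2 := le_constC α i
  have h3 : 0 < α i - 1 / 2 := by linarith [hα i]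
  rw [div_le_iff₀ h3] at h2
  have e1 : (x i - (α i + 1 / 2) / x i) ^ 2 =
      x i ^ 2 - 2 * (α i + 1 / 2) + (α i + 1 / 2) * (α i + 1 / 2) / x i ^ 2 := by
    field_simp; ring
  have e2 : (α i + 1 / 2) * (α i + 1 / 2) / x i ^ 2 ≤
      constC α * (α i - 1 / 2) * (α i + 1 / 2) / x i ^ 2 := by
    have : 0 ≤ α i + 1 / 2 := by linarith
    gcongr
  have e3 : constC α * (x i ^ 2 + (α i ^ 2 - 1 / 4) / x i ^ 2) =
      constC α * x i ^ 2 + constC α * (α i - 1 / 2) * (α i + 1 / 2) / x i ^ 2 := by ring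
  rw [e1, e3]
  have : 1 * x i ^ 2 ≤ constC α * x i ^ 2 := by gcongr
  linarith

/-- The scalar Poisson extension, as a family with one member. -/
def extU (α : Fin d → ℝ) (hα : ∀ i, 1 / 2 < α i) (c : (Fin d → ℕ) →₀ ℝ) : Unit → Sol d :=
  fun _ => poisson α hα 0 le_rfl c

/-- The Poisson extensions associated with `M_i = L + [δ_i, δ_i^*]`, whose eigenvalue at `φ_m^{α+e_i}`
is `λ_m^{α+e_i} + 2`. -/
def extV (α : Fin d → ℝ) (hα : ∀ i, 1 / 2 < α i) (g : Fin d → (Fin d → ℕ) →₀ ℝ) : Fin d → Sol d :=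
  fun i => poisson (raise α i) (raise_gt hα i) 2 zero_le_two (g i)

/-- `δ_i U` for the scalar Poisson extension `U`. -/
def deltaU (α : Fin d → ℝ) (hα : ∀ i, 1 / 2 < α i) (c : (Fin d → ℕ) →₀ ℝ) (i : Fin d)
    (x : Fin d → ℝ) (t : ℝ) : ℝ :=
  (extU α hα c ()).D i x t + (x i - (α i + 1 / 2) / x i) * (extU α hα c ()).F x t

lemma deltaU_eq {α : Fin d → ℝ} (hα : ∀ i, 1 / 2 < α i) (c : (Fin d → ℕ) →₀ ℝ) (i : Fin d)
    {x : Fin d → ℝ} (hx : x ∈ orthant d) (t : ℝ) :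
    deltaU α hα c i x t = ∑ k ∈ c.support, (c k * Real.exp (-√(eigenvalue α k) * t) *
      (-2 * √(k i : ℝ))) * phi (raise α i) (lower k i) x := by
  simp only [deltaU, extU, poisson, add_zero]
  rw [Finset.mul_sum, ← Finset.sum_add_distrib]
  refine Finset.sum_congr rfl fun k _ => ?_
  rw [mul_assoc (c k * Real.exp _), ← delta_phi_eq α k i hx, delta_phi α k i hx]
  ring

/-- The integrand `-∑ δ_i U ∂_t V_i` of the bilinear form, normalized by `1 + √C(α)` as the bilinear
embedding requires. -/
def rieszPsi (α : Fin d → ℝ) (hα : ∀ i, 1 / 2 < α i) (c : (Fin d → ℕ) →₀ ℝ)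
    (g : Fin d → (Fin d → ℕ) →₀ ℝ) (x : Fin d → ℝ) (t : ℝ) : ℝ :=
  -(∑ i, deltaU α hα c i x t * (extV α hα g i).T x t) / (1 + √(constC α))

/-- The integrand is at most the product of the lengths of the generalized gradients. In
`(∂_i U + h_i U)² ≤ (1 + s) (∂_i U)² + (1 + s⁻¹) h_i² U²` the choice `s = √C(α)` balances the
first-order term against the zero-order term, as `∑ h_i² ≤ s² r`. -/
lemma rieszPsi_sq_le {α : Fin d → ℝ} (hα : ∀ i, 1 / 2 < α i) (c : (Fin d → ℕ) →₀ ℝ)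
    (g : Fin d → (Fin d → ℕ) →₀ ℝ) {x : Fin d → ℝ} (hx : x ∈ orthant d) (t : ℝ) :
    rieszPsi α hα c g x t ^ 2 ≤
      gradSq (pot α) (extU α hα c) x t * gradSq (pot α) (extV α hα g) x t := by
  set s := √(constC α) with hs
  have hC := one_le_constC hα
  have hs0 : 0 < s := Real.sqrt_pos.mpr (by linarith)
  have hss : s * s = constC α := Real.mul_self_sqrt (by linarith)
  have hr := pot_nonneg hα x
  set U := (extU α hα c ()).F x t with hU
  have h1 : (∑ i, deltaU α hα c i x t * (extV α hα g i).T x t) ^ 2 ≤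
      (∑ i, deltaU α hα c i x t ^ 2) * ∑ i, (extV α hα g i).T x t ^ 2 :=
    Finset.sum_mul_sq_le_sq_mul_sq _ _ _
  have h2 : ∑ i, (extV α hα g i).T x t ^ 2 ≤ gradSq (pot α) (extV α hα g) x t := by
    unfold gradSq
    have h1 : 0 ≤ ∑ j, ∑ a, (extV α hα g a).D j x t ^ 2 :=
      Finset.sum_nonneg fun j _ => Finset.sum_nonneg fun a _ => sq_nonneg _
    have h3 : 0 ≤ pot α x * ∑ a, (extV α hα g a).F x t ^ 2 :=
      mul_nonneg hr (Finset.sum_nonneg fun a _ => sq_nonneg _)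
    linarith
  have h3 : ∑ i, deltaU α hα c i x t ^ 2 ≤ (1 + s) ^ 2 * gradSq (pot α) (extU α hα c) x t := by
    have hq := sum_sq_le_constC_mul_pot hα hx
    set D := fun i => (extU α hα c ()).D i x t with hD
    have hterm : ∀ i, deltaU α hα c i x t ^ 2 ≤ (1 + s) * D i ^ 2 +
        (1 + s⁻¹) * U ^ 2 * (x i - (α i + 1 / 2) / x i) ^ 2 := by
      intro i
      have e : deltaU α hα c i x t = D i + (x i - (α i + 1 / 2) / x i) * U := rfl
      rw [e]
      have h0 : 0 ≤ s⁻¹ * (s * D i - (x i - (α i + 1 / 2) / x i) * U) ^ 2 := by positivity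
      have e2 : s⁻¹ * (s * D i - (x i - (α i + 1 / 2) / x i) * U) ^ 2 =
          s * D i ^ 2 - 2 * D i * ((x i - (α i + 1 / 2) / x i) * U)
          + s⁻¹ * ((x i - (α i + 1 / 2) / x i) * U) ^ 2 := by
        field_simp; ring
      rw [e2] at h0
      linarith
    have hsum := Finset.sum_le_sum fun i (_ : i ∈ Finset.univ) => hterm i
    rw [Finset.sum_add_distrib, ← Finset.mul_sum, ← Finset.mul_sum] at hsum
    have e4 : gradSq (pot α) (extU α hα c) x t = ∑ i, D i ^ 2 +
        (extU α hα c ()).T x t ^ 2 + pot α x * U ^ 2 := by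
      simp [gradSq, hD, hU]
    rw [e4]
    have hDD : 0 ≤ ∑ i, D i ^ 2 := Finset.sum_nonneg fun i _ => sq_nonneg _
    have hq2 : (1 + s⁻¹) * U ^ 2 * ∑ i, (x i - (α i + 1 / 2) / x i) ^ 2 ≤
        (1 + s⁻¹) * U ^ 2 * (s * s * pot α x) := by
      rw [hss]; gcongr
    have e5 : (1 + s⁻¹) * U ^ 2 * (s * s * pot α x) = (s + s ^ 2) * (pot α x * U ^ 2) := by
      field_simp; ring
    have hrU : 0 ≤ pot α x * U ^ 2 := mul_nonneg hr (sq_nonneg _)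
    have b1 : 0 ≤ (1 + s) ^ 2 * (extU α hα c ()).T x t ^ 2 := by positivity
    have b2 : 0 ≤ (s + s ^ 2) * ∑ i, D i ^ 2 := by positivity
    have b3 : 0 ≤ (1 + s) * (pot α x * U ^ 2) := by positivity
    linarith
  have hgv := gradSq_nonneg (r := pot α) (x := x) (extV α hα g) hr t
  rw [rieszPsi, div_pow, neg_sq, div_le_iff₀ (by positivity)]
  calc _ ≤ _ := h1
    _ ≤ ((1 + s) ^ 2 * gradSq (pot α) (extU α hα c) x t) * gradSq (pot α) (extV α hα g) x t :=
        mul_le_mul h3 h2 (Finset.sum_nonneg fun a _ => sq_nonneg _)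
          (mul_nonneg (sq_nonneg _) (gradSq_nonneg _ hr t))
    _ = _ := by ring

lemma integral_rieszPsi {α : Fin d → ℝ} (hα : ∀ i, 1 / 2 < α i) (c : (Fin d → ℕ) →₀ ℝ)
    (g : Fin d → (Fin d → ℕ) →₀ ℝ) (t : ℝ) :
    Integrable (fun x => rieszPsi α hα c g x t) (mu d) ∧
    ∫ x, rieszPsi α hα c g x t ∂(mu d) = (1 + √(constC α))⁻¹ *
      ∑ i, ∑ k ∈ c.support, (c k * (-2 * √(k i : ℝ)) * g i (lower k i) * √(eigenvalue α k)) *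
        Real.exp (-(2 * √(eigenvalue α k)) * t) := by
  have h := fun i => integral_sum_mul_sum (raise_gt hα i) c.support
    (fun k => c k * Real.exp (-√(eigenvalue α k) * t) * (-2 * √(k i : ℝ))) (fun k => lower k i)
    (g i) (fun m => Real.exp (-√(eigenvalue (raise α i) m + 2) * t) *
      (-√(eigenvalue (raise α i) m + 2)))
  have e : ∀ x ∈ orthant d, rieszPsi α hα c g x t = (-(1 + √(constC α))⁻¹) * ∑ i,
      (∑ k ∈ c.support, c k * Real.exp (-√(eigenvalue α k) * t) * (-2 * √(k i : ℝ)) *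
        phi (raise α i) (lower k i) x) * ∑ m ∈ (g i).support, g i m *
        (Real.exp (-√(eigenvalue (raise α i) m + 2) * t) * (-√(eigenvalue (raise α i) m + 2))) *
        phi (raise α i) m x := by
    intro x hx
    rw [rieszPsi, neg_div, div_eq_inv_mul, neg_mul]
    simp only [deltaU_eq hα c _ hx t]
    rfl
  have hae : (fun x => rieszPsi α hα c g x t) =ᵐ[mu d] _ := ae_mu e
  refine ⟨((integrable_finsetSum _ fun i _ => (h i).1).const_mul _).congr hae.symm, ?_⟩
  rw [integral_congr_ae hae, integral_const_mul, integral_finsetSum _ fun i _ => (h i).1, neg_mul,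
    ← mul_neg, ← Finset.sum_neg_distrib]
  congr 1
  refine Finset.sum_congr rfl fun i _ => ?_
  rw [(h i).2, ← Finset.sum_neg_distrib]
  refine Finset.sum_congr rfl fun k _ => ?_
  rcases eq_or_ne (k i) 0 with h0 | h0
  · simp [h0]
  · rw [eigenvalue_raise h0, show -(2 * √(eigenvalue α k)) * t =
      -√(eigenvalue α k) * t + -√(eigenvalue α k) * t by ring, Real.exp_add]
    ring

/-- The bilinear form of the Riesz transforms as an integral over Poisson extensions: by
orthogonality each term contributes `∫ t e^{-2 t √λ} dt = 1 / (4 λ)`. -/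
lemma integral_mul_integral_rieszPsi {α : Fin d → ℝ} (hα : ∀ i, 1 / 2 < α i)
    (c : (Fin d → ℕ) →₀ ℝ) (g : Fin d → (Fin d → ℕ) →₀ ℝ) :
    IntegrableOn (fun t => t * ∫ x, rieszPsi α hα c g x t ∂(mu d)) (Set.Ioi 0) ∧
    4 * (1 + √(constC α)) * ∫ t in Set.Ioi (0 : ℝ), t * ∫ x, rieszPsi α hα c g x t ∂(mu d) =
      rieszForm α c g := by
  have hl : ∀ k, 0 < √(eigenvalue α k) := fun k =>
    Real.sqrt_pos.mpr (by linarith [one_le_eigenvalue hα k])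
  have e : (fun t => t * ∫ x, rieszPsi α hα c g x t ∂(mu d)) = fun t => (1 + √(constC α))⁻¹ *
      ∑ i, ∑ k ∈ c.support, (c k * (-2 * √(k i : ℝ)) * g i (lower k i) * √(eigenvalue α k)) *
        (t * Real.exp (-(2 * √(eigenvalue α k)) * t)) := by
    funext t
    rw [(integral_rieszPsi hα c g t).2, mul_left_comm, Finset.mul_sum]
    congr 1
    refine Finset.sum_congr rfl fun i _ => ?_
    rw [Finset.mul_sum]
    exact Finset.sum_congr rfl fun k _ => by ring
  have hi : ∀ (i : Fin d) k, IntegrableOn (fun t =>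
      (c k * (-2 * √(k i : ℝ)) * g i (lower k i) * √(eigenvalue α k)) *
        (t * Real.exp (-(2 * √(eigenvalue α k)) * t))) (Set.Ioi 0) := fun i k =>
    (integral_mul_exp (by linarith [hl k])).1.const_mul _
  rw [e]
  refine ⟨(integrable_finsetSum _ fun i _ => integrable_finsetSum _ fun k _ => hi i k).const_mul _,
    ?_⟩
  have hs : 0 < 1 + √(constC α) := by positivity
  rw [integral_const_mul, ← mul_assoc, mul_assoc 4, mul_inv_cancel₀ hs.ne', mul_one,
    integral_finsetSum _ fun i _ => integrable_finsetSum _ fun k _ => hi i k, Finset.mul_sum]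
  refine Finset.sum_congr rfl fun i _ => ?_
  rw [integral_finsetSum _ fun k _ => hi i k, Finset.mul_sum]
  refine Finset.sum_congr rfl fun k _ => ?_
  have h1 := hl k
  have h2 : √(eigenvalue α k) * √(eigenvalue α k) = eigenvalue α k :=
    Real.mul_self_sqrt (by linarith [one_le_eigenvalue hα k])
  have h3 : eigenvalue α k ^ (-(1 / 2) : ℝ) = (√(eigenvalue α k))⁻¹ := by
    rw [Real.rpow_neg (by linarith [one_le_eigenvalue hα k]), ← Real.sqrt_eq_rpow]
  rw [integral_const_mul, (integral_mul_exp (by linarith)).2, h3]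
  field_simp
  ring

/-- The dimension-free bilinear estimate, when the exponent of the scalar function is at least 2. -/
lemma rieszForm_le_of_two_le {α : Fin d → ℝ} (hα : ∀ i, 1 / 2 < α i) {p : ℝ} (hp : 2 ≤ p)
    (c : (Fin d → ℕ) →₀ ℝ) (g : Fin d → (Fin d → ℕ) →₀ ℝ) :
    rieszForm α c g ≤ 2 * (1 + √(constC α)) * ((6 * (p - 1) + 1) *
      ∫ x, (∑ i, comb (raise α i) (g i) x ^ 2) ^ (1 - bellExp p) ∂(mu d) +
        2 * ∫ x, (comb α c x ^ 2) ^ (p / 2) ∂(mu d)) := by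
  obtain ⟨h1, h2⟩ := integral_mul_integral_rieszPsi hα c g
  have h := bilinear_embedding hp (extU α hα c) (extV α hα g) (r := pot α)
    (fun x _ => pot_nonneg hα x) (fun a x _ => by simp [extU, poisson])
    (fun b x _ => by
      have := pot_le_pot_raise hα b x
      simp only [extV, poisson]; linarith)
    (fun x hx t _ => rieszPsi_sq_le hα c g hx t) (fun t _ => (integral_rieszPsi hα c g t).1) h1
  simp only [extU, extV, poisson, Finset.univ_unique, Finset.sum_singleton, mul_zero, Real.exp_zero,
    mul_one] at h
  rw [← h2, show 4 * (1 + √(constC α)) * ∫ t in Set.Ioi (0 : ℝ), t *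
    ∫ x, rieszPsi α hα c g x t ∂(mu d) = 2 * (1 + √(constC α)) * (2 *
    ∫ t in Set.Ioi (0 : ℝ), t * ∫ x, rieszPsi α hα c g x t ∂(mu d)) by ring]
  gcongr
  exact h

/-- The dimension-free bilinear estimate, when the exponent of the vector-valued function is at
least 2. -/
lemma rieszForm_le_of_two_le' {α : Fin d → ℝ} (hα : ∀ i, 1 / 2 < α i) {p : ℝ} (hp : 2 ≤ p)
    (c : (Fin d → ℕ) →₀ ℝ) (g : Fin d → (Fin d → ℕ) →₀ ℝ) :
    rieszForm α c g ≤ 2 * (1 + √(constC α)) * ((6 * (p - 1) + 1) *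
      ∫ x, (comb α c x ^ 2) ^ (1 - bellExp p) ∂(mu d) +
        2 * ∫ x, (∑ i, comb (raise α i) (g i) x ^ 2) ^ (p / 2) ∂(mu d)) := by
  obtain ⟨h1, h2⟩ := integral_mul_integral_rieszPsi hα c g
  have h := bilinear_embedding hp (extV α hα g) (extU α hα c) (r := pot α)
    (fun x _ => pot_nonneg hα x) (fun b x _ => by
      have := pot_le_pot_raise hα b x
      simp only [extV, poisson]; linarith) (fun a x _ => by simp [extU, poisson])
    (fun x hx t _ => by rw [mul_comm]; exact rieszPsi_sq_le hα c g hx t)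
    (fun t _ => (integral_rieszPsi hα c g t).1) h1
  simp only [extU, extV, poisson, Finset.univ_unique, Finset.sum_singleton, mul_zero, Real.exp_zero,
    mul_one] at h
  rw [← h2, show 4 * (1 + √(constC α)) * ∫ t in Set.Ioi (0 : ℝ), t *
    ∫ x, rieszPsi α hα c g x t ∂(mu d) = 2 * (1 + √(constC α)) * (2 *
    ∫ t in Set.Ioi (0 : ℝ), t * ∫ x, rieszPsi α hα c g x t ∂(mu d)) by ring]
  gcongr
  exact h

end

section

/-! ### Approximation in a Gaussian-weighted norm -/

variable {d : ℕ}

lemma comb_eq_linearCombination (β : Fin d → ℝ) (c : (Fin d → ℕ) →₀ ℝ) (x : Fin d → ℝ) :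
    comb β c x = Finsupp.linearCombination ℝ (fun k => phi β k x) c := by
  rw [Finsupp.linearCombination_apply]; rfl

lemma comb_add (β : Fin d → ℝ) (c c' : (Fin d → ℕ) →₀ ℝ) (x : Fin d → ℝ) :
    comb β (c + c') x = comb β c x + comb β c' x := by
  simp only [comb_eq_linearCombination, map_add]

lemma comb_smul (β : Fin d → ℝ) (r : ℝ) (c : (Fin d → ℕ) →₀ ℝ) (x : Fin d → ℝ) :
    comb β (r • c) x = r * comb β c x := by
  simp only [comb_eq_linearCombination, map_smul, smul_eq_mul]

lemma comb_single (β : Fin d → ℝ) (k : Fin d → ℕ) (x : Fin d → ℝ) :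
    comb β (Finsupp.single k 1) x = phi β k x := by
  simp [comb_eq_linearCombination]

/-- Functions on the orthant that are limits of finite combinations of the `φ_k^β`, uniformly with
respect to a Gaussian weight. -/
def Approx (β : Fin d → ℝ) (h : (Fin d → ℝ) → ℝ) : Prop :=
  ∀ ε > 0, ∃ c, ∀ x ∈ orthant d, |h x - comb β c x| ≤ ε * gauss (1 / 8) x

namespace Approx

variable {β : Fin d → ℝ} {h h' : (Fin d → ℝ) → ℝ}

lemma congr (hh : Approx β h) (e : ∀ x ∈ orthant d, h' x = h x) : Approx β h' := by
  intro ε hε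
  obtain ⟨c, hc⟩ := hh ε hε
  exact ⟨c, fun x hx => by rw [e x hx]; exact hc x hx⟩

lemma phi (β : Fin d → ℝ) (k : Fin d → ℕ) : Approx β (phi β k) := fun ε hε =>
  ⟨Finsupp.single k 1, fun x _ => by
    rw [comb_single, sub_self, abs_zero]; exact mul_nonneg hε.le (gauss_pos _ _).le⟩

lemma zero (β : Fin d → ℝ) : Approx β (fun _ => 0) := fun ε hε =>
  ⟨0, fun x _ => by
    rw [comb_eq_linearCombination, map_zero, sub_self, abs_zero]
    exact mul_nonneg hε.le (gauss_pos _ _).le⟩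

lemma add (hh : Approx β h) (hh' : Approx β h') : Approx β (fun x => h x + h' x) := by
  intro ε hε
  obtain ⟨c, hc⟩ := hh (ε / 2) (half_pos hε)
  obtain ⟨c', hc'⟩ := hh' (ε / 2) (half_pos hε)
  refine ⟨c + c', fun x hx => ?_⟩
  rw [comb_add, show h x + h' x - (comb β c x + comb β c' x) =
    (h x - comb β c x) + (h' x - comb β c' x) by ring]
  refine (abs_add_le _ _).trans ?_
  have := hc x hx
  have := hc' x hx
  linarith

lemma const_mul (hh : Approx β h) (r : ℝ) : Approx β (fun x => r * h x) := by
  intro ε hε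
  obtain ⟨c, hc⟩ := hh (ε / (|r| + 1)) (by positivity)
  refine ⟨r • c, fun x hx => ?_⟩
  rw [comb_smul, ← mul_sub, abs_mul]
  have h1 := hc x hx
  have h2 : |r| * (ε / (|r| + 1)) ≤ ε := by
    rw [mul_div_assoc', div_le_iff₀ (by positivity)]
    nlinarith [abs_nonneg r]
  calc |r| * |h x - comb β c x| ≤ |r| * (ε / (|r| + 1) * gauss (1 / 8) x) := by gcongr
    _ = |r| * (ε / (|r| + 1)) * gauss (1 / 8) x := by ring
    _ ≤ _ := mul_le_mul_of_nonneg_right h2 (gauss_pos _ _).le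

lemma sum {κ : Type*} (S : Finset κ) {H : κ → (Fin d → ℝ) → ℝ} (hH : ∀ k, Approx β (H k)) :
    Approx β (fun x => ∑ k ∈ S, H k x) := by
  classical
  induction S using Finset.induction_on with
  | empty => simpa using zero β
  | insert k S hk ih =>
    simp only [Finset.sum_insert hk]
    exact (hH k).add ih

lemma of_close (H : ∀ ε > 0, ∃ h', Approx β h' ∧
    ∀ x ∈ orthant d, |h x - h' x| ≤ ε * gauss (1 / 8) x) : Approx β h := by
  intro ε hε
  obtain ⟨h', hh', h1⟩ := H (ε / 2) (half_pos hε)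
  obtain ⟨c, hc⟩ := hh' (ε / 2) (half_pos hε)
  refine ⟨c, fun x hx => ?_⟩
  have := abs_sub_le (h x) (h' x) (comb β c x)
  have := h1 x hx
  have := hc x hx
  linarith

end Approx

/-- The function `x^(2m) · x^(b+1/2) e^(-x²/2)` of one variable. -/
def mono1 (b : ℝ) (m : ℕ) (x : ℝ) : ℝ :=
  (x ^ 2) ^ m * (x ^ (b + 1 / 2) * Real.exp (-x ^ 2 / 2))

/-- Laguerre polynomials have full degree, so they span all polynomials. -/
lemma mono1_mem_span {b : ℝ} (hb : -1 < b) (m : ℕ) :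
    mono1 b m ∈ Submodule.span ℝ (Set.range (phi1 b)) := by
  induction m using Nat.strong_induction_on with
  | _ m ih =>
    have e : phi1 b m = ∑ j ∈ Finset.range (m + 1), (phiConst b m * laguerreCoeff b m j) •
        mono1 b j := by
      funext x
      rw [phi1_eq, laguerre_eq, Finset.sum_apply, Finset.mul_sum, Finset.sum_mul, Finset.sum_mul]
      refine Finset.sum_congr rfl fun j _ => ?_
      simp only [Pi.smul_apply, smul_eq_mul, mono1]
      ring
    have hg : ∀ n : ℕ, 0 < Real.Gamma (n + b + 1) := fun n =>
      Real.Gamma_pos_of_pos (by have : (0 : ℝ) ≤ n := n.cast_nonneg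
                                linarith)
    have hne : phiConst b m * laguerreCoeff b m m ≠ 0 := by
      have := hg m
      refine mul_ne_zero (Real.sqrt_pos.mpr (by positivity)).ne' ?_
      exact div_ne_zero (mul_ne_zero (pow_ne_zero _ (by norm_num)) this.ne') (by positivity)
    rw [Finset.sum_range_succ] at e
    have e2 : mono1 b m = (phiConst b m * laguerreCoeff b m m)⁻¹ • (phi1 b m -
        ∑ j ∈ Finset.range m, (phiConst b m * laguerreCoeff b m j) • mono1 b j) := by
      rw [e, add_sub_cancel_left, smul_smul, inv_mul_cancel₀ hne, one_smul]
    rw [e2]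
    refine Submodule.smul_mem _ _ (Submodule.sub_mem _ (Submodule.subset_span ⟨m, rfl⟩)
      (Submodule.sum_mem _ fun j hj => Submodule.smul_mem _ _ (ih j (Finset.mem_range.mp hj))))

/-- The function `∏ x_i^(2m_i) · x_i^(β_i+1/2) e^(-x_i²/2)`. -/
def mono (β : Fin d → ℝ) (m : Fin d → ℕ) (x : Fin d → ℝ) : ℝ := ∏ i, mono1 (β i) (m i) (x i)

lemma approx_mono {β : Fin d → ℝ} (hβ : ∀ i, 1 / 2 < β i) (m : Fin d → ℕ) :
    Approx β (mono β m) := by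
  choose a ha using fun i => Finsupp.mem_span_range_iff_exists_finsupp.mp
    (mono1_mem_span (b := β i) (by linarith [hβ i]) (m i))
  have e : ∀ x, mono β m x = ∑ k ∈ Fintype.piFinset fun i => (a i).support,
      (∏ i, a i (k i)) * phi β k x := by
    intro x
    have h1 : ∀ i, mono1 (β i) (m i) (x i) =
        ∑ k ∈ (a i).support, a i k * phi1 (β i) k (x i) := by
      intro i
      rw [← ha i, Finsupp.sum, Finset.sum_apply]
      rfl
    rw [mono, Finset.prod_congr rfl fun i _ => h1 i, Finset.prod_univ_sum]
    refine Finset.sum_congr rfl fun k _ => ?_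
    rw [Finset.prod_mul_distrib]; rfl
  exact (Approx.sum _ fun k => (Approx.phi β k).const_mul _).congr fun x _ => e x

lemma mono1_pos {b : ℝ} (m : ℕ) {x : ℝ} (hx : 0 < x) : 0 < mono1 b m x := by
  unfold mono1; positivity

lemma mono_pos {β : Fin d → ℝ} (m : Fin d → ℕ) {x : Fin d → ℝ} (hx : x ∈ orthant d) :
    0 < mono β m x := Finset.prod_pos fun i _ => mono1_pos _ (mem_orthant.mp hx i)

lemma exists_mono_le {β : Fin d → ℝ} (hβ : ∀ i, 1 / 2 < β i) (m : Fin d → ℕ) :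
    ∃ C : ℝ, 0 ≤ C ∧ ∀ x ∈ orthant d, mono β m x ≤ C * gauss (1 / 4) x := by
  choose C hC h using fun i => exists_rpow_le_exp (e := 2 * m i + (β i + 1 / 2))
    (by have := hβ i; positivity)
  refine ⟨∏ i, C i, Finset.prod_nonneg fun i _ => hC i, fun x hx => ?_⟩
  rw [mono, gauss_eq_prod, ← Finset.prod_mul_distrib]
  refine Finset.prod_le_prod (fun i _ => (mono1_pos _ (mem_orthant.mp hx i)).le) fun i _ => ?_
  have hxi := mem_orthant.mp hx i
  have h1 := h i (x i) hxi
  have e1 : (x i ^ 2) ^ m i * x i ^ (β i + 1 / 2) = x i ^ ((2 : ℝ) * m i + (β i + 1 / 2)) := by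
    rw [Real.rpow_add hxi (2 * (m i : ℝ)), ← pow_mul, ← Real.rpow_natCast]
    push_cast
    rfl
  rw [mono1, ← mul_assoc, e1]
  calc _ ≤ C i * Real.exp (x i ^ 2 / 4) * Real.exp (-x i ^ 2 / 2) := by gcongr
    _ = _ := by rw [mul_assoc, ← Real.exp_add]; ring_nf

/-- Multiplying a monomial by `x_i^(2n)` raises the exponent. -/
lemma mono_update (β : Fin d → ℝ) (m : Fin d → ℕ) (i : Fin d) (n : ℕ) (x : Fin d → ℝ) :
    mono β (Function.update m i (m i + n)) x = (x i ^ 2) ^ n * mono β m x := by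
  rw [mono, mono, Fintype.prod_eq_mul_prod_compl i, Fintype.prod_eq_mul_prod_compl i, ← mul_assoc]
  congr 1
  · simp only [mono1, Function.update_self]
    ring
  · refine Finset.prod_congr rfl fun j hj => ?_
    have : j ≠ i := by simpa using hj
    simp [this]

lemma mono_mul_exp_sub_sum (β : Fin d → ℝ) (m : Fin d → ℕ) (i : Fin d) (N : ℕ) (x : Fin d → ℝ)
    (y : ℝ) :
    mono β m x * (Real.exp (-(x i ^ 2 / 16)) * y) -
      ∑ n ∈ Finset.range N, ((-1 / 16) ^ n / n.factorial) *
        (mono β (Function.update m i (m i + n)) x * y) =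
      mono β m x * y * (Real.exp (-(x i ^ 2 / 16)) -
        ∑ n ∈ Finset.range N, (-(x i ^ 2 / 16)) ^ n / n.factorial) := by
  rw [mul_sub, Finset.mul_sum]
  congr 1
  · ring
  · refine Finset.sum_congr rfl fun n _ => ?_
    rw [mono_update, show -(x i ^ 2 / 16) = (-1 / 16) * x i ^ 2 by ring, mul_pow]
    ring

/-- The bounded functions that stay, after multiplication by any of the functions `mono`, in the
closed span of the `φ_k^β`. -/
def Multiplier (β : Fin d → ℝ) (b : (Fin d → ℝ) → ℝ) : Prop :=
  (∃ B : ℝ, ∀ x ∈ orthant d, |b x| ≤ B) ∧ ∀ m, Approx β (fun x => mono β m x * b x)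

/-- The Taylor remainder of `exp (-s)` is at most that of `exp s`, whose terms are compared with those
of `exp (2 s)`. The factor `exp (2 s)` is harmless against a Gaussian weight. -/
lemma abs_exp_neg_sub_sum_le {s : ℝ} (hs : 0 ≤ s) (N : ℕ) :
    |Real.exp (-s) - ∑ n ∈ Finset.range N, (-s) ^ n / n.factorial| ≤
      Real.exp (2 * s) * (1 / 2) ^ N := by
  have h := Complex.norm_exp_sub_sum_le_exp_norm_sub_sum ((-s : ℝ) : ℂ) N
  have e : Complex.exp ((-s : ℝ) : ℂ) - ∑ n ∈ Finset.range N, ((-s : ℝ) : ℂ) ^ n / n.factorial =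
      ((Real.exp (-s) - ∑ n ∈ Finset.range N, (-s) ^ n / n.factorial : ℝ) : ℂ) := by
    push_cast; rfl
  rw [e, Complex.norm_real, Complex.norm_real, Real.norm_eq_abs, Real.norm_eq_abs, abs_neg,
    abs_of_nonneg hs] at h
  refine h.trans ?_
  have hS : ∀ t : ℝ, HasSum (fun n : ℕ => t ^ (n + N) / (n + N).factorial)
      (Real.exp t - ∑ n ∈ Finset.range N, t ^ n / n.factorial) := fun t => by
    have := NormedSpace.expSeries_div_hasSum_exp t
    rw [← Real.exp_eq_exp_ℝ] at this
    exact (hasSum_nat_add_iff' N).mpr this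
  have h1 := hasSum_le (fun n => ?_) (hS s) ((hS (2 * s)).mul_right ((1 / 2) ^ N))
  · refine h1.trans (mul_le_mul_of_nonneg_right ?_ (by positivity))
    have : 0 ≤ ∑ n ∈ Finset.range N, (2 * s) ^ n / n.factorial :=
      Finset.sum_nonneg fun n _ => by positivity
    linarith
  · have : (1 : ℝ) ≤ 2 ^ n := one_le_pow₀ (by norm_num)
    calc s ^ (n + N) / (n + N).factorial = 1 * (s ^ (n + N) / (n + N).factorial) := by ring
      _ ≤ 2 ^ n * (s ^ (n + N) / (n + N).factorial) := by gcongr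
      _ = _ := by rw [mul_pow, pow_add 2 n N, div_pow, one_pow]; field_simp

namespace Multiplier

variable {β : Fin d → ℝ} {a b : (Fin d → ℝ) → ℝ}

lemma one (hβ : ∀ i, 1 / 2 < β i) : Multiplier β (fun _ => 1) :=
  ⟨⟨1, fun _ _ => by simp⟩, fun m => by simpa using approx_mono hβ m⟩

lemma add (ha : Multiplier β a) (hb : Multiplier β b) : Multiplier β (fun x => a x + b x) := by
  obtain ⟨⟨A, hA⟩, ha⟩ := ha
  obtain ⟨⟨B, hB⟩, hb⟩ := hb
  refine ⟨⟨A + B, fun x hx => (abs_add_le _ _).trans (add_le_add (hA x hx) (hB x hx))⟩,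
    fun m => ((ha m).add (hb m)).congr fun x _ => mul_add _ _ _⟩

lemma const_mul (ha : Multiplier β a) (r : ℝ) : Multiplier β (fun x => r * a x) := by
  obtain ⟨⟨A, hA⟩, ha⟩ := ha
  refine ⟨⟨|r| * A, fun x hx => ?_⟩, fun m => ((ha m).const_mul r).congr fun x _ => by ring⟩
  rw [abs_mul]
  exact mul_le_mul_of_nonneg_left (hA x hx) (abs_nonneg r)

/-- Multipliers may be multiplied by `exp (-x_i² / 16)`: expand the exponential in its Taylor
series, which converges in the weighted norm. -/
lemma exp_mul (hβ : ∀ i, 1 / 2 < β i) (hb : Multiplier β b) (i : Fin d) :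
    Multiplier β (fun x => Real.exp (-(x i ^ 2 / 16)) * b x) := by
  obtain ⟨⟨B, hB⟩, hb⟩ := hb
  refine ⟨⟨B, fun x hx => ?_⟩, fun m => Approx.of_close fun ε hε => ?_⟩
  · rw [abs_mul, Real.abs_exp]
    have h1 : Real.exp (-(x i ^ 2 / 16)) ≤ 1 := Real.exp_le_one_iff.mpr (by
      have := sq_nonneg (x i); linarith)
    exact (mul_le_of_le_one_left (abs_nonneg _) h1).trans (hB x hx)
  obtain ⟨C, hC, hm⟩ := exists_mono_le hβ m
  obtain ⟨N, hN⟩ : ∃ N : ℕ, C * |B| * (1 / 2) ^ N ≤ ε := by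
    have : Tendsto (fun N : ℕ => C * |B| * (1 / 2 : ℝ) ^ N) atTop (𝓝 (C * |B| * 0)) :=
      (tendsto_pow_atTop_nhds_zero_of_lt_one (by norm_num) (by norm_num)).const_mul _
    rw [mul_zero] at this
    exact (this.eventually_le_const hε).exists
  refine ⟨fun x => ∑ n ∈ Finset.range N, ((-1 / 16 : ℝ) ^ n / n.factorial) *
    (mono β (Function.update m i (m i + n)) x * b x),
    Approx.sum _ fun n => (hb _).const_mul _, fun x hx => ?_⟩
  have hg : Real.exp (2 * (x i ^ 2 / 16)) ≤ gauss (-(1 / 8)) x := by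
    rw [gauss]
    refine Real.exp_le_exp.mpr ?_
    have := Finset.single_le_sum (f := fun j => x j ^ 2) (fun j _ => sq_nonneg _)
      (Finset.mem_univ i)
    linarith
  rw [mono_mul_exp_sub_sum, abs_mul, abs_mul, abs_of_pos (mono_pos m hx)]
  calc _ ≤ C * gauss (1 / 4) x * |B| * (gauss (-(1 / 8)) x * (1 / 2) ^ N) := by
        have h1 := gauss_pos (1 / 4) x
        have h2 := (abs_exp_neg_sub_sum_le (s := x i ^ 2 / 16) (by positivity) N).trans
          (mul_le_mul_of_nonneg_right hg (by positivity))
        exact mul_le_mul (mul_le_mul (hm x hx) ((hB x hx).trans (le_abs_self B)) (abs_nonneg _)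
          (by positivity)) h2 (abs_nonneg _) (by positivity)
    _ = (C * |B| * (1 / 2) ^ N) * (gauss (1 / 4) x * gauss (-(1 / 8)) x) := by ring
    _ = (C * |B| * (1 / 2) ^ N) * gauss (1 / 8) x := by
        rw [gauss_mul, show (1 / 4 + -(1 / 8) : ℝ) = 1 / 8 by norm_num]
    _ ≤ _ := mul_le_mul_of_nonneg_right hN (gauss_pos _ _).le

end Multiplier

/-- Polynomials in the variables `exp (-x_i² / 16)` are multipliers. -/
lemma multiplier_of_mem_adjoin {β : Fin d → ℝ} (hβ : ∀ i, 1 / 2 < β i) {P : C(Fin d → ℝ, ℝ)}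
    (hP : P ∈ Algebra.adjoin ℝ (Set.range fun i : Fin d =>
      (⟨fun z => z i, continuous_apply i⟩ : C(Fin d → ℝ, ℝ)))) :
    Multiplier β (fun x => P fun i => Real.exp (-(x i ^ 2 / 16))) := by
  suffices ∀ a, Multiplier β a →
      Multiplier β (fun x => (P fun i => Real.exp (-(x i ^ 2 / 16))) * a x) by
    simpa using this _ (Multiplier.one hβ)
  induction hP using Algebra.adjoin_induction with
  | mem P hP =>
    obtain ⟨i, rfl⟩ := hP
    exact fun a ha => ha.exp_mul hβ i
  | algebraMap r => exact fun a ha => ha.const_mul r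
  | add P Q _ _ hP hQ =>
    intro a ha
    simpa [add_mul] using (hP a ha).add (hQ a ha)
  | mul P Q _ _ hP hQ =>
    intro a ha
    simpa [mul_assoc] using hP _ (hQ a ha)

/-- Every continuous function with compact support in the orthant is approximable: after division by
the ground state it is a continuous function of the variables `exp (-x_i² / 16)`, and the
Stone-Weierstrass theorem applies on the unit cube. -/
theorem approx_of_hasCompactSupport {β : Fin d → ℝ} (hβ : ∀ i, 1 / 2 < β i) {h : (Fin d → ℝ) → ℝ}
    (hc : Continuous h) (hs : HasCompactSupport h) (hsub : tsupport h ⊆ orthant d) :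
    Approx β h := by
  have hw : ContinuousOn (mono β 0) (orthant d) := by
    unfold mono mono1
    refine continuousOn_finsetProd _ fun i _ => ?_
    have : ContinuousOn (fun x : Fin d → ℝ => x i ^ (β i + 1 / 2)) (orthant d) :=
      (continuous_apply i).continuousOn.rpow_const fun x hx => Or.inl (mem_orthant.mp hx i).ne'
    exact (by fun_prop : ContinuousOn (fun x : Fin d → ℝ => (x i ^ 2) ^ (0 : Fin d → ℕ) i)
      (orthant d)).mul (this.mul (by fun_prop))
  -- the quotient by the ground state, and its expression in the variables `exp (-x_i² / 16)`
  set H : (Fin d → ℝ) → ℝ := fun x => h x / mono β 0 x with hH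
  have hHs : tsupport H ⊆ tsupport h := closure_mono fun x hx => by
    rw [Function.mem_support] at hx ⊢
    exact fun h0 => hx (by rw [hH]; simp [h0])
  have hHc : Continuous H := by
    refine ContinuousOn.continuous_of_tsupport_subset (s := orthant d) ?_ isOpen_orthant
      (hHs.trans hsub)
    exact hc.continuousOn.div hw fun x hx => (mono_pos 0 hx).ne'
  obtain ⟨R, hR⟩ := (hs.isCompact.isBounded).exists_norm_le
  set X : (Fin d → ℝ) → Fin d → ℝ := fun z i => √(-(16 * Real.log (z i))) with hX
  set K : (Fin d → ℝ) → ℝ := fun z => H (X z) with hK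
  have hKs : tsupport K ⊆ {z | ∀ i, Real.exp (-(R ^ 2 / 16)) ≤ |z i|} := by
    refine closure_minimal (fun z hz i => ?_) ?_
    · have h1 : X z ∈ tsupport h := hHs (subset_tsupport _ hz)
      have h2 : 0 < X z i := mem_orthant.mp (hsub h1) i
      have h3 : X z i ≤ R := (le_abs_self _).trans ((norm_le_pi_norm (X z) i).trans (hR _ h1))
      have h4 : X z i ^ 2 = -(16 * Real.log (z i)) := Real.sq_sqrt (Real.sqrt_pos.mp h2).le
      have h5 : z i ≠ 0 := fun h0 => by
        rw [h0, Real.log_zero] at h4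
        simp at h4
        exact h2.ne' h4
      rw [← Real.exp_log (abs_pos.mpr h5), Real.log_abs, Real.exp_le_exp]
      nlinarith
    · simp only [Set.ofPred_forall]
      exact isClosed_iInter fun i => isClosed_le continuous_const (by fun_prop)
  have hKc : Continuous K := by
    refine ContinuousOn.continuous_of_tsupport_subset (s := {z | ∀ i, z i ≠ 0}) ?_ ?_
      (hKs.trans fun z hz i => abs_pos.mp ((Real.exp_pos _).trans_le (hz i)))
    · refine hHc.comp_continuousOn (continuousOn_pi.mpr fun i => ?_)
      refine (ContinuousOn.neg (ContinuousOn.mul continuousOn_const ?_)).sqrt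
      exact (continuous_apply i).continuousOn.log fun z hz => hz i
    · simp only [Set.ofPred_forall]
      exact isOpen_iInter_of_finite fun i => isOpen_ne_fun (continuous_apply i) continuous_const
  refine Approx.of_close fun ε hε => ?_
  obtain ⟨C, hC, hm⟩ := exists_mono_le hβ 0
  have hsep : (Algebra.adjoin ℝ (Set.range fun i : Fin d =>
      (⟨fun z => z i, continuous_apply i⟩ : C(Fin d → ℝ, ℝ)))).SeparatesPoints := by
    intro z z' hz
    obtain ⟨i, hi⟩ := Function.ne_iff.mp hz
    exact ⟨_, ⟨_, Algebra.subset_adjoin ⟨i, rfl⟩, rfl⟩, hi⟩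
  obtain ⟨P, hP, hPK⟩ :=
    ContinuousMap.exists_mem_subalgebra_near_continuous_of_isCompact_of_separatesPoints hsep
      ⟨K, hKc⟩ (isCompact_Icc (a := (0 : Fin d → ℝ)) (b := 1)) (ε := ε / (C + 1)) (by positivity)
  refine ⟨_, (multiplier_of_mem_adjoin hβ hP).2 0, fun x hx => ?_⟩
  have hx0 := mem_orthant.mp hx
  have e1 : X (fun i => Real.exp (-(x i ^ 2 / 16))) = x := by
    funext i
    simp only [hX, Real.log_exp]
    rw [show -(16 * -(x i ^ 2 / 16)) = x i ^ 2 by ring, Real.sqrt_sq (hx0 i).le]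
  have e2 : h x = mono β 0 x * K fun i => Real.exp (-(x i ^ 2 / 16)) := by
    simp only [hK, e1, hH]
    rw [mul_div_cancel₀ _ (mono_pos 0 hx).ne']
  have h1 := hPK (fun i => Real.exp (-(x i ^ 2 / 16))) ⟨fun i => (Real.exp_pos _).le, fun i =>
    Real.exp_le_one_iff.mpr (by have := sq_nonneg (x i); linarith)⟩
  rw [ContinuousMap.coe_mk, Real.norm_eq_abs, abs_sub_comm] at h1
  rw [e2, ← mul_sub, abs_mul, abs_of_pos (mono_pos 0 hx)]
  have hgp := gauss_pos (1 / 4) x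
  have h2 : C * (ε / (C + 1)) ≤ ε := by
    rw [mul_div_assoc', div_le_iff₀ (by positivity)]
    nlinarith
  have h3 : gauss (1 / 4) x ≤ gauss (1 / 8) x := by
    have h := gauss_mul (1 / 8) (1 / 8) x
    rw [show (1 / 8 + 1 / 8 : ℝ) = 1 / 4 by norm_num] at h
    rw [← h]
    exact mul_le_of_le_one_left (gauss_pos _ _).le (gauss_le_one (by norm_num) x)
  calc _ ≤ C * gauss (1 / 4) x * (ε / (C + 1)) :=
        mul_le_mul (hm x hx) h1.le (abs_nonneg _) (by positivity)
    _ = C * (ε / (C + 1)) * gauss (1 / 4) x := by ring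
    _ ≤ _ := mul_le_mul h2 h3 hgp.le hε.le

end

section

/-! ### Density in `L^p` and completeness -/

variable {d : ℕ}

lemma memLp_comb {β : Fin d → ℝ} (hβ : ∀ i, 1 / 2 < β i) (c : (Fin d → ℕ) →₀ ℝ) {p : ℝ≥0∞}
    (hp : p ≠ 0) (hp' : p ≠ ∞) : MemLp (comb β c) p (mu d) := by
  unfold comb
  exact memLp_finsetSum _ fun k _ => (memLp_phi hβ k hp hp').const_mul _

lemma memLp_gauss {c : ℝ} (hc : 0 < c) {p : ℝ≥0∞} (hp : p ≠ 0) (hp' : p ≠ ∞) :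
    MemLp (gauss c) p (mu d) :=
  memLp_of_gauss_bound (C := 1) (continuous_gauss c).continuousOn hc
    (fun x _ => by rw [one_mul, Real.norm_eq_abs, abs_of_pos (gauss_pos _ _)]) hp hp'

/-- A cutoff that vanishes near the boundary of the orthant. -/
def cutoff (n : ℕ) (x : Fin d → ℝ) : ℝ := ∏ i, min 1 (max 0 (n * x i - 1))

lemma continuous_cutoff (n : ℕ) : Continuous (cutoff n : (Fin d → ℝ) → ℝ) := by
  unfold cutoff; fun_prop

lemma cutoff_nonneg (n : ℕ) (x : Fin d → ℝ) : 0 ≤ cutoff n x :=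
  Finset.prod_nonneg fun _ _ => le_min zero_le_one (le_max_left _ _)

lemma cutoff_le_one (n : ℕ) (x : Fin d → ℝ) : cutoff n x ≤ 1 :=
  Finset.prod_le_one (fun _ _ => le_min zero_le_one (le_max_left _ _)) fun _ _ => min_le_left _ _

lemma tendsto_cutoff {x : Fin d → ℝ} (hx : x ∈ orthant d) :
    Tendsto (fun n => cutoff n x) atTop (𝓝 1) := by
  refine tendsto_const_nhds.congr' ?_
  have : ∀ i, ∀ᶠ n : ℕ in atTop, 2 ≤ (n : ℝ) * x i := fun i =>
    (tendsto_natCast_atTop_atTop.atTop_mul_const (mem_orthant.mp hx i)).eventually_ge_atTop 2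
  filter_upwards [eventually_all.mpr this] with n hn
  refine (Finset.prod_eq_one fun i _ => ?_).symm
  rw [max_eq_right (by linarith [hn i]), min_eq_left (by linarith [hn i])]

lemma tsupport_cutoff_subset (n : ℕ) : tsupport (cutoff n) ⊆ orthant d := by
  have h : tsupport (cutoff n) ⊆ {x : Fin d → ℝ | ∀ i, 1 ≤ n * x i} := by
    refine closure_minimal (fun x hx i => ?_) ?_
    · by_contra! h
      refine hx (Finset.prod_eq_zero (Finset.mem_univ i) ?_)
      rw [max_eq_left (by linarith), min_eq_right zero_le_one]
    · simp only [Set.ofPred_forall]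
      exact isClosed_iInter fun i => isClosed_le continuous_const (by fun_prop)
  refine h.trans fun x hx => mem_orthant.mpr fun i => ?_
  by_contra! h0
  have := mul_nonpos_of_nonneg_of_nonpos (Nat.cast_nonneg (α := ℝ) n) h0
  linarith [hx i]

/-- Functions with compact support in the open orthant are dense in `L^p`. -/
lemma exists_continuous_orthant_eLpNorm_sub_le {p : ℝ≥0∞} (hp : 1 ≤ p) (hp' : p ≠ ∞)
    {f : (Fin d → ℝ) → ℝ} (hf : MemLp f p (mu d)) {ε : ℝ≥0∞} (hε : ε ≠ 0) :
    ∃ h : (Fin d → ℝ) → ℝ, Continuous h ∧ HasCompactSupport h ∧ tsupport h ⊆ orthant d ∧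
      MemLp h p (mu d) ∧ eLpNorm (fun x => f x - h x) p (mu d) ≤ ε := by
  have hp0 : p ≠ 0 := (one_pos.trans_le hp).ne'
  have hε2 : ε / 2 ≠ 0 := (ENNReal.half_pos hε).ne'
  have : (mu d).Regular := by unfold mu; infer_instance
  obtain ⟨g, hgs, hfg, hgc, hg⟩ := hf.exists_hasCompactSupport_eLpNorm_sub_le hp' hε2
  have hm : ∀ n, MemLp (fun x => g x - g x * cutoff n x) p (mu d) := fun n => by
    refine hg.mono (by
      have := continuous_cutoff (d := d) n
      exact (by fun_prop : Continuous fun x => g x - g x * cutoff n x).aestronglyMeasurable)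
      (ae_of_all _ fun x => ?_)
    rw [← mul_one_sub, norm_mul]
    refine mul_le_of_le_one_right (norm_nonneg _) ?_
    rw [Real.norm_eq_abs, abs_le]
    constructor <;> linarith [cutoff_nonneg n x, cutoff_le_one n x]
  have hpr : 0 < p.toReal := ENNReal.toReal_pos hp0 hp'
  have ht : Tendsto (fun n => eLpNorm (fun x => g x - g x * cutoff n x) p (mu d)) atTop (𝓝 0) := by
    have h1 : Tendsto (fun n => ∫ x, ‖g x - g x * cutoff n x‖ ^ p.toReal ∂(mu d)) atTop
        (𝓝 (∫ x, (0 : ℝ) ∂(mu d))) := by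
      refine tendsto_integral_of_dominated_convergence (fun x => ‖g x‖ ^ p.toReal)
        (fun n => ((hm n).integrable_norm_rpow hp0 hp').aestronglyMeasurable)
        (hg.integrable_norm_rpow hp0 hp') (fun n => ae_of_all _ fun x => ?_)
        (ae_mu fun x hx => ?_)
      · rw [Real.norm_of_nonneg (by positivity), ← mul_one_sub, norm_mul]
        refine Real.rpow_le_rpow (by positivity) (mul_le_of_le_one_right (norm_nonneg _) ?_) hpr.le
        rw [Real.norm_eq_abs, abs_le]
        constructor <;> linarith [cutoff_nonneg n x, cutoff_le_one n x]
      · have h2 : Tendsto (fun n => g x - g x * cutoff n x) atTop (𝓝 (g x - g x * 1)) :=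
          tendsto_const_nhds.sub ((tendsto_cutoff hx).const_mul _)
        have h3 := h2.norm.rpow_const (p := p.toReal) (Or.inr hpr.le)
        simpa [Real.zero_rpow hpr.ne'] using h3
    have h4 := ENNReal.tendsto_ofReal (h1.rpow_const (p := p.toReal⁻¹) (Or.inr (by positivity)))
    simp only [integral_zero, Real.zero_rpow (inv_ne_zero hpr.ne'), ENNReal.ofReal_zero] at h4
    refine h4.congr fun n => ?_
    rw [(hm n).eLpNorm_eq_integral_rpow_norm hp0 hp']
  obtain ⟨n, hn⟩ := (ht.eventually_le_const (pos_iff_ne_zero.mpr hε2)).exists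
  have hc : Continuous fun x => g x * cutoff n x := hgc.mul (continuous_cutoff n)
  refine ⟨fun x => g x * cutoff n x, hc, hgs.mul_right,
    (tsupport_mul_subset_right (f := g) (g := cutoff n)).trans (tsupport_cutoff_subset n), ?_, ?_⟩
  · have := hg.sub (hm n)
    refine this.congr_norm hc.aestronglyMeasurable (ae_of_all _ fun x => ?_)
    simp
  · have e : (fun x => f x - g x * cutoff n x) =
        (f - g) + fun x => g x - g x * cutoff n x := by
      funext x; simp
    rw [e]
    calc _ ≤ _ := eLpNorm_add_le (hf.sub hg).aestronglyMeasurable (hm n).aestronglyMeasurable hp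
      _ ≤ ε / 2 + ε / 2 := add_le_add hfg hn
      _ = ε := ENNReal.add_halves ε

/-- The finite combinations of the `φ_k^β` are dense in `L^p`. -/
theorem exists_comb_eLpNorm_sub_le {β : Fin d → ℝ} (hβ : ∀ i, 1 / 2 < β i) {p : ℝ≥0∞}
    (hp : 1 ≤ p) (hp' : p ≠ ∞) {f : (Fin d → ℝ) → ℝ} (hf : MemLp f p (mu d)) {ε : ℝ≥0∞}
    (hε : ε ≠ 0) : ∃ c, eLpNorm (fun x => f x - comb β c x) p (mu d) ≤ ε := by
  have hp0 : p ≠ 0 := (one_pos.trans_le hp).ne'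
  have hε2 : ε / 2 ≠ 0 := (ENNReal.half_pos hε).ne'
  obtain ⟨h, hc, hs, hsub, hh, hfh⟩ := exists_continuous_orthant_eLpNorm_sub_le hp hp' hf hε2
  have hgm := memLp_gauss (d := d) (c := 1 / 8) (by norm_num) hp0 hp'
  obtain ⟨r, hr, hr'⟩ : ∃ r : ℝ, 0 < r ∧
      ENNReal.ofReal r * eLpNorm (gauss (1 / 8)) p (mu d) ≤ ε / 2 := by
    have h1 : Tendsto (fun r : ℝ => ENNReal.ofReal r * eLpNorm (gauss (1 / 8)) p (mu d)) (𝓝[>] 0)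
        (𝓝 (ENNReal.ofReal 0 * eLpNorm (gauss (1 / 8)) p (mu d))) :=
      ENNReal.Tendsto.mul_const ((ENNReal.continuous_ofReal.tendsto 0).mono_left
        nhdsWithin_le_nhds) (Or.inr hgm.eLpNorm_ne_top)
    rw [ENNReal.ofReal_zero, zero_mul] at h1
    obtain ⟨r, h2, h3⟩ := ((h1.eventually_le_const (pos_iff_ne_zero.mpr hε2)).and
      self_mem_nhdsWithin).exists
    exact ⟨r, h3, h2⟩
  obtain ⟨c, hc'⟩ := approx_of_hasCompactSupport hβ hc hs hsub r hr
  refine ⟨c, ?_⟩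
  have e : (fun x => f x - comb β c x) = (fun x => f x - h x) + fun x => h x - comb β c x := by
    funext x; simp
  rw [e]
  have hcm := memLp_comb hβ c hp0 hp'
  refine (eLpNorm_add_le (hf.sub hh).aestronglyMeasurable (hh.sub hcm).aestronglyMeasurable
    hp).trans ?_
  rw [← ENNReal.add_halves ε]
  refine add_le_add hfh (le_trans ?_ hr')
  refine eLpNorm_le_mul_eLpNorm_of_ae_le_mul (ae_mu fun x hx => ?_) p
  rw [Real.norm_eq_abs, Real.norm_eq_abs, abs_of_pos (gauss_pos _ x)]
  exact hc' x hx

lemma integrable_mul_gauss {p : ℝ≥0∞} (hp : 1 < p) {u : (Fin d → ℝ) → ℝ}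
    (hu : MemLp u p (mu d)) : Integrable (fun x => u x * gauss (1 / 8) x) (mu d) := by
  have := ENNReal.HolderConjugate.conjExponent hp.le
  have h0 : p.conjExponent ≠ 0 := this.symm.ne_zero
  have h1 : p.conjExponent ≠ ∞ := by
    rw [ENNReal.conjExponent]
    simp [tsub_eq_zero_iff_le, hp]
  exact hu.integrable_mul (memLp_gauss (by norm_num) h0 h1)

lemma integrable_mul_phi {β : Fin d → ℝ} (hβ : ∀ i, 1 / 2 < β i) {u : (Fin d → ℝ) → ℝ}
    (hu : Integrable (fun x => u x * gauss (1 / 8) x) (mu d)) (k : Fin d → ℕ) :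
    Integrable (fun x => u x * phi β k x) (mu d) := by
  obtain ⟨C, hC, h⟩ := phi_jet_bound hβ k
  have h1 := hu.mul_bdd (c := C) (g := fun x => phi β k x * gauss (-(1 / 8)) x)
    (aestronglyMeasurable_mu ((continuousOn_phi β k).mul (continuous_gauss _).continuousOn))
    (ae_mu fun x hx => by
      have h1 := (h x hx).1
      rw [norm_mul, Real.norm_eq_abs, Real.norm_eq_abs, abs_of_pos (gauss_pos _ x)]
      calc _ ≤ C * gauss (1 / 4) x * gauss (-(1 / 8)) x :=
            mul_le_mul_of_nonneg_right h1 (gauss_pos _ x).le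
        _ = C * gauss (1 / 4 + -(1 / 8)) x := by rw [mul_assoc, gauss_mul]
        _ ≤ C * 1 := mul_le_mul_of_nonneg_left (gauss_le_one (by norm_num) x) hC
        _ = C := mul_one C)
  refine h1.congr (ae_of_all _ fun x => ?_)
  calc _ = u x * phi β k x * (gauss (1 / 8) x * gauss (-(1 / 8)) x) := by ring
    _ = _ := by rw [gauss_mul]; simp [gauss]

/-- The family `φ_k^β` is complete: among the functions integrable against the Gaussian weight, which
include all `L^p` functions with `p > 1`, only the zero function is orthogonal to all its members. -/
theorem ae_eq_zero_of_integral_mul_phi {β : Fin d → ℝ} (hβ : ∀ i, 1 / 2 < β i)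
    {u : (Fin d → ℝ) → ℝ} (hu : Integrable (fun x => u x * gauss (1 / 8) x) (mu d))
    (h : ∀ k, ∫ x, u x * phi β k x ∂(mu d) = 0) : ∀ᵐ x ∂(mu d), u x = 0 := by
  have hgg : ∀ x : Fin d → ℝ, u x * gauss (1 / 8) x * gauss (-(1 / 8)) x = u x := fun x => by
    rw [mul_assoc, gauss_mul]; simp [gauss]
  have hloc : LocallyIntegrableOn u (orthant d) volume := by
    have h1 : LocallyIntegrableOn (fun x => u x * gauss (1 / 8) x) (orthant d) volume :=
      IntegrableOn.locallyIntegrableOn hu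
    refine (h1.mul_continuousOn (continuous_gauss (-(1 / 8))).continuousOn
      isOpen_orthant.isLocallyClosed).congr ?_
    exact ae_of_all _ hgg
  refine (ae_restrict_iff' measurableSet_orthant).mpr
    (isOpen_orthant.ae_eq_zero_of_integral_contDiff_smul_eq_zero hloc fun g hg hgs hsub => ?_)
  have hcomb : ∀ c, Integrable (fun x => u x * comb β c x) (mu d) ∧
      ∫ x, u x * comb β c x ∂(mu d) = 0 := by
    intro c
    have e : (fun x => u x * comb β c x) = fun x => ∑ k ∈ c.support, c k * (u x * phi β k x) := by
      funext x
      rw [comb, Finset.mul_sum]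
      exact Finset.sum_congr rfl fun k _ => by ring
    have hi := fun k => (integrable_mul_phi hβ hu k).const_mul (c k)
    rw [e, integral_finsetSum _ fun k _ => hi k]
    refine ⟨integrable_finsetSum _ fun k _ => hi k, Finset.sum_eq_zero fun k _ => ?_⟩
    rw [integral_const_mul, h, mul_zero]
  have hmu : ∫ x, g x • u x = ∫ x, u x * g x ∂(mu d) := by
    rw [mu_eq_restrict, setIntegral_eq_integral_of_forall_compl_eq_zero]
    · exact integral_congr_ae (ae_of_all _ fun x => mul_comm _ _)
    · intro x hx
      rw [image_eq_zero_of_notMem_tsupport (fun h => hx (hsub h)), mul_zero]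
  rw [hmu]
  set J := ∫ x, |u x| * gauss (1 / 8) x ∂(mu d) with hJ
  have hJi : Integrable (fun x => |u x| * gauss (1 / 8) x) (mu d) :=
    hu.abs.congr (ae_of_all _ fun x => by simp [abs_mul, abs_of_pos (gauss_pos _ x)])
  have hbound : ∀ ε > 0, |∫ x, u x * g x ∂(mu d)| ≤ ε * J := by
    intro ε hε
    obtain ⟨c, hc⟩ := approx_of_hasCompactSupport hβ hg.continuous hgs hsub ε hε
    have hle : ∀ᵐ x ∂(mu d), ‖u x * g x - u x * comb β c x‖ ≤ ε * (|u x| * gauss (1 / 8) x) :=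
      ae_mu fun x hx => by
        rw [← mul_sub, norm_mul, Real.norm_eq_abs, Real.norm_eq_abs]
        calc _ ≤ |u x| * (ε * gauss (1 / 8) x) :=
              mul_le_mul_of_nonneg_left (hc x hx) (abs_nonneg _)
          _ = _ := by ring
    have hgi : Integrable (fun x => u x * g x) (mu d) := by
      obtain ⟨B, hB⟩ := (hgs.mul_left (f := gauss (-(1 / 8)))).exists_bound_of_continuous
        ((continuous_gauss _).mul hg.continuous)
      have h1 := hu.mul_bdd (c := B)
        ((continuous_gauss (-(1 / 8))).mul hg.continuous).aestronglyMeasurable (ae_of_all _ hB)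
      refine h1.congr (ae_of_all _ fun x => ?_)
      simp only [Pi.mul_apply]
      rw [← mul_assoc, hgg]
    have e : ∫ x, u x * g x ∂(mu d) = ∫ x, (u x * g x - u x * comb β c x) ∂(mu d) := by
      rw [integral_sub hgi (hcomb c).1, (hcomb c).2, sub_zero]
    rw [e, ← Real.norm_eq_abs, hJ, ← integral_const_mul]
    exact norm_integral_le_of_norm_le (hJi.const_mul ε) hle
  have hJ0 : 0 ≤ J := integral_nonneg fun x => mul_nonneg (abs_nonneg _) (gauss_pos _ _).le
  refine abs_nonpos_iff.mp (le_of_forall_pos_le_add fun η hη => ?_)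
  refine (hbound (η / (J + 1)) (by positivity)).trans ?_
  rw [zero_add, div_mul_eq_mul_div, div_le_iff₀ (by positivity)]
  nlinarith

end

section

/-! ### The Riesz transforms on `L²` -/

variable {d : ℕ}

lemma coeFn_sum_smul_toLp {κ : Type*} {p : ℝ≥0∞} (s : Finset κ) (a : κ → ℝ)
    {h : κ → (Fin d → ℝ) → ℝ} (hh : ∀ k, MemLp (h k) p (mu d)) :
    ((∑ k ∈ s, a k • (hh k).toLp (h k) : Lp ℝ p (mu d)) : (Fin d → ℝ) → ℝ) =ᵐ[mu d]
      fun x => ∑ k ∈ s, a k * h k x := by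
  classical
  induction s using Finset.induction_on with
  | empty =>
    simp only [Finset.sum_empty]
    exact Lp.coeFn_zero ℝ p (mu d)
  | insert k s hk ih =>
    simp only [Finset.sum_insert hk]
    filter_upwards [Lp.coeFn_add (a k • (hh k).toLp (h k)) (∑ k ∈ s, a k • (hh k).toLp (h k)), ih,
      Lp.coeFn_smul (a k) ((hh k).toLp (h k)), (hh k).coeFn_toLp] with x h1 h2 h3 h4
    rw [h1, Pi.add_apply, h2, h3, Pi.smul_apply, h4, smul_eq_mul]

/-- The function `φ_k^β` as an element of `L²`. -/
def phiL2 {β : Fin d → ℝ} (hβ : ∀ i, 1 / 2 < β i) (k : Fin d → ℕ) : Lp ℝ 2 (mu d) :=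
  (memLp_phi hβ k two_ne_zero (by simp)).toLp (phi β k)

lemma inner_phiL2 {β : Fin d → ℝ} (hβ : ∀ i, 1 / 2 < β i) (k : Fin d → ℕ) {f : (Fin d → ℝ) → ℝ}
    (hf : MemLp f 2 (mu d)) :
    inner ℝ (phiL2 hβ k) (hf.toLp f) = ∫ x, f x * phi β k x ∂(mu d) := by
  rw [L2.inner_def]
  refine integral_congr_ae ?_
  filter_upwards [hf.coeFn_toLp, (memLp_phi hβ k two_ne_zero (by simp)).coeFn_toLp] with x h1 h2
  rw [h1, phiL2, h2]
  simp

lemma orthonormal_phiL2 {β : Fin d → ℝ} (hβ : ∀ i, 1 / 2 < β i) :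
    Orthonormal ℝ (phiL2 hβ) := by
  classical
  rw [orthonormal_iff_ite]
  intro k m
  rw [show phiL2 hβ m = (memLp_phi hβ m two_ne_zero (by simp)).toLp (phi β m) from rfl,
    inner_phiL2, integral_phi_mul hβ]
  simp [eq_comm]

/-- The coefficient of `φ_{k-e_i}^{α+e_i}` in the expansion of the `i`-th Riesz transform. -/
def rieszCoeff (α : Fin d → ℝ) (i : Fin d) (f : (Fin d → ℝ) → ℝ) (k : Fin d → ℕ) : ℝ :=
  eigenvalue α k ^ (-(1 / 2) : ℝ) * coeff α f k * (-2 * √(k i : ℝ))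

/-- The multi-index `m + e_i`. -/
def lift (m : Fin d → ℕ) (i : Fin d) : Fin d → ℕ := Function.update m i (m i + 1)

lemma lower_lift (m : Fin d → ℕ) (i : Fin d) : lower (lift m i) i = m := by
  simp [lower, lift]

lemma lift_lower {k : Fin d → ℕ} {i : Fin d} (h : k i ≠ 0) : lift (lower k i) i = k := by
  simp [lower, lift, Nat.sub_add_cancel (Nat.one_le_iff_ne_zero.mpr h)]

lemma lift_injective (i : Fin d) : Function.Injective fun m : Fin d → ℕ => lift m i :=
  fun m m' h => by
    have := congrArg (fun k => lower k i) h
    simpa [lower_lift] using this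

/-- The Riesz transform does not increase the coefficients, since `4 k_i ≤ λ_k`. -/
lemma sq_rieszCoeff_le {α : Fin d → ℝ} (hα : ∀ i, 1 / 2 < α i) (i : Fin d)
    (f : (Fin d → ℝ) → ℝ) (k : Fin d → ℕ) : rieszCoeff α i f k ^ 2 ≤ coeff α f k ^ 2 := by
  have hl : 4 * (k i : ℝ) + 1 ≤ eigenvalue α k := by
    have h1 : (k i : ℝ) ≤ ∑ j, (k j : ℝ) :=
      Finset.single_le_sum (f := fun j => (k j : ℝ)) (fun _ _ => Nat.cast_nonneg _)
        (Finset.mem_univ i)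
    have h2 : 0 ≤ ∑ j, α j := Finset.sum_nonneg fun j _ => by linarith [hα j]
    have h3 : (1 : ℝ) ≤ d := by exact_mod_cast (Nat.one_le_iff_ne_zero.mpr (i.pos.ne'))
    rw [eigenvalue]; linarith
  have hk : (0 : ℝ) ≤ k i := Nat.cast_nonneg _
  have hpos : 0 < eigenvalue α k := by linarith
  have h1 : (eigenvalue α k ^ (-(1 / 2) : ℝ)) ^ 2 = (eigenvalue α k)⁻¹ := by
    rw [← Real.rpow_natCast, ← Real.rpow_mul hpos.le]
    norm_num [Real.rpow_neg_one]
  have e : rieszCoeff α i f k ^ 2 = (4 * k i) / eigenvalue α k * coeff α f k ^ 2 := by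
    rw [rieszCoeff, mul_pow, mul_pow, h1, mul_pow, Real.sq_sqrt hk]
    ring
  rw [e]
  refine mul_le_of_le_one_left (sq_nonneg _) ?_
  rw [div_le_one hpos]; linarith

/-- The series of the Riesz transform is orthogonal: `k ↦ k - e_i` is injective where `k_i ≠ 0`, and
the other terms vanish. -/
lemma summable_rieszCoeff_smul {α : Fin d → ℝ} (hα : ∀ i, 1 / 2 < α i) (i : Fin d)
    {f : (Fin d → ℝ) → ℝ} (hf : MemLp f 2 (mu d)) :
    Summable fun k => rieszCoeff α i f k • phiL2 (raise_gt hα i) (lower k i) := by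
  have hz : ∀ k ∉ Set.range (fun m : Fin d → ℕ => lift m i),
      rieszCoeff α i f k • phiL2 (raise_gt hα i) (lower k i) = 0 := by
    intro k hk
    have : k i = 0 := by
      by_contra h
      exact hk ⟨_, lift_lower h⟩
    simp [rieszCoeff, this]
  rw [← (lift_injective i).summable_iff hz]
  have h1 : Summable fun k => coeff α f k ^ 2 := by
    have := (orthonormal_phiL2 hα).inner_products_summable (hf.toLp f)
    simp only [inner_phiL2] at this
    simpa [coeff] using this
  have h2 : Summable fun m => ‖rieszCoeff α i f (lift m i)‖ ^ 2 := by
    refine Summable.of_nonneg_of_le (fun m => by positivity) (fun m => ?_)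
      (h1.comp_injective (lift_injective i))
    rw [Real.norm_eq_abs, sq_abs]
    exact sq_rieszCoeff_le hα i f _
  have h3 := ((orthonormal_phiL2 (raise_gt hα i)).orthogonalFamily.summable_iff_norm_sq_summable
    fun m => rieszCoeff α i f (lift m i)).mpr h2
  refine h3.congr fun m => ?_
  simp [lower_lift]

lemma riesz_term_eq (α : Fin d → ℝ) (i : Fin d) (f : (Fin d → ℝ) → ℝ) (k : Fin d → ℕ)
    {x : Fin d → ℝ} (hx : x ∈ orthant d) :
    eigenvalue α k ^ (-(1 / 2) : ℝ) * coeff α f k * delta α i (phi α k) x =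
      rieszCoeff α i f k * phi (raise α i) (lower k i) x := by
  rw [delta_phi_eq α k i hx, rieszCoeff]; ring

/-- The series defining the Riesz transforms converges unconditionally in `L²`. -/
theorem exists_isRieszTransform {α : Fin d → ℝ} (hα : ∀ i, 1 / 2 < α i) (i : Fin d)
    {f : (Fin d → ℝ) → ℝ} (hf : MemLp f 2 (mu d)) : ∃ g, IsRieszTransform α i f g := by
  obtain ⟨G, hG⟩ := summable_rieszCoeff_smul hα i hf
  refine ⟨G, Lp.memLp G, ?_⟩
  have h1 : Tendsto (fun s => ‖G - ∑ k ∈ s, rieszCoeff α i f k •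
      phiL2 (raise_gt hα i) (lower k i)‖ₑ) atTop (𝓝 0) := by
    have := (tendsto_const_nhds (x := G)).sub (show Tendsto _ _ _ from hG)
    rw [sub_self] at this
    simpa using this.enorm
  refine h1.congr fun s => ?_
  rw [Lp.enorm_def]
  refine eLpNorm_congr_ae ?_
  filter_upwards [Lp.coeFn_sub G (∑ k ∈ s, rieszCoeff α i f k •
      phiL2 (raise_gt hα i) (lower k i)),
    coeFn_sum_smul_toLp s (rieszCoeff α i f) (fun k =>
      memLp_phi (raise_gt hα i) (lower k i) (p := 2) two_ne_zero (by simp)),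
    ae_mu fun x (hx : x ∈ orthant d) => hx] with x h2 h3 hx
  rw [h2, Pi.sub_apply]
  congr 1
  refine h3.trans (Finset.sum_congr rfl fun k _ => (riesz_term_eq α i f k hx).symm)

lemma IsRieszTransform.congr_ae {α : Fin d → ℝ} {i : Fin d} {f g g' : (Fin d → ℝ) → ℝ}
    (h : IsRieszTransform α i f g) (e : g' =ᵐ[mu d] g) : IsRieszTransform α i f g' := by
  refine ⟨(memLp_congr_ae e).mpr h.1, h.2.congr fun s => eLpNorm_congr_ae ?_⟩
  filter_upwards [e] with x hx
  rw [hx]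

/-- The coefficients of the Riesz transform of an `L²` function. -/
lemma IsRieszTransform.integral_mul_phi {α : Fin d → ℝ} (hα : ∀ i, 1 / 2 < α i) {i : Fin d}
    {f g : (Fin d → ℝ) → ℝ} (h : IsRieszTransform α i f g) (m : Fin d → ℕ) :
    ∫ x, g x * phi (raise α i) m x ∂(mu d) = rieszCoeff α i f (lift m i) := by
  classical
  have hβ := raise_gt hα i
  have hψ := memLp_phi hβ m (p := 2) two_ne_zero (by simp)
  set S : Finset (Fin d → ℕ) → (Fin d → ℝ) → ℝ := fun s x =>
    ∑ k ∈ s, rieszCoeff α i f k * phi (raise α i) (lower k i) x with hS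
  have hSm : ∀ s, MemLp (S s) 2 (mu d) := fun s =>
    memLp_finsetSum _ fun k _ => (memLp_phi hβ _ two_ne_zero (by simp)).const_mul _
  have hSi : ∀ s, lift m i ∈ s → ∫ x, S s x * phi (raise α i) m x ∂(mu d) =
      rieszCoeff α i f (lift m i) := by
    intro s hs
    have := (integral_sum_mul_sum hβ s (rieszCoeff α i f) (fun k => lower k i)
      (Finsupp.single m 1) (fun _ => 1)).2
    rw [Finsupp.support_single _ one_ne_zero] at this
    simp only [Finset.sum_singleton, Finsupp.single_eq_same, mul_one, one_mul] at this
    rw [this, Finset.sum_eq_single_of_mem _ hs]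
    · rw [lower_lift, Finsupp.single_eq_same, mul_one]
    · intro k _ hk
      rcases eq_or_ne (k i) 0 with h0 | h0
      · simp [rieszCoeff, h0]
      · rw [Finsupp.single_eq_of_ne, mul_zero]
        intro e
        exact hk (by rw [← e, lift_lower h0])
  have h1 : Tendsto (fun s => eLpNorm (fun x => g x - S s x) 2 (mu d) *
      eLpNorm (phi (raise α i) m) 2 (mu d)) atTop (𝓝 0) := by
    have h2 : Tendsto (fun s => eLpNorm (fun x => g x - S s x) 2 (mu d)) atTop (𝓝 0) := by
      refine h.2.congr fun s => eLpNorm_congr_ae (ae_mu fun x hx => ?_)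
      simp only [hS]
      congr 1
      exact Finset.sum_congr rfl fun k _ => riesz_term_eq α i f k hx
    simpa using ENNReal.Tendsto.mul_const h2 (Or.inr hψ.eLpNorm_ne_top)
  have h3 : ∀ s, lift m i ∈ s →
      ‖∫ x, g x * phi (raise α i) m x ∂(mu d) - rieszCoeff α i f (lift m i)‖ₑ ≤
      eLpNorm (fun x => g x - S s x) 2 (mu d) * eLpNorm (phi (raise α i) m) 2 (mu d) := by
    intro s hs
    have i1 : Integrable (fun x => g x * phi (raise α i) m x) (mu d) := h.1.integrable_mul hψ
    have i2 : Integrable (fun x => S s x * phi (raise α i) m x) (mu d) := (hSm s).integrable_mul hψ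
    rw [← hSi s hs, ← integral_sub i1 i2]
    refine (enorm_integral_le_lintegral_enorm _).trans ?_
    have := eLpNorm_smul_le_mul_eLpNorm (p := 2) (q := 2) (r := 1) (μ := mu d)
      hψ.aestronglyMeasurable (h.1.sub (hSm s)).aestronglyMeasurable
    rw [eLpNorm_one_eq_lintegral_enorm] at this
    refine le_trans (le_of_eq ?_) this
    refine lintegral_congr fun x => ?_
    simp [sub_mul]
  have h4 : ‖∫ x, g x * phi (raise α i) m x ∂(mu d) - rieszCoeff α i f (lift m i)‖ₑ ≤ 0 :=
    ge_of_tendsto h1 ((eventually_ge_atTop {lift m i}).mono fun s hs =>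
      h3 s (hs (Finset.mem_singleton_self _)))
  exact sub_eq_zero.mp (enorm_eq_zero.mp (le_antisymm h4 bot_le))

/-- The Riesz transform of an `L²` function is determined by its coefficients. -/
lemma isRieszTransform_of_integral_mul_phi {α : Fin d → ℝ} (hα : ∀ i, 1 / 2 < α i) {i : Fin d}
    {f u : (Fin d → ℝ) → ℝ} (hf : MemLp f 2 (mu d))
    (hu : Integrable (fun x => u x * gauss (1 / 8) x) (mu d))
    (h : ∀ m, ∫ x, u x * phi (raise α i) m x ∂(mu d) = rieszCoeff α i f (lift m i)) :
    IsRieszTransform α i f u := by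
  obtain ⟨g, hg⟩ := exists_isRieszTransform hα i hf
  have hβ := raise_gt hα i
  have hgi := integrable_mul_gauss (by norm_num) hg.1
  refine hg.congr_ae ?_
  have := ae_eq_zero_of_integral_mul_phi hβ (u := fun x => u x - g x)
    ((hu.sub hgi).congr (ae_of_all _ fun x => (sub_mul _ _ _).symm)) fun m => by
      simp only [sub_mul]
      rw [integral_sub (integrable_mul_phi hβ hu m) (integrable_mul_phi hβ hgi m), h,
        hg.integral_mul_phi hα, sub_self]
  filter_upwards [this] with x hx
  exact sub_eq_zero.mp hx

end

section

/-! ### Duality and scaling -/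

variable {d : ℕ}

section Duality

variable {X V : Type*} [MeasurableSpace X] {μ : Measure X} [NormedAddCommGroup V]

lemma norm_toLp_eq {p : ℝ≥0∞} (hp : p ≠ 0) (hp' : p ≠ ∞) {F : X → V} (hF : MemLp F p μ) :
    ‖hF.toLp F‖ = (∫ x, ‖F x‖ ^ p.toReal ∂μ) ^ p.toReal⁻¹ := by
  rw [Lp.norm_toLp, hF.eLpNorm_eq_integral_rpow_norm hp hp', ENNReal.toReal_ofReal]
  exact Real.rpow_nonneg (integral_nonneg fun x => by positivity) _

variable [InnerProductSpace ℝ V]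

/-- The `L^p` norm is bounded through the duality with `L^q`; the extremal function is
`|G|^(p-2) G`. -/
lemma norm_le_of_inner_le {p q : ℝ≥0∞} (hpq : p.toReal.HolderConjugate q.toReal)
    (G : Lp V p μ) {B : ℝ} (hB : ∀ h : Lp V q μ, ∫ x, inner ℝ (G x) (h x) ∂μ ≤ B * ‖h‖)
    (hB0 : 0 ≤ B) : ‖G‖ ≤ B := by
  set P := p.toReal with hP
  set Q := q.toReal with hQ
  have hp := ENNReal.toReal_pos_iff.mp hpq.pos
  have hq := ENNReal.toReal_pos_iff.mp hpq.symm.pos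
  have hP1 := hpq.lt
  have hG := Lp.memLp G
  set R : X → ℝ := fun x => ‖G x‖ with hR
  set H : X → V := fun x => R x ^ (P - 2) • G x with hH
  have hHm : AEStronglyMeasurable H μ :=
    (hG.aestronglyMeasurable.norm.aemeasurable.pow_const _).aestronglyMeasurable.smul
      hG.aestronglyMeasurable
  have hHn : ∀ x, ‖H x‖ = R x ^ (P - 1) := by
    intro x
    have h0 : 0 ≤ R x := norm_nonneg _
    rw [hH, norm_smul, Real.norm_of_nonneg (Real.rpow_nonneg h0 _)]
    change R x ^ (P - 2) * R x = _
    rcases h0.eq_or_lt with h | h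
    · rw [← h, mul_zero, Real.zero_rpow (by linarith)]
    · rw [← Real.rpow_add_one h.ne']; ring_nf
  have hHq : ∀ x, ‖H x‖ ^ Q = R x ^ P := by
    intro x
    have e : (P - 1) * Q = P := by rw [sub_mul, one_mul, hpq.mul_eq_add, add_sub_cancel_right]
    rw [hHn, ← Real.rpow_mul (norm_nonneg _), e]
  have hi := hG.integrable_norm_rpow hp.1.ne' hp.2.ne
  have hHL : MemLp H q μ := by
    rw [← integrable_norm_rpow_iff hHm hq.1.ne' hq.2.ne]
    exact hi.congr (ae_of_all _ fun x => (hHq x).symm)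
  have hGn : ‖G‖ = (∫ x, R x ^ P ∂μ) ^ P⁻¹ := by
    have := norm_toLp_eq hp.1.ne' hp.2.ne hG
    rwa [Lp.toLp_coeFn] at this
  have hI0 : 0 ≤ ∫ x, R x ^ P ∂μ := integral_nonneg fun x => Real.rpow_nonneg (norm_nonneg _) _
  have key := hB (hHL.toLp H)
  rw [norm_toLp_eq hq.1.ne' hq.2.ne hHL] at key
  simp only [← hQ, hHq] at key
  have e : ∫ x, inner ℝ (G x) (hHL.toLp H x) ∂μ = ∫ x, R x ^ P ∂μ := by
    refine integral_congr_ae ?_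
    filter_upwards [hHL.coeFn_toLp] with x hx
    rw [hx, hH, inner_smul_right, real_inner_self_eq_norm_sq]
    have h0 : 0 ≤ R x := norm_nonneg _
    change R x ^ (P - 2) * R x ^ 2 = _
    rcases h0.eq_or_lt with h | h
    · rw [← h, Real.zero_rpow hpq.pos.ne']; simp
    · rw [← Real.rpow_natCast, ← Real.rpow_add h]; norm_num
  rw [e] at key
  rw [hGn]
  rcases hI0.eq_or_lt with h | h
  · rw [← h, Real.zero_rpow (inv_ne_zero hpq.pos.ne')]; exact hB0
  · set I := ∫ x, R x ^ P ∂μ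
    have e2 : I = I ^ P⁻¹ * I ^ Q⁻¹ := by
      rw [← Real.rpow_add h, hpq.inv_add_inv_eq_one, Real.rpow_one]
    have h3 : 0 < I ^ Q⁻¹ := Real.rpow_pos_of_pos h _
    exact le_of_mul_le_mul_right (by rw [← e2]; exact key) h3

end Duality

/-- The scaling argument that turns an additive estimate into a multiplicative one. -/
lemma le_mul_of_scaled {X k a b N M P Q : ℝ} (hN : 0 ≤ N) (hM : 0 ≤ M) (hk : 0 ≤ k) (ha : 0 ≤ a)
    (hb : 0 ≤ b) (hP : 0 < P) (hQ : 0 < Q)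
    (h : ∀ s > 0, ∀ t > 0, s * t * X ≤ k * (a * (t ^ Q * M ^ Q) + b * (s ^ P * N ^ P))) :
    X ≤ k * (a + b) * N * M := by
  have key : ∀ η > 0, X ≤ k * (a + b) * (N + η) * (M + η) := by
    intro η hη
    have hs : 0 < N + η := by linarith
    have ht : 0 < M + η := by linarith
    have h1 := h (N + η)⁻¹ (inv_pos.mpr hs) (M + η)⁻¹ (inv_pos.mpr ht)
    have h2 : (M + η)⁻¹ ^ Q * M ^ Q ≤ 1 := by
      rw [← Real.mul_rpow (by positivity) hM]
      refine Real.rpow_le_one (by positivity) ?_ hQ.le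
      rw [inv_mul_le_iff₀ ht]; linarith
    have h3 : (N + η)⁻¹ ^ P * N ^ P ≤ 1 := by
      rw [← Real.mul_rpow (by positivity) hN]
      refine Real.rpow_le_one (by positivity) ?_ hP.le
      rw [inv_mul_le_iff₀ hs]; linarith
    have h4 : (N + η)⁻¹ * (M + η)⁻¹ * X ≤ k * (a * 1 + b * 1) := h1.trans (by gcongr)
    rw [← mul_inv, inv_mul_le_iff₀ (by positivity)] at h4
    linarith
  have hlim : Tendsto (fun η : ℝ => k * (a + b) * (N + η) * (M + η)) (𝓝[>] 0)
      (𝓝 (k * (a + b) * (N + 0) * (M + 0))) :=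
    ((by fun_prop : Continuous fun η : ℝ => k * (a + b) * (N + η) * (M + η)).tendsto 0).mono_left
      nhdsWithin_le_nhds
  rw [add_zero, add_zero] at hlim
  exact ge_of_tendsto hlim (eventually_nhdsWithin_of_forall key)

lemma rieszForm_smul (α : Fin d → ℝ) {s t : ℝ} (hs : s ≠ 0) (c : (Fin d → ℕ) →₀ ℝ)
    (g : Fin d → (Fin d → ℕ) →₀ ℝ) :
    rieszForm α (s • c) (fun i => t • g i) = s * t * rieszForm α c g := by
  rw [rieszForm, rieszForm, Finset.mul_sum, Finsupp.support_smul_eq hs]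
  refine Finset.sum_congr rfl fun i _ => ?_
  rw [Finset.mul_sum]
  refine Finset.sum_congr rfl fun k _ => ?_
  simp only [Finsupp.smul_apply, smul_eq_mul]
  ring

lemma integral_rpow_scaled {ι : Type*} [Fintype ι] {X : Type*} [MeasurableSpace X]
    {μ : Measure X} (F : ι → X → ℝ) {t : ℝ} (ht : 0 ≤ t) (Q : ℝ) :
    ∫ x, (∑ i, (t * F i x) ^ 2) ^ (Q / 2) ∂μ = t ^ Q * ∫ x, (∑ i, F i x ^ 2) ^ (Q / 2) ∂μ := by
  rw [← integral_const_mul]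
  congr 1
  funext x
  have h0 : 0 ≤ ∑ i, F i x ^ 2 := Finset.sum_nonneg fun i _ => sq_nonneg _
  simp only [mul_pow, ← Finset.mul_sum]
  rw [Real.mul_rpow (sq_nonneg t) h0, ← Real.rpow_natCast t 2, ← Real.rpow_mul ht]
  congr 2
  push_cast
  ring

lemma one_sub_bellExp {P Q : ℝ} (h : P.HolderConjugate Q) : 1 - bellExp P = Q / 2 := by
  have h1 : P - 1 ≠ 0 := by linarith [h.lt]
  rw [bellExp, h.conjugate_eq]
  field_simp
  ring

/-- The dimension-free bilinear estimate in multiplicative form. -/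
theorem rieszForm_le [NeZero d] {α : Fin d → ℝ} (hα : ∀ i, 1 / 2 < α i) {P Q : ℝ}
    (hPQ : P.HolderConjugate Q) (c : (Fin d → ℕ) →₀ ℝ) (g : Fin d → (Fin d → ℕ) →₀ ℝ) :
    rieszForm α c g ≤ 24 * (1 + √(constC α)) * (pStar P - 1) *
      (∫ x, (comb α c x ^ 2) ^ (P / 2) ∂(mu d)) ^ P⁻¹ *
      (∫ x, (∑ i, comb (raise α i) (g i) x ^ 2) ^ (Q / 2) ∂(mu d)) ^ Q⁻¹ := by
  set A := ∫ x, (comb α c x ^ 2) ^ (P / 2) ∂(mu d) with hA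
  set B := ∫ x, (∑ i, comb (raise α i) (g i) x ^ 2) ^ (Q / 2) ∂(mu d) with hB
  have hA0 : 0 ≤ A := integral_nonneg fun x => Real.rpow_nonneg (sq_nonneg _) _
  have hB0 : 0 ≤ B := integral_nonneg fun x =>
    Real.rpow_nonneg (Finset.sum_nonneg fun i _ => sq_nonneg _) _
  have hAP : (A ^ P⁻¹) ^ P = A := Real.rpow_inv_rpow hA0 hPQ.pos.ne'
  have hBQ : (B ^ Q⁻¹) ^ Q = B := Real.rpow_inv_rpow hB0 hPQ.symm.pos.ne'
  have hN : 0 ≤ A ^ P⁻¹ := Real.rpow_nonneg hA0 _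
  have hM : 0 ≤ B ^ Q⁻¹ := Real.rpow_nonneg hB0 _
  have hk : 0 ≤ 2 * (1 + √(constC α)) := by positivity
  have hsA : ∀ s > 0, ∫ x, (comb α (s • c) x ^ 2) ^ (P / 2) ∂(mu d) = s ^ P * A := by
    intro s hs
    have := integral_rpow_scaled (μ := mu d) (fun _ : Unit => comb α c) (le_of_lt hs) P
    simpa [comb_smul] using this
  have hsB : ∀ t > 0, ∫ x, (∑ i, comb (raise α i) (t • g i) x ^ 2) ^ (Q / 2) ∂(mu d) =
      t ^ Q * B := by
    intro t ht
    simp only [comb_smul]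
    exact integral_rpow_scaled (fun i => comb (raise α i) (g i)) (le_of_lt ht) Q
  have hstar : ∀ r : ℝ, 2 ≤ r → r ≤ pStar P → rieszForm α c g ≤
      2 * (1 + √(constC α)) * ((6 * (r - 1) + 1) + 2) * A ^ P⁻¹ * B ^ Q⁻¹ →
      rieszForm α c g ≤ 24 * (1 + √(constC α)) * (pStar P - 1) * A ^ P⁻¹ * B ^ Q⁻¹ := by
    intro r hr hrp h
    refine h.trans ?_
    have : 2 * (1 + √(constC α)) * ((6 * (r - 1) + 1) + 2) ≤
        24 * (1 + √(constC α)) * (pStar P - 1) := by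
      have h1 : (6 * (r - 1) + 1) + 2 ≤ 12 * (pStar P - 1) := by linarith
      calc _ ≤ 2 * (1 + √(constC α)) * (12 * (pStar P - 1)) := mul_le_mul_of_nonneg_left h1 hk
        _ = _ := by ring
    gcongr
  rcases le_total 2 P with hp | hp
  · refine hstar P hp (le_max_left _ _) (le_mul_of_scaled hN hM hk (by linarith) zero_le_two
      hPQ.pos hPQ.symm.pos fun s hs t ht => ?_)
    have h := rieszForm_le_of_two_le hα hp (s • c) (fun i => t • g i)
    rwa [rieszForm_smul α hs.ne', one_sub_bellExp hPQ, hsA s hs, hsB t ht, ← hAP, ← hBQ] at h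
  · have hq : 2 ≤ Q := by
      rw [hPQ.conjugate_eq, le_div_iff₀ (by linarith [hPQ.lt])]; linarith
    have hQs : Q ≤ pStar P := by rw [pStar, ← hPQ.conjugate_eq]; exact le_max_right _ _
    refine hstar Q hq hQs ?_
    have := le_mul_of_scaled (X := rieszForm α c g) (a := 6 * (Q - 1) + 1) (b := 2) hM hN hk
      (by linarith) zero_le_two hPQ.symm.pos hPQ.pos fun t ht s hs => by
        have h := rieszForm_le_of_two_le' hα hq (s • c) (fun i => t • g i)
        rw [rieszForm_smul α hs.ne', one_sub_bellExp hPQ.symm, hsA s hs, hsB t ht, ← hAP,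
          ← hBQ] at h
        rw [mul_comm t s]
        exact h
    calc _ ≤ _ := this
      _ = _ := by ring

end

section

/-! ### The extension to `L^p` -/

variable {d : ℕ}

lemma ne_zero_of_fact (p : ℝ≥0∞) [Fact (1 ≤ p)] : p ≠ 0 :=
  (one_pos.trans_le (Fact.out : 1 ≤ p)).ne'

lemma norm_rpow_eq_sq_rpow (y P : ℝ) : ‖y‖ ^ P = (y ^ 2) ^ (P / 2) := by
  rw [← sq_abs, ← Real.rpow_natCast, ← Real.rpow_mul (abs_nonneg y), Real.norm_eq_abs]
  congr 1
  push_cast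
  ring

lemma norm_rpow_eq_sum_sq_rpow (v : EuclideanSpace ℝ (Fin d)) (P : ℝ) :
    ‖v‖ ^ P = (∑ i, v i ^ 2) ^ (P / 2) := by
  have h := EuclideanSpace.norm_sq_eq v
  simp only [Real.norm_eq_abs, sq_abs] at h
  rw [← h, ← norm_rpow_eq_sq_rpow, norm_norm]

/-- The `L^p` class of a finite combination of the `φ_k^β`. -/
def combLp {β : Fin d → ℝ} (hβ : ∀ i, 1 / 2 < β i) (p : ℝ≥0∞) [Fact (1 ≤ p)] (hp' : p ≠ ∞) :
    ((Fin d → ℕ) →₀ ℝ) →ₗ[ℝ] Lp ℝ p (mu d) where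
  toFun c := (memLp_comb hβ c (ne_zero_of_fact p) hp').toLp (comb β c)
  map_add' c c' := by
    rw [← MemLp.toLp_add]
    exact MemLp.toLp_congr _ _ (ae_of_all _ fun x => comb_add β c c' x)
  map_smul' r c := by
    rw [RingHom.id_apply, ← MemLp.toLp_const_smul]
    exact MemLp.toLp_congr _ _ (ae_of_all _ fun x => comb_smul β r c x)

lemma coeFn_combLp {β : Fin d → ℝ} (hβ : ∀ i, 1 / 2 < β i) (p : ℝ≥0∞) [Fact (1 ≤ p)]
    (hp' : p ≠ ∞) (c : (Fin d → ℕ) →₀ ℝ) : combLp hβ p hp' c =ᵐ[mu d] comb β c :=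
  (memLp_comb hβ c (ne_zero_of_fact p) hp').coeFn_toLp

lemma denseRange_combLp {β : Fin d → ℝ} (hβ : ∀ i, 1 / 2 < β i) (p : ℝ≥0∞) [Fact (1 ≤ p)]
    (hp' : p ≠ ∞) : DenseRange (combLp hβ p hp') := by
  refine Metric.denseRange_iff.mpr fun f r hr => ?_
  obtain ⟨c, hc⟩ := exists_comb_eLpNorm_sub_le hβ Fact.out hp' (Lp.memLp f)
    (ε := ENNReal.ofReal (r / 2)) (by simpa using hr)
  refine ⟨c, lt_of_le_of_lt ((edist_le_ofReal (by positivity)).mp ?_) (half_lt_self hr)⟩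
  rw [Lp.edist_def]
  refine le_trans (le_of_eq (eLpNorm_congr_ae ?_)) hc
  filter_upwards [coeFn_combLp hβ p hp' c] with x hx
  rw [Pi.sub_apply, hx]

/-- The vector with components `∑ g_i φ^{α+e_i}`. -/
def combVec (α : Fin d → ℝ) (g : Fin d → (Fin d → ℕ) →₀ ℝ) (x : Fin d → ℝ) :
    EuclideanSpace ℝ (Fin d) := WithLp.toLp 2 fun i => comb (raise α i) (g i) x

lemma memLp_combVec {α : Fin d → ℝ} (hα : ∀ i, 1 / 2 < α i) (g : Fin d → (Fin d → ℕ) →₀ ℝ)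
    {p : ℝ≥0∞} (hp : p ≠ 0) (hp' : p ≠ ∞) : MemLp (combVec α g) p (mu d) :=
  MemLp.of_eval_piLp fun i => memLp_comb (raise_gt hα i) (g i) hp hp'

lemma denseRange_combVec {α : Fin d → ℝ} (hα : ∀ i, 1 / 2 < α i) (p : ℝ≥0∞) [Fact (1 ≤ p)]
    (hp' : p ≠ ∞) :
    DenseRange fun g => (memLp_combVec hα g (ne_zero_of_fact p) hp').toLp (combVec α g) := by
  refine Metric.denseRange_iff.mpr fun h r hr => ?_
  have hp0 := ne_zero_of_fact p
  have hh := fun i => MemLp.eval_piLp (Lp.memLp h) i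
  have hε : ENNReal.ofReal (r / 2) / d ≠ 0 := by simp [hr]
  choose g hg using fun i => exists_comb_eLpNorm_sub_le (raise_gt hα i) Fact.out hp' (hh i) hε
  refine ⟨g, lt_of_le_of_lt ((edist_le_ofReal (by positivity)).mp ?_) (half_lt_self hr)⟩
  rw [Lp.edist_def]
  have hm : ∀ i, MemLp (fun x => h x i - comb (raise α i) (g i) x) p (mu d) := fun i =>
    (hh i).sub (memLp_comb (raise_gt hα i) (g i) hp0 hp')
  calc _ ≤ eLpNorm (∑ i, fun x => ‖h x i - comb (raise α i) (g i) x‖) p (mu d) := by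
        refine eLpNorm_mono_ae ?_
        filter_upwards [(memLp_combVec hα g hp0 hp').coeFn_toLp] with x hx
        rw [Pi.sub_apply, hx, Finset.sum_apply, Real.norm_of_nonneg
          (Finset.sum_nonneg fun i _ => norm_nonneg _), EuclideanSpace.norm_eq]
        refine Real.sqrt_le_iff.mpr ⟨Finset.sum_nonneg fun i _ => norm_nonneg _, ?_⟩
        exact Finset.sum_sq_le_sq_sum_of_nonneg fun i _ => norm_nonneg _
    _ ≤ ∑ i, eLpNorm (fun x => ‖h x i - comb (raise α i) (g i) x‖) p (mu d) :=
        eLpNorm_sum_le (fun i _ => (hm i).aestronglyMeasurable.norm) Fact.out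
    _ ≤ ∑ i : Fin d, ENNReal.ofReal (r / 2) / d := by
        refine Finset.sum_le_sum fun i _ => ?_
        rw [eLpNorm_norm (fun x => h x i - comb (raise α i) (g i) x)]
        exact hg i
    _ ≤ _ := by
        rw [Finset.sum_const, Finset.card_univ, Fintype.card_fin, nsmul_eq_mul]
        exact ENNReal.mul_div_le

/-- The vector of Riesz transforms of `comb α c`. -/
def rieszVec (α : Fin d → ℝ) (c : (Fin d → ℕ) →₀ ℝ) (x : Fin d → ℝ) : EuclideanSpace ℝ (Fin d) :=
  WithLp.toLp 2 fun i => rieszComb α c i x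

lemma rieszComb_eq_linearCombination (α : Fin d → ℝ) (c : (Fin d → ℕ) →₀ ℝ) (i : Fin d)
    (x : Fin d → ℝ) : rieszComb α c i x = Finsupp.linearCombination ℝ (fun k =>
      eigenvalue α k ^ (-(1 / 2) : ℝ) * (-2 * √(k i : ℝ)) * phi (raise α i) (lower k i) x) c := by
  rw [Finsupp.linearCombination_apply, Finsupp.sum, rieszComb]
  refine Finset.sum_congr rfl fun k _ => ?_
  rw [smul_eq_mul]; ring

lemma memLp_rieszComb {α : Fin d → ℝ} (hα : ∀ i, 1 / 2 < α i) (c : (Fin d → ℕ) →₀ ℝ) (i : Fin d)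
    {p : ℝ≥0∞} (hp : p ≠ 0) (hp' : p ≠ ∞) : MemLp (rieszComb α c i) p (mu d) := by
  unfold rieszComb
  exact memLp_finsetSum _ fun k _ => (memLp_phi (raise_gt hα i) _ hp hp').const_mul _

lemma memLp_rieszVec {α : Fin d → ℝ} (hα : ∀ i, 1 / 2 < α i) (c : (Fin d → ℕ) →₀ ℝ)
    {p : ℝ≥0∞} (hp : p ≠ 0) (hp' : p ≠ ∞) : MemLp (rieszVec α c) p (mu d) :=
  MemLp.of_eval_piLp fun i => memLp_rieszComb hα c i hp hp'

/-- The vector of Riesz transforms as a linear map on finite combinations. -/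
def rieszLp {α : Fin d → ℝ} (hα : ∀ i, 1 / 2 < α i) (p : ℝ≥0∞) [Fact (1 ≤ p)] (hp' : p ≠ ∞) :
    ((Fin d → ℕ) →₀ ℝ) →ₗ[ℝ] Lp (EuclideanSpace ℝ (Fin d)) p (mu d) where
  toFun c := (memLp_rieszVec hα c (ne_zero_of_fact p) hp').toLp (rieszVec α c)
  map_add' c c' := by
    rw [← MemLp.toLp_add]
    refine MemLp.toLp_congr _ _ (ae_of_all _ fun x => ?_)
    ext i
    simp [rieszVec, rieszComb_eq_linearCombination]
  map_smul' r c := by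
    rw [RingHom.id_apply, ← MemLp.toLp_const_smul]
    refine MemLp.toLp_congr _ _ (ae_of_all _ fun x => ?_)
    ext i
    simp [rieszVec, rieszComb_eq_linearCombination]

lemma coeFn_rieszLp {α : Fin d → ℝ} (hα : ∀ i, 1 / 2 < α i) (p : ℝ≥0∞) [Fact (1 ≤ p)]
    (hp' : p ≠ ∞) (c : (Fin d → ℕ) →₀ ℝ) : rieszLp hα p hp' c =ᵐ[mu d] rieszVec α c :=
  (memLp_rieszVec hα c (ne_zero_of_fact p) hp').coeFn_toLp

/-- The `L^p` estimate for the Riesz transforms on the dense class of finite combinations. -/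
theorem norm_rieszLp_le [NeZero d] {α : Fin d → ℝ} (hα : ∀ i, 1 / 2 < α i) {p : ℝ≥0∞}
    [Fact (1 ≤ p)] (hp : 1 < p) (hp' : p ≠ ∞) (c : (Fin d → ℕ) →₀ ℝ) :
    ‖rieszLp hα p hp' c‖ ≤
      24 * (1 + √(constC α)) * (pStar p.toReal - 1) * ‖combLp hα p hp' c‖ := by
  have hp1 : 1 < p.toReal := by
    rw [← ENNReal.toReal_one]
    exact (ENNReal.toReal_lt_toReal ENNReal.one_ne_top hp').mpr hp
  have hconj : p.HolderConjugate p.conjExponent := ENNReal.HolderConjugate.conjExponent hp.le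
  set q := p.conjExponent with hq
  have hpq : p.toReal.HolderConjugate q.toReal :=
    (ENNReal.HolderConjugate.toReal_iff hp1).mpr hconj
  have hq' := ENNReal.toReal_pos_iff.mp hpq.symm.pos
  have : Fact (1 ≤ q) := ⟨hconj.symm.one_le⟩
  have hK : 0 ≤ 24 * (1 + √(constC α)) * (pStar p.toReal - 1) := by
    have : p.toReal ≤ pStar p.toReal := le_max_left _ _
    have : 0 ≤ pStar p.toReal - 1 := by linarith
    positivity
  refine norm_le_of_inner_le hpq _ (fun h => ?_) (by positivity)
  have hpair : ∀ h : Lp (EuclideanSpace ℝ (Fin d)) q (mu d),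
      ContinuousLinearMap.lpPairing (mu d) p q
        (innerSL ℝ : EuclideanSpace ℝ (Fin d) →L[ℝ] EuclideanSpace ℝ (Fin d) →L[ℝ] ℝ)
        (rieszLp hα p hp' c) h = ∫ x, inner ℝ (rieszLp hα p hp' c x) (h x) ∂(mu d) := fun h =>
    ContinuousLinearMap.lpPairing_eq_integral _ _ _
  rw [← hpair]
  refine (denseRange_combVec hα q hq'.2.ne).induction_on h
    (isClosed_le (by fun_prop) (by fun_prop)) fun g => ?_
  rw [hpair]
  have e1 : ∫ x, inner ℝ (rieszLp hα p hp' c x)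
      ((memLp_combVec hα g (ne_zero_of_fact q) hq'.2.ne).toLp (combVec α g) x) ∂(mu d) =
      rieszForm α c g := by
    have e2 : ∫ x, inner ℝ (rieszLp hα p hp' c x)
        ((memLp_combVec hα g (ne_zero_of_fact q) hq'.2.ne).toLp (combVec α g) x) ∂(mu d) =
        ∫ x, ∑ i, rieszComb α c i x * comb (raise α i) (g i) x ∂(mu d) := by
      refine integral_congr_ae ?_
      filter_upwards [coeFn_rieszLp hα p hp' c,
        (memLp_combVec hα g (ne_zero_of_fact q) hq'.2.ne).coeFn_toLp] with x h1 h2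
      rw [h1, h2, PiLp.inner_apply]
      refine Finset.sum_congr rfl fun i _ => ?_
      simp [rieszVec, combVec, mul_comm]
    rw [e2, integral_finsetSum]
    · exact Finset.sum_congr rfl fun i _ => integral_rieszComb_mul_comb hα c (g i) i
    · intro i _
      exact (memLp_rieszComb hα c i two_ne_zero (by simp)).integrable_mul
        (memLp_comb (raise_gt hα i) (g i) two_ne_zero (by simp))
  rw [e1]
  refine (rieszForm_le hα hpq c g).trans (le_of_eq ?_)
  congr 1
  · congr 1
    change _ = ‖(memLp_comb hα c (ne_zero_of_fact p) hp').toLp (comb α c)‖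
    rw [norm_toLp_eq (ne_zero_of_fact p) hp']
    simp only [norm_rpow_eq_sq_rpow]
  · rw [norm_toLp_eq (ne_zero_of_fact q) hq'.2.ne]
    simp only [norm_rpow_eq_sum_sq_rpow, combVec]

/-- Integration against `φ_m^β`, as a functional on `L^p`. -/
lemma exists_clm_integral_mul_phi {β : Fin d → ℝ} (hβ : ∀ i, 1 / 2 < β i) {p : ℝ≥0∞}
    [Fact (1 ≤ p)] (hp : 1 < p) (m : Fin d → ℕ) :
    ∃ ℓ : Lp ℝ p (mu d) →L[ℝ] ℝ, ∀ f, ℓ f = ∫ x, f x * phi β m x ∂(mu d) := by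
  have hconj : p.HolderConjugate p.conjExponent := ENNReal.HolderConjugate.conjExponent hp.le
  set q := p.conjExponent with hq
  have : Fact (1 ≤ q) := ⟨hconj.symm.one_le⟩
  have hq' : q ≠ ∞ := by
    rw [hq, ENNReal.conjExponent]
    simp [tsub_eq_zero_iff_le, hp]
  have hφ := memLp_phi hβ m (ne_zero_of_fact q) hq'
  refine ⟨(ContinuousLinearMap.lpPairing (mu d) p q (ContinuousLinearMap.mul ℝ ℝ)).flip
    (hφ.toLp _), fun f => ?_⟩
  rw [ContinuousLinearMap.flip_apply, ContinuousLinearMap.lpPairing_eq_integral]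
  refine integral_congr_ae ?_
  filter_upwards [hφ.coeFn_toLp] with x hx
  rw [hx, ContinuousLinearMap.mul_apply']

lemma coeff_comb {α : Fin d → ℝ} (hα : ∀ i, 1 / 2 < α i) (c : (Fin d → ℕ) →₀ ℝ)
    (k : Fin d → ℕ) : coeff α (comb α c) k = c k := by
  have := (integral_sum_mul_sum hα c.support c id (Finsupp.single k 1) (fun _ => 1)).2
  rw [Finsupp.support_single _ one_ne_zero] at this
  simp only [Finset.sum_singleton, Finsupp.single_eq_same, mul_one, one_mul, id] at this
  rw [coeff]
  refine this.trans ?_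
  rw [Finset.sum_eq_single k (fun j _ hj => by rw [Finsupp.single_eq_of_ne hj, mul_zero])
    (fun h => by rw [Finsupp.notMem_support_iff.mp h, zero_mul]), Finsupp.single_eq_same, mul_one]

lemma integral_rieszComb_mul_phi {α : Fin d → ℝ} (hα : ∀ i, 1 / 2 < α i)
    (c : (Fin d → ℕ) →₀ ℝ) (i : Fin d) (m : Fin d → ℕ) :
    ∫ x, rieszComb α c i x * phi (raise α i) m x ∂(mu d) =
      rieszCoeff α i (comb α c) (lift m i) := by
  have := integral_rieszComb_mul_comb hα c (Finsupp.single m 1) i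
  simp only [comb_single] at this
  rw [this, rieszCoeff, coeff_comb hα, Finset.sum_eq_single (lift m i)]
  · rw [lower_lift, Finsupp.single_eq_same, mul_one]
  · intro k _ hk
    rcases eq_or_ne (k i) 0 with h0 | h0
    · simp [h0]
    · rw [Finsupp.single_eq_of_ne, mul_zero]
      intro e
      exact hk (by rw [← e, lift_lower h0])
  · intro h
    rw [Finsupp.notMem_support_iff.mp h]; simp

/-- The extension of the vector of Riesz transforms from finite combinations to `L^p`. It
has a meaning only through the density `denseRange_combLp` and the bound `norm_rieszLp_le`. -/
def rieszExt {α : Fin d → ℝ} (hα : ∀ i, 1 / 2 < α i) (p : ℝ≥0∞) [Fact (1 ≤ p)] (hp' : p ≠ ∞) :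
    Lp ℝ p (mu d) →L[ℝ] Lp (EuclideanSpace ℝ (Fin d)) p (mu d) :=
  (rieszLp hα p hp').extendOfNorm (combLp hα p hp')

/-- The coefficients of the extension: both sides are continuous in `f` and agree on finite
combinations. -/
lemma integral_rieszExt_mul_phi [NeZero d] {α : Fin d → ℝ} (hα : ∀ i, 1 / 2 < α i) {p : ℝ≥0∞}
    [Fact (1 ≤ p)] (hp : 1 < p) (hp' : p ≠ ∞) (f : Lp ℝ p (mu d)) (i : Fin d) (m : Fin d → ℕ) :
    ∫ x, rieszExt hα p hp' f x i * phi (raise α i) m x ∂(mu d) =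
      rieszCoeff α i f (lift m i) := by
  obtain ⟨ℓ₁, h1⟩ := exists_clm_integral_mul_phi (raise_gt hα i) hp m
  obtain ⟨ℓ₂, h2⟩ := exists_clm_integral_mul_phi hα hp (lift m i)
  set π := ContinuousLinearMap.compLpL p (mu d) (EuclideanSpace.proj i :
    EuclideanSpace ℝ (Fin d) →L[ℝ] ℝ) with hπ
  have hL : ∀ F : Lp (EuclideanSpace ℝ (Fin d)) p (mu d),
      ℓ₁ (π F) = ∫ x, F x i * phi (raise α i) m x ∂(mu d) := by
    intro F
    rw [h1]
    refine integral_congr_ae ?_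
    filter_upwards [ContinuousLinearMap.coeFn_compLpL (EuclideanSpace.proj i :
      EuclideanSpace ℝ (Fin d) →L[ℝ] ℝ) F] with x hx
    rw [hπ, hx]; rfl
  rw [← hL, rieszCoeff, coeff, ← h2]
  refine (denseRange_combLp hα p hp').induction_on f
    (isClosed_eq (by fun_prop) (by fun_prop)) fun c => ?_
  rw [hL, h2, rieszExt, LinearMap.extendOfNorm_eq (denseRange_combLp hα p hp')
    ⟨_, norm_rieszLp_le hα hp hp'⟩]
  have e1 : ∫ x, rieszLp hα p hp' c x i * phi (raise α i) m x ∂(mu d) =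
      ∫ x, rieszComb α c i x * phi (raise α i) m x ∂(mu d) := by
    refine integral_congr_ae ?_
    filter_upwards [coeFn_rieszLp hα p hp' c] with x hx
    rw [hx]; rfl
  have e2 : ∫ x, combLp hα p hp' c x * phi α (lift m i) x ∂(mu d) =
      coeff α (comb α c) (lift m i) := by
    refine integral_congr_ae ?_
    filter_upwards [coeFn_combLp hα p hp' c] with x hx
    rw [hx]
  rw [e1, e2, integral_rieszComb_mul_phi hα, rieszCoeff]

lemma extendsRiesz_rieszExt [NeZero d] {α : Fin d → ℝ} (hα : ∀ i, 1 / 2 < α i) {p : ℝ≥0∞}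
    [Fact (1 ≤ p)] (hp : 1 < p) (hp' : p ≠ ∞) : ExtendsRiesz α p (rieszExt hα p hp') :=
  fun f hf i => isRieszTransform_of_integral_mul_phi hα hf
    (integrable_mul_gauss hp (MemLp.eval_piLp (Lp.memLp _) i))
    (integral_rieszExt_mul_phi hα hp hp' f i)

/-- The requirement `ExtendsRiesz` determines an operator on the dense class of finite
combinations, hence everywhere. -/
lemma ExtendsRiesz.unique {α : Fin d → ℝ} (hα : ∀ i, 1 / 2 < α i) {p : ℝ≥0∞}
    [Fact (1 ≤ p)] (hp : 1 < p) (hp' : p ≠ ∞)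
    {T T' : Lp ℝ p (mu d) →L[ℝ] Lp (EuclideanSpace ℝ (Fin d)) p (mu d)}
    (hT : ExtendsRiesz α p T) (hT' : ExtendsRiesz α p T') : T' = T := by
  refine ContinuousLinearMap.ext fun f => ?_
  refine (denseRange_combLp hα p hp').induction_on f
    (isClosed_eq T'.continuous T.continuous) fun c => ?_
  set f := combLp hα p hp' c with hfdef
  have hf : MemLp f 2 (mu d) :=
    (memLp_congr_ae (coeFn_combLp hα p hp' c)).mpr (memLp_comb hα c two_ne_zero (by simp))
  have hi : ∀ i, ∀ᵐ x ∂(mu d), T' f x i - T f x i = 0 := by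
    intro i
    have i1 := integrable_mul_gauss hp (MemLp.eval_piLp (Lp.memLp (T f)) i)
    have i2 := integrable_mul_gauss hp (MemLp.eval_piLp (Lp.memLp (T' f)) i)
    refine ae_eq_zero_of_integral_mul_phi (raise_gt hα i)
      ((i2.sub i1).congr (ae_of_all _ fun x => (sub_mul _ _ _).symm)) fun m => ?_
    simp only [sub_mul]
    rw [integral_sub (integrable_mul_phi (raise_gt hα i) i2 m)
      (integrable_mul_phi (raise_gt hα i) i1 m), (hT' f hf i).integral_mul_phi hα,
      (hT f hf i).integral_mul_phi hα, sub_self]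
  refine Lp.ext ?_
  filter_upwards [ae_all_iff.mpr hi] with x hx
  ext i
  exact sub_eq_zero.mp (hx i)

end

end

end LaguerreHermite

theorem theorem5p5 {d : ℕ} [NeZero d] (α : Fin d → ℝ) (hα : ∀ i, 1 / 2 < α i) :
    (∀ f : (Fin d → ℝ) → ℝ, MemLp f 2 (LaguerreHermite.mu d) →
      ∀ i, ∃ g, LaguerreHermite.IsRieszTransform α i f g) ∧
    ∀ (p : ℝ≥0∞) [Fact (1 ≤ p)], 1 < p → p ≠ ∞ →
      ∃ T : Lp ℝ p (LaguerreHermite.mu d) →L[ℝ]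
          Lp (EuclideanSpace ℝ (Fin d)) p (LaguerreHermite.mu d),
        LaguerreHermite.ExtendsRiesz α p T ∧
        (∀ T' : Lp ℝ p (LaguerreHermite.mu d) →L[ℝ]
            Lp (EuclideanSpace ℝ (Fin d)) p (LaguerreHermite.mu d),
          LaguerreHermite.ExtendsRiesz α p T' → T' = T) ∧
        ∀ f : Lp ℝ p (LaguerreHermite.mu d),
          ‖T f‖ ≤ 24 * (1 + √(LaguerreHermite.constC α)) *
            (LaguerreHermite.pStar p.toReal - 1) * ‖f‖ := by
  refine ⟨fun f hf i => LaguerreHermite.exists_isRieszTransform hα i hf, fun p _ hp hp' => ?_⟩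
  have hT := LaguerreHermite.extendsRiesz_rieszExt hα hp hp'
  exact ⟨LaguerreHermite.rieszExt hα p hp', hT, fun T' hT' => hT.unique hα hp hp' hT',
    LinearMap.norm_extendOfNorm_apply_le (LaguerreHermite.denseRange_combLp hα p hp') _
      (LaguerreHermite.norm_rieszLp_le hα hp hp')⟩
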